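/- **Conventions.** Let $\mathbb F$ be a field of characteristic two. A *thin* Lie algebra over $\mathbb F$ is a graded Lie algebra $L=\bigoplus_{i\ge 1}L_i$ with $\dim L_1=2$, generated by $L_1$ (so no nonzero component follows a zero one), such that $[uL_1]=L_{i+1}$ for every $i\ge 1$ and every nonzero $u\in L_i$, and such that $L_1$ is not the only component of dimension two. Components of dimension two are called (genuine) *diamonds*; the *second diamond* is the first one, $L_k$ with $k>1$, after $L_1$. $L^j$ denotes the $j$-th term of the lower central series ($L^1=L$), and long brackets are left-normed. A *graded Lie algebra of maximal class* is a graded Lie algebra $M=\bigoplus_{i\ge1}M_i$ with $\dim M_1=2$, $\dim M_i\le 1$ for $i\ge 2$, and $[M_i,M_1]=M_{i+1}$ for $i\ge 1$. The *two-step centralizers* of $L$ are $C_{L_1}(L_i)=\{a\in L_1: [ab]=0 \text{ for all } b\in L_i\}$. A thin Lie algebra $L$ in characteristic two is *of Nottingham type with fake second diamond in degree $m$* if $L/L^{m+1}$ is metabelian and $L/L^{m+2}$ is a graded Lie algebra of maximal class that is not metabelian. For given $x,y\in L_1$, a component $L_h$ with $L_{h+1}\ne 0$ is a *diamond of type* $\mu\in\mathbb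 F$ if $L_{h-1}$ is spanned by a nonzero element $w$ with $[wxx]=0$, $[wyy]=0$ and $(1-\mu)[wxy]=\mu[wyx]$; a *fake diamond of type one* is a diamond of type $\mu=1$ with $\dim L_h=1$. **Theorem.** Let $L$ be a thin Lie algebra over a field $\mathbb F$ of characteristic two, with second (genuine) diamond $L_k$, and of (possibly infinite) dimension larger than $(4k+1)/3$. Suppose that $L/L^k$ is not metabelian, but $L/L^6$ is. Let $\mathbb F y=C_{L_1}(L_2)$ and $\mathbb F x=C_{L_1}(L_{\bar q})$ be the first two distinct two-step centralizers at their first occurrence, that is, $C_{L_1}(L_i)=\mathbb F y$ for $2\le i<\bar q$ and $\mathbb F x\ne\mathbb F y$. Then $\bar q$ is a power of two, $L$ is of Nottingham type with fake second diamond in degree $\bar q$, and: 1. each homogeneous component $L_i$, for $1<i<k-1$, is centralized by $x$ or by $y$; 2. $k=2r\bar q-1$, where $r\ge 1$ is a power of two; 3. with this $r$, the fake diamonds of type one of $L$ (with respect to $x,y$) in degrees $h$ with $1<h<k$ are exactly the fake second diamond $L_{\bar q}$ and those in the degrees $h=m\bar q-1$ for $1<m<2r$. -/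

import Mathlib

namespace ThinLie

section Generalities

variable (F : Type*) (K : Type*) [Field F] [LieRing K] [LieAlgebra F K]

/-- The Lie power `K^j` for `j ≥ 1`: the `j`-th term of the lower central series, counted
so that `K^1 = K` and `K^(j+1) = [K^j, K]` (Mathlib starts the count at `0`). -/
def liePower (j : ℕ) : LieIdeal F K :=
  LieModule.lowerCentralSeries F K K (j - 1)

/-- `K` is metabelian: its second derived algebra `[[K, K], [K, K]]` is zero. -/
def IsMetabelian : Prop :=
  LieAlgebra.derivedSeries F K 2 = ⊥

end Generalities

section Graded

variable {F : Type*} {K : Type*} [Field F] [LieRing K] [LieAlgebra F K]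

/-- `K = ⨁_{i ≥ 1} K_i` is a Lie algebra graded over the positive integers. The family is indexed
by `ℕ` and its member of index `0` is zero. -/
structure IsPositivelyGraded (𝒦 : ℕ → Submodule F K) : Prop where
  zero_eq_bot : 𝒦 0 = ⊥
  isInternal : DirectSum.IsInternal 𝒦
  bracket_mem : ∀ i j : ℕ, ∀ u ∈ 𝒦 i, ∀ v ∈ 𝒦 j, ⁅u, v⁆ ∈ 𝒦 (i + j)

/-- A graded Lie algebra of maximal class: `dim K_1 = 2`, `dim K_i ≤ 1` for `i ≥ 2`, and
`[K_i, K_1] = K_{i+1}` for `i ≥ 1`. -/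
structure IsMaximalClass (𝒦 : ℕ → Submodule F K) : Prop where
  graded : IsPositivelyGraded 𝒦
  finrank_one : Module.finrank F (𝒦 1) = 2
  rank_le_one : ∀ i : ℕ, 2 ≤ i → Module.rank F (𝒦 i) ≤ 1
  span_bracket : ∀ i : ℕ, 1 ≤ i →
    Submodule.span F {z : K | ∃ u ∈ 𝒦 i, ∃ v ∈ 𝒦 1, ⁅u, v⁆ = z} = 𝒦 (i + 1)

/-- A thin Lie algebra: a graded Lie algebra with `dim K_1 = 2` that has the covering property
`[u K_1] = K_{i+1}` for `0 ≠ u ∈ K_i`, and that has a diamond (a component of dimension two)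
besides `K_1`. The field `eq_bot_succ` completes the covering property where `K_i = 0`: it says that
no nonzero component follows a zero one, that is, that `K` is generated by `K_1`. -/
structure IsThin (𝒦 : ℕ → Submodule F K) : Prop where
  graded : IsPositivelyGraded 𝒦
  finrank_one : Module.finrank F (𝒦 1) = 2
  covering : ∀ i : ℕ, 1 ≤ i → ∀ u ∈ 𝒦 i, u ≠ 0 →
    (𝒦 1).map (LieAlgebra.ad F K u : K →ₗ[F] K) = 𝒦 (i + 1)
  eq_bot_succ : ∀ i : ℕ, 1 ≤ i → 𝒦 i = ⊥ → 𝒦 (i + 1) = ⊥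
  exists_diamond : ∃ k : ℕ, 1 < k ∧ Module.finrank F (𝒦 k) = 2

/-- `K_k` is the second (genuine) diamond: the first component of dimension two after `K_1`. -/
def IsSecondDiamond (𝒦 : ℕ → Submodule F K) (k : ℕ) : Prop :=
  1 < k ∧ Module.finrank F (𝒦 k) = 2 ∧
    ∀ i : ℕ, 1 < i → i < k → Module.finrank F (𝒦 i) ≠ 2

/-- The two-step centralizer `C_{K_1}(K_i)`. -/
def twoStepCentralizer (𝒦 : ℕ → Submodule F K) (i : ℕ) : Submodule F K where
  carrier := {a | a ∈ 𝒦 1 ∧ ∀ b ∈ 𝒦 i, ⁅a, b⁆ = 0}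
  add_mem' := fun ha hb =>
    ⟨(𝒦 1).add_mem ha.1 hb.1, fun c hc => by rw [add_lie, ha.2 c hc, hb.2 c hc, add_zero]⟩
  zero_mem' := ⟨(𝒦 1).zero_mem, fun c _ => zero_lie c⟩
  smul_mem' := fun t _ ha =>
    ⟨(𝒦 1).smul_mem t ha.1, fun c hc => by rw [smul_lie, ha.2 c hc, smul_zero]⟩

/-- `F y = C_{K_1}(K_2)` and `F x = C_{K_1}(K_qb)` are (one-dimensional and) the first two distinct
two-step centralizers, where `qb` is the degree in which the second one first occurs. -/
structure IsFirstTwoCentralizers (𝒦 : ℕ → Submodule F K) (qb : ℕ) (x y : K) : Prop where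
  x_ne_zero : x ≠ 0
  y_ne_zero : y ≠ 0
  two_le : 2 ≤ qb
  centralizer_two : twoStepCentralizer 𝒦 2 = Submodule.span F {y}
  centralizer_eq : ∀ i : ℕ, 2 ≤ i → i < qb → twoStepCentralizer 𝒦 i = Submodule.span F {y}
  centralizer_qb : twoStepCentralizer 𝒦 qb = Submodule.span F {x}
  span_ne : Submodule.span F {x} ≠ Submodule.span F {y}

/-- `K_h` is a diamond of finite type `μ` with respect to `x` and `y`: `K_{h-1}` is spanned by a
nonzero `w` with `[wxx] = 0`, `[wyy] = 0` and `(1 - μ)[wxy] = μ[wyx]` (brackets are left-normed), and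
`K_{h+1} ≠ 0`. Its dimension is not prescribed. -/
def IsDiamondOfType (𝒦 : ℕ → Submodule F K) (x y : K) (μ : F) (h : ℕ) : Prop :=
  𝒦 (h + 1) ≠ ⊥ ∧
    ∃ w : K, w ≠ 0 ∧ 𝒦 (h - 1) = Submodule.span F {w} ∧
      ⁅⁅w, x⁆, x⁆ = 0 ∧ ⁅⁅w, y⁆, y⁆ = 0 ∧
      (1 - μ) • ⁅⁅w, x⁆, y⁆ = μ • ⁅⁅w, y⁆, x⁆

/-- `K_h` is a fake diamond of type one: a diamond of type one that is one-dimensional. -/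
def IsFakeDiamondOfTypeOne (𝒦 : ℕ → Submodule F K) (x y : K) (h : ℕ) : Prop :=
  IsDiamondOfType 𝒦 x y (1 : F) h ∧ Module.finrank F (𝒦 h) = 1

/-- The family of the images of the components `K_i` in the quotient by an ideal. -/
def quotientGrading (I : LieIdeal F K) (𝒦 : ℕ → Submodule F K) : ℕ → Submodule F (K ⧸ I) :=
  fun i => (𝒦 i).map (LieSubmodule.Quotient.mk' I : K →ₗ[F] K ⧸ I)

/-- A thin Lie algebra (in characteristic two) is of Nottingham type with fake second diamond in
degree `m` if `K/K^(m+1)` is metabelian and `K/K^(m+2)` is a graded Lie algebra of maximal class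
which is not metabelian. -/
structure IsNottinghamWithFakeSecondDiamond (𝒦 : ℕ → Submodule F K) (m : ℕ) : Prop where
  charTwo : CharP F 2
  thin : IsThin 𝒦
  metabelian : IsMetabelian F (K ⧸ liePower F K (m + 1))
  maximalClass : IsMaximalClass (quotientGrading (liePower F K (m + 2)) 𝒦)
  not_metabelian : ¬ IsMetabelian F (K ⧸ liePower F K (m + 2))

end Graded

end ThinLie

/-! Write X and Y for the adjoint maps of x and y, q for the degree in which the second centralizer
occurs, and w for the element [y, x, …, x] of degree q. In characteristic two signs disappear and
2^n-th powers of derivations are derivations. So Y^2 vanishes, because it kills both generators, and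
so does X^q once q is known to be a power of two. The degrees before k are governed by those not
centralized by y. The main tool is the Leibniz expansion of [u, X^n a] for u chosen so that at most
three terms survive. The parity of a few binomial coefficients then decides which configurations are
possible. In this way two consecutive noncentralized degrees from q on and below k differ by q or by
q - 2^b (`Frame.gap`), and the last difference, ending in degree k - 1, is q - 1 or q - 2
(`Frame.exists_tail`). This uses q ≥ 8: q = 4 is excluded because L/L^6 is metabelian. If the last
difference is q - 2, then w is the only obstruction before the last one and k = 2q - 1
(`Tail.eq_of_two`). If it is q - 1, two sequences of elements killed by X are followed at once: A
ascends from w, and U descends from the other end, with degrees adding up to k or k - 1. The bracket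
[U, YA], just past or on the second diamond, controls the next difference: the first one is q - 1
(`Tail.link_start`) and every later one is q (`Tail.link_next`). Hence k + 1 = Nq. That q and N are
powers of two has one common cause (`IsDer.lie_pow_self_eq_zero`): for a derivation δ, if the
brackets [δ^i c, c] with i < 2n vanish, then [δ^(2n) c, c] = [δ^n c, δ^n c] = 0. For q one takes δ =
X^P, for N one takes δ = W^Q with W the adjoint map of w, where P and Q are the 2-parts. If N = Q(2r
+ 1) with r ≥ 1, an element of degree k + Qq - 1 is forced to vanish. It spans its component, and
3Qq ≤ k + 1, so the component is nonzero exactly by the assumed bound on the dimension. -/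

namespace ThinLie

/-! ### Parity of binomial coefficients -/

section Binomials

/-- Lucas' theorem with base 2^b digits, from b applications of its one-digit form. -/
theorem choose_two_pow_mul_add_modEq (b : ℕ) : ∀ (n m r s : ℕ), r < 2 ^ b → s < 2 ^ b →
    (2 ^ b * n + r).choose (2 ^ b * m + s) ≡ n.choose m * r.choose s [MOD 2] := by
  have : Fact (Nat.Prime 2) := ⟨Nat.prime_two⟩
  induction b with
  | zero =>
    intro n m r s hr hs
    obtain rfl : r = 0 := by omega
    obtain rfl : s = 0 := by omega
    simp [Nat.ModEq]
  | succ b ih =>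
    intro n m r s hr hs
    have e1 : (2 ^ (b + 1) * n + r) % 2 = r % 2 := by
      rw [pow_succ, mul_right_comm, mul_comm _ 2, Nat.mul_add_mod]
    have e2 : (2 ^ (b + 1) * m + s) % 2 = s % 2 := by
      rw [pow_succ, mul_right_comm, mul_comm _ 2, Nat.mul_add_mod]
    have e3 : (2 ^ (b + 1) * n + r) / 2 = 2 ^ b * n + r / 2 := by
      rw [pow_succ, mul_right_comm, mul_comm _ 2, Nat.mul_add_div (by norm_num)]
    have e4 : (2 ^ (b + 1) * m + s) / 2 = 2 ^ b * m + s / 2 := by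
      rw [pow_succ, mul_right_comm, mul_comm _ 2, Nat.mul_add_div (by norm_num)]
    have h1 := Choose.choose_modEq_choose_mod_mul_choose_div_nat
      (n := 2 ^ (b + 1) * n + r) (k := 2 ^ (b + 1) * m + s) (p := 2)
    rw [e1, e2, e3, e4] at h1
    have h2 := ih n m (r / 2) (s / 2) (by rw [pow_succ] at hr; omega)
      (by rw [pow_succ] at hs; omega)
    have h3 := Choose.choose_modEq_choose_mod_mul_choose_div_nat (n := r) (k := s) (p := 2)
    calc _ ≡ _ [MOD 2] := h1
      _ ≡ (r % 2).choose (s % 2) * (n.choose m * (r / 2).choose (s / 2)) [MOD 2] :=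
          h2.mul_left _
      _ = n.choose m * ((r % 2).choose (s % 2) * (r / 2).choose (s / 2)) := by ring
      _ ≡ _ [MOD 2] := h3.symm.mul_left _

theorem odd_of_modEq {a b : ℕ} (h : a ≡ b [MOD 2]) (hb : Odd b) : Odd a := by
  rw [Nat.odd_iff] at *; rw [← hb]; exact h

theorem even_of_modEq {a b : ℕ} (h : a ≡ b [MOD 2]) (hb : Even b) : Even a := by
  rw [Nat.even_iff] at *; rw [← hb]; exact h

theorem odd_choose_two_pow_sub_one (e : ℕ) : ∀ l, l < 2 ^ e → Odd ((2 ^ e - 1).choose l) := by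
  have : Fact (Nat.Prime 2) := ⟨Nat.prime_two⟩
  induction e with
  | zero => intro l hl; obtain rfl : l = 0 := by omega
            simp
  | succ e ih =>
    intro l hl
    have hp : 0 < 2 ^ e := by positivity
    have h1 := Choose.choose_modEq_choose_mod_mul_choose_div_nat
      (n := 2 ^ (e + 1) - 1) (k := l) (p := 2)
    rw [show (2 ^ (e + 1) - 1) % 2 = 1 by rw [pow_succ]; omega,
      show (2 ^ (e + 1) - 1) / 2 = 2 ^ e - 1 by rw [pow_succ]; omega] at h1
    refine odd_of_modEq h1 ?_
    have : Nat.choose 1 (l % 2) = 1 := by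
      rcases Nat.mod_two_eq_zero_or_one l with h | h <;> simp [h]
    rw [this, one_mul]
    exact ih _ (by rw [pow_succ] at hl; omega)

/-- The binary digits of 2^e - 2 are all one except the last, so by Lucas only the last digit of l
matters. -/
theorem odd_choose_sub_two {e l : ℕ} (he : 1 ≤ e) (hl : l + 2 ≤ 2 ^ e) (h : Even l) :
    Odd ((2 ^ e - 2).choose l) := by
  obtain ⟨d, rfl⟩ : ∃ d, e = d + 1 := ⟨e - 1, by omega⟩
  obtain ⟨m, rfl⟩ := h
  have := choose_two_pow_mul_add_modEq 1 (2 ^ d - 1) m 0 0 (by norm_num) (by norm_num)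
  rw [show 2 ^ (d + 1) - 2 = 2 ^ 1 * (2 ^ d - 1) + 0 by rw [pow_succ]; omega,
    show m + m = 2 ^ 1 * m + 0 by ring]
  refine odd_of_modEq this ?_
  simpa using odd_choose_two_pow_sub_one d m (by rw [pow_succ] at hl; omega)

theorem even_choose_sub_two {e l : ℕ} (he : 1 ≤ e) (h : Odd l) :
    Even ((2 ^ e - 2).choose l) := by
  obtain ⟨d, rfl⟩ : ∃ d, e = d + 1 := ⟨e - 1, by omega⟩
  obtain ⟨m, rfl⟩ := h
  have := choose_two_pow_mul_add_modEq 1 (2 ^ d - 1) m 0 1 (by norm_num) (by norm_num)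
  rw [show 2 ^ (d + 1) - 2 = 2 ^ 1 * (2 ^ d - 1) + 0 by rw [pow_succ]; omega,
    show 2 * m + 1 = 2 ^ 1 * m + 1 by ring]
  refine even_of_modEq this ?_
  simp

/-- If `n + 1` is an odd multiple of `2 ^ b`, then `C(n + 2 ^ b, 2 ^ b)` is odd. -/
theorem odd_choose_add_two_pow {n b o : ℕ} (ho : Odd o) (hn : n + 1 = 2 ^ b * o) :
    Odd ((2 ^ b + n).choose (2 ^ b)) := by
  have hp : 0 < 2 ^ b := by positivity
  have := choose_two_pow_mul_add_modEq b o 1 (2 ^ b - 1) 0 (by omega) hp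
  have h1 : 2 ^ b * o + (2 ^ b - 1) = 2 ^ b + n := by omega
  rw [h1] at this
  exact odd_of_modEq (by simpa using this) ho

/-- The digits of 2^e - 2^b in positions b to e - 1 are ones, so the high block always contributes
an odd factor and the low blocks decide. -/
theorem choose_sub_two_pow_modEq {e b r s : ℕ} (hb : b < e) (hs : s < 2 ^ b) (hr : r < 2 ^ b) :
    (2 ^ e - 2 ^ b + r).choose (2 ^ e / 2 - 2 ^ b + s) ≡ r.choose s [MOD 2] := by
  obtain ⟨d, rfl⟩ : ∃ d, e = b + (d + 1) := ⟨e - b - 1, by omega⟩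
  have h0 : 2 ^ (b + (d + 1)) = 2 * (2 ^ b * 2 ^ d) := by ring
  have hd : 0 < 2 ^ d := by positivity
  have e1 : 2 ^ (b + (d + 1)) - 2 ^ b = 2 ^ b * (2 ^ (d + 1) - 1) := by
    rw [Nat.mul_sub, mul_one, pow_add]
  have e2 : 2 ^ (b + (d + 1)) / 2 - 2 ^ b = 2 ^ b * (2 ^ d - 1) := by
    rw [Nat.mul_sub, mul_one, h0, Nat.mul_div_cancel_left _ (by norm_num)]
  rw [e1, e2]
  refine (choose_two_pow_mul_add_modEq b _ _ r s hr hs).trans ?_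
  have h1 : (2 ^ (d + 1) - 1).choose (2 ^ d - 1) ≡ 1 [MOD 2] := by
    have := odd_choose_two_pow_sub_one (d + 1) (2 ^ d - 1) (by rw [pow_succ]; omega)
    rw [Nat.odd_iff] at this
    exact this
  simpa using h1.mul_right (r.choose s)

theorem choose_sub_three_modEq {e b s m : ℕ} (hb : b < e) (hb2 : 2 ≤ b) (hs : s < 2 ^ b)
    (hm : m ≤ 1) :
    (2 ^ e - 3).choose (2 ^ b * m + s) ≡ (2 ^ b - 3).choose s [MOD 2] := by
  obtain ⟨d, rfl⟩ : ∃ d, e = b + (d + 1) := ⟨e - b - 1, by omega⟩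
  have h4 : 4 ≤ 2 ^ b := by
    calc 4 = 2 ^ 2 := by norm_num
      _ ≤ 2 ^ b := Nat.pow_le_pow_right (by norm_num) hb2
  have hd : 0 < 2 ^ d := by positivity
  have hle : 2 ^ b ≤ 2 ^ (b + (d + 1)) := Nat.pow_le_pow_right (by norm_num) (by omega)
  have e1 : 2 ^ (b + (d + 1)) - 3 = 2 ^ b * (2 ^ (d + 1) - 1) + (2 ^ b - 3) := by
    rw [Nat.mul_sub, mul_one, ← pow_add]; omega
  rw [e1]
  refine (choose_two_pow_mul_add_modEq b _ _ _ s (by omega) hs).trans ?_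
  have h1 : (2 ^ (d + 1) - 1).choose m ≡ 1 [MOD 2] := by
    have := odd_choose_two_pow_sub_one (d + 1) m (by rw [pow_succ]; omega)
    rw [Nat.odd_iff] at this
    exact this
  simpa using h1.mul_right ((2 ^ b - 3).choose s)

end Binomials

/-! ### Signs and scalars in characteristic two -/

section CharTwo

variable {F : Type*} [Field F] [CharP F 2]

theorem cast_of_odd {n : ℕ} (h : Odd n) : (n : F) = 1 := by
  obtain ⟨t, rfl⟩ := h
  have : (2 : F) = 0 := CharTwo.two_eq_zero
  push_cast; rw [this]; ring

theorem cast_of_even {n : ℕ} (h : Even n) : (n : F) = 0 := by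
  obtain ⟨t, rfl⟩ := h
  push_cast; exact CharTwo.add_self_eq_zero _

end CharTwo

theorem add_self_zero (F : Type*) {L : Type*} [Field F] [CharP F 2] [LieRing L]
    [LieAlgebra F L] (u : L) : u + u = 0 := by
  rw [← two_smul F, CharTwo.two_eq_zero, zero_smul]

theorem eq_of_add_eq_zero (F : Type*) {L : Type*} [Field F] [CharP F 2] [LieRing L]
    [LieAlgebra F L] {u w : L} (h : u + w = 0) : u = w := by
  have := add_self_zero F w
  calc u = u + (w + w) := by rw [this, add_zero]
    _ = w := by rw [← add_assoc, h, zero_add]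

theorem lie_comm_char_two (F : Type*) {L : Type*} [Field F] [CharP F 2] [LieRing L]
    [LieAlgebra F L] (u w : L) : ⁅u, w⁆ = ⁅w, u⁆ := by
  apply eq_of_add_eq_zero F
  rw [← lie_skew u w]
  exact neg_add_cancel _

/-! ### Iterates of an endomorphism -/

section IterateApply

variable {R M : Type*} [Semiring R] [AddCommMonoid M] [Module R M]

theorem pow_apply_pow (X : Module.End R M) (m n : ℕ) (u : M) :
    (X ^ m) ((X ^ n) u) = (X ^ (m + n)) u := by
  rw [pow_add, Module.End.mul_apply]

theorem apply_pow (X : Module.End R M) (n : ℕ) (u : M) : X ((X ^ n) u) = (X ^ (n + 1)) u := by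
  rw [pow_succ', Module.End.mul_apply]

theorem pow_apply_apply (X : Module.End R M) (n : ℕ) (u : M) :
    (X ^ n) (X u) = (X ^ (n + 1)) u := by
  rw [pow_succ, Module.End.mul_apply]

theorem pow_apply_zero_of_le {X : Module.End R M} {m n : ℕ} {u : M} (h : (X ^ m) u = 0)
    (hmn : m ≤ n) : (X ^ n) u = 0 := by
  obtain ⟨d, rfl⟩ := Nat.exists_eq_add_of_le hmn
  rw [add_comm, ← pow_apply_pow, h, map_zero]

end IterateApply

/-! ### Derivations and Leibniz expansions -/

section Derivations

variable {F L : Type*} [Field F] [LieRing L] [LieAlgebra F L]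

/-- The Leibniz rule for a linear endomorphism. -/
def IsDer (δ : Module.End F L) : Prop := ∀ u w : L, δ ⁅u, w⁆ = ⁅δ u, w⁆ + ⁅u, δ w⁆

theorem IsDer.ad (a : L) : IsDer (LieAlgebra.ad F L a) := fun u w => by
  rw [LieAlgebra.ad_apply, LieAlgebra.ad_apply, LieAlgebra.ad_apply, leibniz_lie]

variable [CharP F 2]

/-- The mixed term [δu, δw] occurs twice and cancels. -/
theorem IsDer.sq {δ : Module.End F L} (h : IsDer δ) : IsDer (δ ^ 2) := fun u w => by
  simp only [pow_two, Module.End.mul_apply, h _ _, map_add]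
  have := add_self_zero F ⁅δ u, δ w⁆
  calc _ = ⁅δ (δ u), w⁆ + ⁅u, δ (δ w)⁆ + (⁅δ u, δ w⁆ + ⁅δ u, δ w⁆) := by abel
    _ = _ := by rw [this, add_zero]

theorem IsDer.pow_two_pow {δ : Module.End F L} (h : IsDer δ) (n : ℕ) : IsDer (δ ^ 2 ^ n) := by
  induction n with
  | zero => simpa using h
  | succ n ih => rw [pow_succ, pow_mul]; exact ih.sq

/-- In characteristic two, `[u, X^n a] = ∑ C(n, l) X^(n-l) [X^l u, a]` for a derivation `X`. -/
theorem IsDer.lie_pow {X : Module.End F L} (h : IsDer X) (n : ℕ) : ∀ u a : L,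
    ⁅u, (X ^ n) a⁆ =
      ∑ l ∈ Finset.range (n + 1), ((n.choose l : ℕ) : F) • (X ^ (n - l)) ⁅(X ^ l) u, a⁆ := by
  induction n with
  | zero => intro u a; simp
  | succ n ih =>
    intro u a
    have h1 : ⁅u, (X ^ (n + 1)) a⁆ = X ⁅u, (X ^ n) a⁆ + ⁅X u, (X ^ n) a⁆ := by
      rw [h, apply_pow, add_right_comm, add_self_zero F, zero_add]
    rw [h1, ih, ih, map_sum, Finset.sum_range_succ', Finset.sum_range_succ' _ (n + 1)]
    rw [Finset.sum_range_succ _ n]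
    have e1 : ∀ l ∈ Finset.range (n + 1),
        (((n + 1).choose (l + 1) : ℕ) : F) • (X ^ (n + 1 - (l + 1))) ⁅(X ^ (l + 1)) u, a⁆ =
        ((n.choose l : ℕ) : F) • (X ^ (n - l)) ⁅(X ^ l) (X u), a⁆ +
        ((n.choose (l + 1) : ℕ) : F) • (X ^ (n - l)) ⁅(X ^ (l + 1)) u, a⁆ := by
      intro l _
      rw [Nat.choose_succ_succ, Nat.cast_add, add_smul, Nat.add_sub_add_right, pow_apply_apply]
    rw [Finset.sum_congr rfl e1, Finset.sum_add_distrib, Finset.sum_range_succ,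
      Finset.sum_range_succ (fun l => ((n.choose (l + 1) : ℕ) : F) • _)]
    have e2 : ∀ l ∈ Finset.range n,
        X (((n.choose (l + 1) : ℕ) : F) • (X ^ (n - (l + 1))) ⁅(X ^ (l + 1)) u, a⁆) =
        ((n.choose (l + 1) : ℕ) : F) • (X ^ (n - l)) ⁅(X ^ (l + 1)) u, a⁆ := by
      intro l hl
      have := Finset.mem_range.1 hl
      rw [map_smul, apply_pow, show n - (l + 1) + 1 = n - l by omega]
    rw [Finset.sum_congr rfl e2]
    simp only [Nat.choose_succ_self, Nat.cast_zero, zero_smul, add_zero, Nat.choose_zero_right,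
      Nat.cast_one, one_smul, pow_zero, Module.End.one_apply, Nat.sub_zero, apply_pow]
    abel

/-- A Leibniz expansion in which at most three consecutive terms survive. -/
theorem IsDer.lie_pow_three {X : Module.End F L} (h : IsDer X) {n m : ℕ} {u a : L}
    (h1 : ∀ l, l < m → l ≤ n → ⁅(X ^ l) u, a⁆ = 0)
    (h2 : ∀ l, m + 3 ≤ l → l ≤ n → ⁅(X ^ l) u, a⁆ = 0) :
    ⁅u, (X ^ n) a⁆ = ((n.choose m : ℕ) : F) • (X ^ (n - m)) ⁅(X ^ m) u, a⁆ +
      ((n.choose (m + 1) : ℕ) : F) • (X ^ (n - (m + 1))) ⁅(X ^ (m + 1)) u, a⁆ +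
      ((n.choose (m + 2) : ℕ) : F) • (X ^ (n - (m + 2))) ⁅(X ^ (m + 2)) u, a⁆ := by
  rw [h.lie_pow]
  set f : ℕ → L := fun l => ((n.choose l : ℕ) : F) • (X ^ (n - l)) ⁅(X ^ l) u, a⁆ with hf
  have hbig : ∀ l, n < l → f l = 0 := fun l hl => by
    simp [hf, Nat.choose_eq_zero_of_lt hl]
  have hs : ∑ l ∈ Finset.range (n + 1), f l = ∑ l ∈ Finset.range (n + m + 3), f l := by
    apply Finset.sum_subset
    · intro l; simp only [Finset.mem_range]; omega
    · intro l _ hl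
      exact hbig l (by simpa [Finset.mem_range] using hl)
  have ht : ∑ l ∈ ({m, m + 1, m + 2} : Finset ℕ), f l = ∑ l ∈ Finset.range (n + m + 3), f l := by
    apply Finset.sum_subset
    · intro l; simp only [Finset.mem_range, Finset.mem_insert, Finset.mem_singleton]; omega
    · intro l _ hl
      simp only [Finset.mem_insert, Finset.mem_singleton] at hl
      by_cases hn : l ≤ n
      · by_cases hm : l < m
        · simp [hf, h1 l hm hn]
        · simp [hf, h2 l (by omega) hn]
      · exact hbig l (by omega)
  rw [hs, ← ht, Finset.sum_insert (by simp), Finset.sum_insert (by simp), Finset.sum_singleton,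
    add_assoc]

theorem IsDer.lie_pow_two {X : Module.End F L} (h : IsDer X) {n m : ℕ} {u a : L}
    (h1 : ∀ l, l < m → l ≤ n → ⁅(X ^ l) u, a⁆ = 0)
    (h2 : ∀ l, m + 2 ≤ l → l ≤ n → ⁅(X ^ l) u, a⁆ = 0) :
    ⁅u, (X ^ n) a⁆ = ((n.choose m : ℕ) : F) • (X ^ (n - m)) ⁅(X ^ m) u, a⁆ +
      ((n.choose (m + 1) : ℕ) : F) • (X ^ (n - (m + 1))) ⁅(X ^ (m + 1)) u, a⁆ := by
  rw [h.lie_pow_three h1 (fun l hl => h2 l (by omega))]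
  by_cases hn : m + 2 ≤ n
  · rw [h2 _ le_rfl hn, map_zero, smul_zero, add_zero]
  · rw [Nat.choose_eq_zero_of_lt (show n < m + 2 by omega), Nat.cast_zero, zero_smul, add_zero]

theorem IsDer.lie_pow_one {X : Module.End F L} (h : IsDer X) {n m : ℕ} {u a : L}
    (h1 : ∀ l, l < m → l ≤ n → ⁅(X ^ l) u, a⁆ = 0)
    (h2 : ∀ l, m + 1 ≤ l → l ≤ n → ⁅(X ^ l) u, a⁆ = 0) :
    ⁅u, (X ^ n) a⁆ = ((n.choose m : ℕ) : F) • (X ^ (n - m)) ⁅(X ^ m) u, a⁆ := by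
  rw [h.lie_pow_two h1 (fun l hl => h2 l (by omega))]
  by_cases hn : m + 1 ≤ n
  · rw [h2 _ le_rfl hn, map_zero, smul_zero, add_zero]
  · rw [Nat.choose_eq_zero_of_lt (show n < m + 1 by omega), Nat.cast_zero, zero_smul, add_zero]

theorem IsDer.lie_pow_zero {X : Module.End F L} (h : IsDer X) {n : ℕ} {u a : L}
    (h1 : ∀ l, l ≤ n → ⁅(X ^ l) u, a⁆ = 0) : ⁅u, (X ^ n) a⁆ = 0 := by
  rw [h.lie_pow_one (m := 0) (fun l _ => h1 l) (fun l _ => h1 l), h1 0 (Nat.zero_le _), map_zero,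
    smul_zero]

/-- If `δ` moves a bracket `[δ^i c, δ^j c]` with `i + j < n` to zero, then all such brackets with
`i + j = n` coincide. -/
theorem IsDer.lie_pow_self_eq {δ : Module.End F L} (h : IsDer δ) {c : L} {n : ℕ}
    (hz : ∀ i, i < n → ⁅(δ ^ i) c, c⁆ = 0) :
    ∀ s, s ≤ n → ∀ j, j ≤ s → ⁅(δ ^ (s - j)) c, (δ ^ j) c⁆ = ⁅(δ ^ s) c, c⁆ := by
  intro s
  induction s with
  | zero => intro _ j hj; obtain rfl : j = 0 := by omega
            simp
  | succ s ih =>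
    intro hs j
    induction j with
    | zero => intro _; simp
    | succ j ihj =>
      intro hj
      rw [← ihj (by omega)]
      have h0 : ⁅(δ ^ (s - j)) c, (δ ^ j) c⁆ = 0 := by
        rw [ih (by omega) j (by omega), hz s (by omega)]
      have h1 := h ((δ ^ (s - j)) c) ((δ ^ j) c)
      rw [h0, map_zero, apply_pow, apply_pow] at h1
      rw [Nat.add_sub_add_right, show s + 1 - j = s - j + 1 by omega]
      exact (eq_of_add_eq_zero F h1.symm).symm

/-- All brackets [δ^i c, δ^j c] of total exponent 2n agree, and the balanced one has equal
arguments. This is what excludes odd factors of q and of N. -/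
theorem IsDer.lie_pow_self_eq_zero {δ : Module.End F L} (h : IsDer δ) {c : L} {n : ℕ}
    (hz : ∀ i, i < 2 * n → ⁅(δ ^ i) c, c⁆ = 0) : ⁅(δ ^ (2 * n)) c, c⁆ = 0 := by
  rw [← h.lie_pow_self_eq hz (2 * n) le_rfl n (by omega), show 2 * n - n = n by omega, lie_self]

end Derivations
end ThinLie

namespace ThinLie

/-! ### Elementary consequences of thinness -/

section Frames

variable {F L : Type*} [Field F] [LieRing L] [LieAlgebra F L]

/-- The component of degree `i` is centralized by `y`, where `Y` is the adjoint map of `y`. -/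
def Normal (ℒ : ℕ → Submodule F L) (Y : Module.End F L) (i : ℕ) : Prop := ∀ u ∈ ℒ i, Y u = 0

/-- The elementary consequences of thinness for the adjoint maps `X` and `Y` of the generators
`x` and `y` spanning the first two distinct two-step centralizers. -/
structure Frame (ℒ : ℕ → Submodule F L) (k q : ℕ) (x y : L) (X Y : Module.End F L) : Prop where
  derX : IsDer X
  derY : IsDer Y
  lie_y : ∀ u, ⁅u, y⁆ = Y u
  X_x : X x = 0
  Y_y : Y y = 0
  Y_x : Y x = X y
  y_mem : y ∈ ℒ 1
  X_y_ne : X y ≠ 0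
  X_mem : ∀ {i u}, u ∈ ℒ i → X u ∈ ℒ (i + 1)
  Y_mem : ∀ {i u}, u ∈ ℒ i → Y u ∈ ℒ (i + 1)
  lie_mem : ∀ {i j u w}, u ∈ ℒ i → w ∈ ℒ j → ⁅u, w⁆ ∈ ℒ (i + j)
  cover : ∀ {i u}, 1 ≤ i → u ∈ ℒ i → u ≠ 0 → ∀ t ∈ ℒ (i + 1), ∃ a b : F, t = a • X u + b • Y u
  bot_succ : ∀ {i}, 1 ≤ i → ℒ i = ⊥ → ℒ (i + 1) = ⊥
  ne_bot : ∀ {i}, 1 ≤ i → i ≤ k → ℒ i ≠ ⊥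
  line : ∀ {i}, 2 ≤ i → i < k → ∀ {u w}, u ∈ ℒ i → u ≠ 0 → w ∈ ℒ i → ∃ a : F, w = a • u
  indep : ∀ {v}, v ∈ ℒ (k - 1) → v ≠ 0 → ∀ a b : F, a • X v + b • Y v = 0 → a = 0 ∧ b = 0
  two_le : 2 ≤ q
  q_le : q + 2 ≤ k
  low : ∀ i, 2 ≤ i → i < q → Normal ℒ Y i
  X_q : ∀ u ∈ ℒ q, X u = 0
  der_zero : ∀ δ : Module.End F L, IsDer δ → δ x = 0 → δ y = 0 → δ = 0

namespace Frame

variable {ℒ : ℕ → Submodule F L} {k q : ℕ} {x y : L} {X Y : Module.End F L}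

theorem pow_mem (S : Frame ℒ k q x y X Y) {i : ℕ} {u : L} (hu : u ∈ ℒ i) (n : ℕ) :
    (X ^ n) u ∈ ℒ (i + n) := by
  induction n with
  | zero => simpa using hu
  | succ n ih => rw [← apply_pow]; exact S.X_mem ih

theorem pow_mem' (S : Frame ℒ k q x y X Y) {i j : ℕ} {u : L} (n : ℕ) (hu : u ∈ ℒ i)
    (hj : i + n = j) : (X ^ n) u ∈ ℒ j := hj ▸ S.pow_mem hu n

theorem Y_mem' (S : Frame ℒ k q x y X Y) {i j : ℕ} {u : L} (hu : u ∈ ℒ i)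
    (hj : i + 1 = j) : Y u ∈ ℒ j := hj ▸ S.Y_mem hu

theorem X_mem' (S : Frame ℒ k q x y X Y) {i j : ℕ} {u : L} (hu : u ∈ ℒ i)
    (hj : i + 1 = j) : X u ∈ ℒ j := hj ▸ S.X_mem hu

theorem lie_mem' (S : Frame ℒ k q x y X Y) {i j n : ℕ} {u w : L} (hu : u ∈ ℒ i) (hw : w ∈ ℒ j)
    (hn : i + j = n) : ⁅u, w⁆ ∈ ℒ n := hn ▸ S.lie_mem hu hw

theorem bot_of_zero (S : Frame ℒ k q x y X Y) {i : ℕ} {u : L} (hi : 1 ≤ i) (hu : u ∈ ℒ i)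
    (h0 : u ≠ 0) (hX : X u = 0) (hY : Y u = 0) : ℒ (i + 1) = ⊥ := by
  rw [eq_bot_iff]
  intro t ht
  obtain ⟨a, b, rfl⟩ := S.cover hi hu h0 t ht
  simp [hX, hY]

theorem X_ne (S : Frame ℒ k q x y X Y) {i : ℕ} {u : L} (hi : 1 ≤ i) (hu : u ∈ ℒ i)
    (h0 : u ≠ 0) (hY : Y u = 0) (hb : ℒ (i + 1) ≠ ⊥) : X u ≠ 0 :=
  fun hX => hb (S.bot_of_zero hi hu h0 hX hY)

theorem Y_ne (S : Frame ℒ k q x y X Y) {i : ℕ} {u : L} (hi : 1 ≤ i) (hu : u ∈ ℒ i)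
    (h0 : u ≠ 0) (hX : X u = 0) (hb : ℒ (i + 1) ≠ ⊥) : Y u ≠ 0 :=
  fun hY => hb (S.bot_of_zero hi hu h0 hX hY)

theorem not_normal_last (S : Frame ℒ k q x y X Y) {v : L} (hv : v ∈ ℒ (k - 1)) (h0 : v ≠ 0) :
    Y v ≠ 0 := fun h => by
  have := (S.indep hv h0 0 1 (by simp [h])).2
  simp at this

theorem X_last_ne (S : Frame ℒ k q x y X Y) {v : L} (hv : v ∈ ℒ (k - 1)) (h0 : v ≠ 0) :
    X v ≠ 0 := fun h => by
  have := (S.indep hv h0 1 0 (by simp [h])).1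
  simp at this

theorem exists_ne (S : Frame ℒ k q x y X Y) {i : ℕ} (hi : 1 ≤ i) (hk : i ≤ k) :
    ∃ u ∈ ℒ i, u ≠ 0 := by
  obtain ⟨u, hu, h⟩ := (Submodule.ne_bot_iff _).1 (S.ne_bot hi hk)
  exact ⟨u, hu, h⟩

theorem normal_of_zero (S : Frame ℒ k q x y X Y) {i : ℕ} {u : L} (hi : 2 ≤ i) (hk : i < k)
    (hu : u ∈ ℒ i) (h0 : u ≠ 0) (hY : Y u = 0) : Normal ℒ Y i := by
  intro w hw
  obtain ⟨a, rfl⟩ := S.line hi hk hu h0 hw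
  rw [map_smul, hY, smul_zero]

theorem Y_ne_of_not_normal (S : Frame ℒ k q x y X Y) {i : ℕ} {u : L} (hi : 2 ≤ i) (hk : i < k)
    (hn : ¬ Normal ℒ Y i) (hu : u ∈ ℒ i) (h0 : u ≠ 0) : Y u ≠ 0 :=
  fun h => hn (S.normal_of_zero hi hk hu h0 h)

/-- A run of components centralized by `y` does not reach degree `k - 1`. -/
theorem run (S : Frame ℒ k q x y X Y) {i : ℕ} {u : L} (hi : 1 ≤ i) (hk : i < k)
    (hu : u ∈ ℒ i) (h0 : u ≠ 0) (n : ℕ) (h : ∀ l, l < n → Y ((X ^ l) u) = 0) :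
    i + n < k ∧ (X ^ n) u ≠ 0 := by
  induction n with
  | zero => exact ⟨hk, by simpa using h0⟩
  | succ n ih =>
    obtain ⟨h1, h2⟩ := ih fun l hl => h l (by omega)
    have hm := S.pow_mem hu n
    have hY := h n (by omega)
    have h3 : i + n ≠ k - 1 := by
      intro e
      exact S.not_normal_last (e ▸ hm) h2 hY
    refine ⟨by omega, ?_⟩
    rw [← apply_pow]
    exact S.X_ne (by omega) hm h2 hY (S.ne_bot (by omega) (by omega))

theorem run_normal (S : Frame ℒ k q x y X Y) {i : ℕ} {u : L} (hi : 1 ≤ i) (hk : i < k)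
    (hu : u ∈ ℒ i) (h0 : u ≠ 0) (n : ℕ) (h : ∀ j, i ≤ j → j < i + n → Normal ℒ Y j) :
    i + n < k ∧ (X ^ n) u ≠ 0 :=
  S.run hi hk hu h0 n fun l hl => h (i + l) (by omega) (by omega) _ (S.pow_mem hu l)

theorem exists_pow_eq (S : Frame ℒ k q x y X Y) {i : ℕ} (hi : 2 ≤ i) (n : ℕ) {j : ℕ} {t : L}
    (hj : i + n = j) (hk : j < k) (ht : t ∈ ℒ j) (h : ∀ l, i ≤ l → l < j → Normal ℒ Y l) :
    ∃ u ∈ ℒ i, (X ^ n) u = t := by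
  subst hj
  obtain ⟨u, hu, h0⟩ := S.exists_ne (i := i) (by omega) (by omega)
  obtain ⟨-, h1⟩ := S.run_normal (by omega) (by omega) hu h0 n h
  obtain ⟨a, rfl⟩ := S.line (by omega) hk (S.pow_mem hu n) h1 ht
  exact ⟨a • u, (ℒ i).smul_mem _ hu, map_smul _ _ _⟩

theorem b_mem (S : Frame ℒ k q x y X Y) {n j : ℕ} (hj : n + 1 = j) : (X ^ n) y ∈ ℒ j :=
  S.pow_mem' n S.y_mem (by omega)

theorem Y_b (S : Frame ℒ k q x y X Y) {n : ℕ} (hn : n + 2 ≤ q) : Y ((X ^ n) y) = 0 := by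
  rcases Nat.eq_zero_or_pos n with rfl | h
  · simpa using S.Y_y
  · exact S.low (n + 1) (by omega) (by omega) _ (S.b_mem rfl)

theorem b_ne (S : Frame ℒ k q x y X Y) {n : ℕ} (hn : n + 1 ≤ q) : (X ^ n) y ≠ 0 := by
  have := S.q_le
  exact (S.run (i := 1) le_rfl (by omega) S.y_mem
    (fun h => S.X_y_ne (by rw [h, map_zero])) n fun l hl => S.Y_b (by omega)).2

theorem w_mem (S : Frame ℒ k q x y X Y) : (X ^ (q - 1)) y ∈ ℒ q :=
  S.b_mem (by have := S.two_le; omega)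

theorem w_ne (S : Frame ℒ k q x y X Y) : (X ^ (q - 1)) y ≠ 0 :=
  S.b_ne (by have := S.two_le; omega)

theorem X_w (S : Frame ℒ k q x y X Y) : X ((X ^ (q - 1)) y) = 0 := S.X_q _ S.w_mem

theorem Y_w_ne (S : Frame ℒ k q x y X Y) : Y ((X ^ (q - 1)) y) ≠ 0 := by
  have := S.q_le
  have := S.two_le
  exact S.Y_ne (by omega) S.w_mem S.w_ne S.X_w (S.ne_bot (by omega) (by omega))

theorem b_zero (S : Frame ℒ k q x y X Y) {n : ℕ} (hn : q ≤ n) : (X ^ n) y = 0 := by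
  have := S.two_le
  refine pow_apply_zero_of_le (m := q - 1 + 1) ?_ (by omega)
  rw [← apply_pow]; exact S.X_w

theorem not_normal_q (S : Frame ℒ k q x y X Y) : ¬ Normal ℒ Y q :=
  fun h => S.Y_w_ne (h _ S.w_mem)

variable [CharP F 2]

/-- The derivation Y^2 kills y, and it sends x to Y(Xy), which vanishes because y centralizes degree
2. -/
theorem Y_sq (S : Frame ℒ k q x y X Y) (hq : 2 < q) (u : L) : Y (Y u) = 0 := by
  have : Y ^ 2 = 0 := S.der_zero _ S.derY.sq
    (by rw [pow_two, Module.End.mul_apply, S.Y_x]; exact S.low 2 le_rfl hq _ (S.X_mem S.y_mem))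
    (by rw [pow_two, Module.End.mul_apply, S.Y_y, map_zero])
  have h2 : (Y ^ 2) u = 0 := by rw [this]; rfl
  rwa [pow_two, Module.End.mul_apply] at h2

/-- The derivation X^q kills x, and it sends y to Xw = 0. -/
theorem X_pow_q (S : Frame ℒ k q x y X Y) {e : ℕ} (hq : q = 2 ^ e) {n : ℕ} (hn : q ≤ n) (u : L) :
    (X ^ n) u = 0 := by
  have : X ^ q = 0 := by
    refine S.der_zero _ (hq ▸ S.derX.pow_two_pow e) ?_ (S.b_zero le_rfl)
    exact pow_apply_zero_of_le (m := 1) (by simpa using S.X_x) (by have := S.two_le; omega)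
  exact pow_apply_zero_of_le (m := q) (by rw [this]; rfl) hn

/-- The degree in which the second two-step centralizer first occurs is a power of two. -/
theorem exists_eq_two_pow (S : Frame ℒ k q x y X Y) : ∃ e, q = 2 ^ e := by
  have h2 := S.two_le
  have hqk := S.q_le
  obtain ⟨f, o, ho, hq⟩ := Nat.exists_eq_two_pow_mul_odd (n := q) (by omega)
  obtain ⟨r, rfl⟩ := ho
  rcases Nat.eq_zero_or_pos r with rfl | hr
  · exact ⟨f, by simpa using hq⟩
  exfalso
  -- P is the 2-part of q = P(2r + 1). The contradiction concerns X^(P-1) Yw, which is, up to sign,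
  -- the bracket of w with X^(P-1) y.
  set P := 2 ^ f with hP
  have hP0 : 0 < P := by positivity
  have hqP : q = P * (2 * r) + P := by rw [hq]; ring
  have hPr : P * 2 ≤ P * (2 * r) := Nat.mul_le_mul_left _ (by omega)
  have hpow : ∀ i, ((X ^ P) ^ i) ((X ^ (P - 1)) y) = (X ^ (P * i + (P - 1))) y := fun i => by
    rw [← pow_mul, pow_apply_pow]
  -- The balanced bracket for the derivation X^P and c = X^(P-1) y shows that [w, c] = 0. Its
  -- expansion has only the term l = 0, since Xw = 0.
  have key : (X ^ (P - 1)) (Y ((X ^ (q - 1)) y)) = 0 := by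
    have h0 := (S.derX.pow_two_pow f).lie_pow_self_eq_zero (c := (X ^ (P - 1)) y) (n := r) (by
      intro i hi
      rw [← hP, hpow]
      apply S.derX.lie_pow_zero
      intro l hl
      rw [S.lie_y, pow_apply_pow]
      have : P * (i + 1) ≤ P * (2 * r) := Nat.mul_le_mul_left _ (by omega)
      exact S.Y_b (by rw [mul_add, mul_one] at this; omega))
    rw [← hP, hpow, show P * (2 * r) + (P - 1) = q - 1 by omega,
      S.derX.lie_pow_one (m := 0) (by intro l hl; omega)] at h0
    · simpa [S.lie_y] using h0
    · intro l hl _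
      rw [pow_apply_pow, S.b_zero (by omega), zero_lie]
  -- On the other hand y centralizes the run starting at Yw: Y kills both factors of a suitable
  -- bracket of powers of X on y, whose one surviving term has coefficient C(P - 1, P - 1 - l),
  -- which is odd. So X^(P-1) Yw cannot vanish.
  have hY : ∀ l, l < P - 1 → Y ((X ^ l) (Y ((X ^ (q - 1)) y))) = 0 := by
    intro l hl
    have h0 : Y ⁅(X ^ (q - 1 - (P - 1 - l))) y, (X ^ (P - 1)) y⁆ = 0 := by
      rw [S.derY, S.Y_b (by omega), S.Y_b (by omega), zero_lie, lie_zero, add_zero]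
    rw [S.derX.lie_pow_one (m := P - 1 - l)] at h0
    · rw [S.lie_y, pow_apply_pow, map_smul,
        show P - 1 - l + (q - 1 - (P - 1 - l)) = q - 1 by omega,
        show P - 1 - (P - 1 - l) = l by omega,
        cast_of_odd (odd_choose_two_pow_sub_one f _ (by omega)), one_smul] at h0
      exact h0
    · intro m hm _
      rw [S.lie_y, pow_apply_pow]
      exact S.Y_b (by omega)
    · intro m hm _
      rw [pow_apply_pow, S.b_zero (by omega), zero_lie]
  exact (S.run (by omega) (by omega) (S.Y_mem S.w_mem) S.Y_w_ne (P - 1) hY).2 key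

end Frame

end Frames
end ThinLie

namespace ThinLie

/-! ### Differences of consecutive degrees not centralized by y -/

section Gaps

variable {F L : Type*} [Field F] [LieRing L] [LieAlgebra F L]

theorem exists_prev_not_normal (ℒ : ℕ → Submodule F L) (Y : Module.End F L) {q : ℕ}
    (hq : ¬ Normal ℒ Y q) : ∀ s, q < s →
    ∃ p, q ≤ p ∧ p < s ∧ ¬ Normal ℒ Y p ∧ ∀ i, p < i → i < s → Normal ℒ Y i := by
  intro s
  induction s with
  | zero => intro h; omega
  | succ s ih =>
    intro h
    by_cases hs : Normal ℒ Y s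
    · have hqs : q ≠ s := fun h => hq (h ▸ hs)
      obtain ⟨p, h1, h2, h3, h4⟩ := ih (by omega)
      refine ⟨p, h1, by omega, h3, fun i hi hi2 => ?_⟩
      rcases Nat.lt_succ_iff_lt_or_eq.1 hi2 with h | rfl
      · exact h4 i hi h
      · exact hs
    · exact ⟨s, by omega, by omega, hs, fun i hi hi2 => by omega⟩

theorem exists_next_not_normal (ℒ : ℕ → Submodule F L) (Y : Module.End F L) {m : ℕ}
    (hm : ¬ Normal ℒ Y m) {s : ℕ} (hs : s < m) :
    ∃ p, s < p ∧ p ≤ m ∧ ¬ Normal ℒ Y p ∧ ∀ i, s < i → i < p → Normal ℒ Y i := by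
  classical
  have hex : ∃ p, s < p ∧ ¬ Normal ℒ Y p := ⟨m, hs, hm⟩
  refine ⟨Nat.find hex, (Nat.find_spec hex).1, Nat.find_min' hex ⟨hs, hm⟩,
    (Nat.find_spec hex).2, fun i hi hi2 => ?_⟩
  have := Nat.find_min hex hi2
  by_contra hc
  exact this ⟨hi, hc⟩

namespace Frame

variable {ℒ : ℕ → Submodule F L} {k q : ℕ} {x y : L} {X Y : Module.End F L}

theorem not_normal_pred (S : Frame ℒ k q x y X Y) : ¬ Normal ℒ Y (k - 1) := by
  have := S.q_le
  obtain ⟨v, hv, h0⟩ := S.exists_ne (i := k - 1) (by omega) (by omega)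
  exact fun h => S.not_normal_last hv h0 (h v hv)

variable [CharP F 2]

/-- Let 2^b be the 2-part of s - p = n + 1, and let μ lie 2^b steps below degree p. The bracket [μ,
X^(2^b+n) y] is a single term with the odd coefficient C(2^b + n, 2^b), namely X^n YA. If 2^b + n +
2 ≤ q, then Y kills both factors, hence also X^n YA, against the choice of s. This leaves only the
listed differences. -/
theorem gap_of_run (S : Frame ℒ k q x y X Y) {e : ℕ} (he : 3 ≤ e) (hq : q = 2 ^ e) {p s : ℕ}
    (hp : q ≤ p) (hps : p < s) (hs : s < k) (hpn : ¬ Normal ℒ Y p) (hsn : ¬ Normal ℒ Y s)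
    (hbt : ∀ i, p < i → i < s → Normal ℒ Y i)
    (hrun : ∀ i, i < p → p ≤ i + q / 4 → Normal ℒ Y i) :
    s = p + q ∨ ∃ b, b < e ∧ s + 2 ^ b = p + q := by
  have hq8 : 8 ≤ q := by
    rw [hq]; calc 8 = 2 ^ 3 := by norm_num
      _ ≤ 2 ^ e := Nat.pow_le_pow_right (by norm_num) he
  obtain ⟨A, hA, hA0⟩ := S.exists_ne (i := p) (by omega) (by omega)
  have hYA := S.Y_ne_of_not_normal (by omega) (by omega) hpn hA hA0
  have hYAm := S.Y_mem hA
  obtain ⟨n, rfl⟩ : ∃ n, s = p + 1 + n := ⟨s - p - 1, by omega⟩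
  have hne := (S.run_normal (by omega) (by omega) hYAm hYA n
    fun j h1 h2 => hbt j (by omega) (by omega)).2
  have hYne := S.Y_ne_of_not_normal (by omega) hs hsn (S.pow_mem hYAm n) hne
  have hnq : n < q := by
    by_contra h
    exact hne (S.X_pow_q hq (by omega) _)
  rcases Nat.lt_or_ge (n + 1) q with h1 | h1
  swap
  · left; omega
  right
  obtain ⟨b, o, ho, hno⟩ := Nat.exists_eq_two_pow_mul_odd (n := n + 1) (by omega)
  have ho1 : 1 ≤ o := ho.pos
  have hbe : b < e := by
    have : 2 ^ b < 2 ^ e := by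
      rw [← hq]
      calc 2 ^ b ≤ 2 ^ b * o := Nat.le_mul_of_pos_right _ ho1
        _ < q := by omega
    exact (Nat.pow_lt_pow_iff_right (by norm_num)).1 this
  refine ⟨b, hbe, ?_⟩
  obtain ⟨d, rfl⟩ : ∃ d, e = b + (d + 1) := ⟨e - b - 1, by omega⟩
  have hq' : q = 2 ^ b * (2 * 2 ^ d) := by rw [hq]; ring
  have hb0 : 0 < 2 ^ b := by positivity
  have hlt : o < 2 * 2 ^ d := by
    rw [hno, hq'] at h1
    exact lt_of_mul_lt_mul_left h1 (Nat.zero_le _)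
  by_contra hcon
  have hneq : o + 1 ≠ 2 * 2 ^ d := by
    intro h
    apply hcon
    rw [hq', ← h, mul_add, mul_one, ← hno]
    ring
  -- Both sides of the excluded equality are even, so the slack is at least two. Consequently 2^b ≤
  -- q/4, which is the length of the run assumed below p.
  have hle : o + 3 ≤ 2 * 2 ^ d := by
    obtain ⟨t, rfl⟩ := ho
    omega
  have hle2 : 2 ^ b * o + 2 ^ b * 3 ≤ q := by
    rw [hq', ← mul_add]; exact Nat.mul_le_mul_left _ hle
  have hb4 : 2 ^ b ≤ q / 4 := by
    have : 2 ^ b * 4 ≤ 2 ^ b * (2 * 2 ^ d) := Nat.mul_le_mul_left _ (by omega)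
    omega
  obtain ⟨c, hc⟩ := S.line (by omega) (by omega) hYAm hYA (S.X_mem hA)
  obtain ⟨μ, hμ, hμA⟩ := S.exists_pow_eq (i := p - 2 ^ b) (by omega) (2 ^ b) (j := p) (by omega)
    (by omega) hA fun l h1 h2 => hrun l h2 (by omega)
  have h0 : Y ⁅μ, (X ^ (2 ^ b + n)) y⁆ = 0 := by
    have hμY : Y μ = 0 := hrun (p - 2 ^ b) (by omega) (by omega) _ hμ
    rw [S.derY, S.Y_b (by omega), hμY, zero_lie, lie_zero, add_zero]
  rw [S.derX.lie_pow_one (m := 2 ^ b)] at h0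
  · rw [S.lie_y, hμA, map_smul, cast_of_odd (odd_choose_add_two_pow ho hno), one_smul,
      Nat.add_sub_cancel_left] at h0
    exact hYne h0
  · intro l hl _
    rw [S.lie_y]
    exact hrun (p - 2 ^ b + l) (by omega) (by omega) _ (S.pow_mem hμ l)
  · intro l hl hl2
    obtain ⟨t, rfl⟩ : ∃ t, l = t + 1 + 2 ^ b := ⟨l - 1 - 2 ^ b, by omega⟩
    rw [S.lie_y, ← pow_apply_pow, hμA, ← pow_apply_apply, hc, map_smul, map_smul,
      hbt (p + 1 + t) (by omega) (by omega) _ (S.pow_mem hYAm t), smul_zero]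

/-- Strong induction on s: the run of length q/2 below the preceding noncentralized degree p
provides the run of length q/4 that `gap_of_run` needs, and each admissible difference is at least
q/2. -/
theorem half_le_gap (S : Frame ℒ k q x y X Y) {e : ℕ} (he : 3 ≤ e) (hq : q = 2 ^ e) :
    ∀ s, q ≤ s → s < k → ¬ Normal ℒ Y s → ∀ i, i < s → s < i + q / 2 → Normal ℒ Y i := by
  have hq8 : 8 ≤ q := by
    rw [hq]; calc 8 = 2 ^ 3 := by norm_num
      _ ≤ 2 ^ e := Nat.pow_le_pow_right (by norm_num) he
  intro s
  induction s using Nat.strong_induction_on with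
  | _ s ih =>
    intro hqs hsk hsn i his hi
    rcases Nat.eq_or_lt_of_le hqs with rfl | hlt
    · exact S.low i (by omega) his
    obtain ⟨p, h1, h2, h3, h4⟩ := exists_prev_not_normal ℒ Y S.not_normal_q s hlt
    have hg := S.gap_of_run he hq h1 h2 hsk h3 hsn h4 fun j hj hj2 =>
      ih p h2 h1 (by omega) h3 j hj (by omega)
    have hpi : p < i := by
      rcases hg with h | ⟨b, hb, h⟩
      · omega
      · have : 2 ^ b ≤ q / 2 := by
          obtain ⟨d, rfl⟩ : ∃ d, e = d + 1 := ⟨e - 1, by omega⟩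
          rw [hq, pow_succ, Nat.mul_div_cancel _ (by norm_num)]
          exact Nat.pow_le_pow_right (by norm_num) (by omega)
        omega
    exact h4 i hpi his

/-- The possible differences between the degrees of consecutive components not centralized
by `y`. -/
theorem gap (S : Frame ℒ k q x y X Y) {e : ℕ} (he : 3 ≤ e) (hq : q = 2 ^ e) {p s : ℕ}
    (hp : q ≤ p) (hps : p < s) (hs : s < k) (hpn : ¬ Normal ℒ Y p) (hsn : ¬ Normal ℒ Y s)
    (hbt : ∀ i, p < i → i < s → Normal ℒ Y i) :
    s = p + q ∨ ∃ b, b < e ∧ s + 2 ^ b = p + q := by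
  have hq8 : 8 ≤ q := by
    rw [hq]; calc 8 = 2 ^ 3 := by norm_num
      _ ≤ 2 ^ e := Nat.pow_le_pow_right (by norm_num) he
  exact S.gap_of_run he hq hp hps hs hpn hsn hbt fun i h1 h2 =>
    S.half_le_gap he hq p hp (by omega) hpn i h1 (by omega)

end Frame

end Gaps
end ThinLie

namespace ThinLie

/-! ### The configuration around the second diamond -/

section Tails

variable {F L : Type*} [Field F] [LieRing L] [LieAlgebra F L]

/-- `ℒ i` is spanned by its (possibly zero) element `u`. -/
def SpannedBy (ℒ : ℕ → Submodule F L) (i : ℕ) (u : L) : Prop :=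
  u ∈ ℒ i ∧ ∀ w ∈ ℒ i, ∃ a : F, w = a • u

variable {ℒ : ℕ → Submodule F L} {k q : ℕ} {x y : L} {X Y : Module.End F L}

/-- Beyond the second diamond components may vanish, so the spanning element may be zero. The
covering property is then replaced by the fact that no nonzero component follows a zero one. -/
theorem SpannedBy.X_of_Y_eq_zero {i : ℕ} {u : L} (h : SpannedBy ℒ i u)
    (S : Frame ℒ k q x y X Y) (hi : 1 ≤ i) (hY : Y u = 0) : SpannedBy ℒ (i + 1) (X u) := by
  refine ⟨S.X_mem h.1, fun w hw => ?_⟩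
  by_cases h0 : u = 0
  · have : ℒ i = ⊥ := by
      rw [eq_bot_iff]
      intro w hw
      obtain ⟨a, rfl⟩ := h.2 w hw
      simp [h0]
    rw [S.bot_succ hi this] at hw
    exact ⟨0, by simpa using hw⟩
  · obtain ⟨a, b, rfl⟩ := S.cover hi h.1 h0 w hw
    exact ⟨a, by rw [hY, smul_zero, add_zero]⟩

theorem SpannedBy.Y_of_X_eq_zero {i : ℕ} {u : L} (h : SpannedBy ℒ i u)
    (S : Frame ℒ k q x y X Y) (hi : 1 ≤ i) (hX : X u = 0) : SpannedBy ℒ (i + 1) (Y u) := by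
  refine ⟨S.Y_mem h.1, fun w hw => ?_⟩
  by_cases h0 : u = 0
  · have : ℒ i = ⊥ := by
      rw [eq_bot_iff]
      intro w hw
      obtain ⟨a, rfl⟩ := h.2 w hw
      simp [h0]
    rw [S.bot_succ hi this] at hw
    exact ⟨0, by simpa using hw⟩
  · obtain ⟨a, b, rfl⟩ := S.cover hi h.1 h0 w hw
    exact ⟨b, by rw [hX, smul_zero, zero_add]⟩

theorem SpannedBy.pow {i : ℕ} {u : L} (h : SpannedBy ℒ i u)
    (S : Frame ℒ k q x y X Y) (hi : 1 ≤ i) (n : ℕ) (hY : ∀ l, l < n → Y ((X ^ l) u) = 0) :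
    SpannedBy ℒ (i + n) ((X ^ n) u) := by
  induction n with
  | zero => simpa using h
  | succ n ih =>
    rw [← apply_pow]
    exact (ih fun l hl => hY l (by omega)).X_of_Y_eq_zero S (by omega) (hY n (by omega))

theorem SpannedBy.normal {i : ℕ} {u : L} (h : SpannedBy ℒ i u) (hY : Y u = 0) :
    Normal ℒ Y i := by
  intro w hw
  obtain ⟨a, rfl⟩ := h.2 w hw
  rw [map_smul, hY, smul_zero]

theorem SpannedBy.ne_zero {i : ℕ} {u : L} (h : SpannedBy ℒ i u) (hi : ℒ i ≠ ⊥) : u ≠ 0 := by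
  rintro rfl
  apply hi
  rw [eq_bot_iff]
  intro w hw
  obtain ⟨a, rfl⟩ := h.2 w hw
  simp

/-- The configuration around the second diamond: `τ` spans the last component of degree less than
`k - 1` which is not centralized by `y`, and `v` spans the component of degree `k - 1`. -/
structure Tail (ℒ : ℕ → Submodule F L) (k q e : ℕ) (x y : L) (X Y : Module.End F L) (d t : ℕ)
    (τ v : L) (ρ : F) : Prop where
  S : Frame ℒ k q x y X Y
  he : 3 ≤ e
  hq : q = 2 ^ e
  hd : d = 1 ∨ d = 2
  q_le : q ≤ t
  t_eq : t + q + 1 = k + d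
  hbt : ∀ i, t < i → i + 1 < k → Normal ℒ Y i
  τ_mem : τ ∈ ℒ t
  X_τ : X τ = 0
  v_eq : (X ^ (q - d - 1)) (Y τ) = v
  v_ne : v ≠ 0
  YXv : Y (X v) = ρ • X (Y v)
  ρ_ne : ρ ≠ 0
  spanned : SpannedBy ℒ (k + 1) (X (Y v))
  tail : ∀ a, a + 3 ≤ q → Y ((X ^ a) (Y v)) = 0

variable [CharP F 2]

/-- The relations come from X^q = 0 and from brackets [μ, X^j y] with j ≤ q - 2 and μ centralized by
y: Y kills such a bracket, while its expansion passes through v and into the second diamond. -/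
theorem Frame.exists_tail (S : Frame ℒ k q x y X Y) {e : ℕ} (he : 3 ≤ e) (hq : q = 2 ^ e)
    (hk1 : ℒ (k + 1) ≠ ⊥) : ∃ d t τ v, ∃ ρ : F, Tail ℒ k q e x y X Y d t τ v ρ := by
  have hq8 : 8 ≤ q := by
    rw [hq]; calc 8 = 2 ^ 3 := by norm_num
      _ ≤ 2 ^ e := Nat.pow_le_pow_right (by norm_num) he
  have hqk := S.q_le
  obtain ⟨t, ht1, ht2, ht3, hbt⟩ := exists_prev_not_normal ℒ Y S.not_normal_q (k - 1) (by omega)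
  obtain ⟨τ, hτ, hτ0⟩ := S.exists_ne (i := t) (by omega) (by omega)
  have hYτ := S.Y_ne_of_not_normal (by omega) (by omega) ht3 hτ hτ0
  obtain ⟨n, hn⟩ : ∃ n, k = t + 2 + n := ⟨k - 2 - t, by omega⟩
  set v := (X ^ n) (Y τ) with hv
  have hvm : v ∈ ℒ (k - 1) := S.pow_mem' n (S.Y_mem hτ) (by omega)
  have hv0 : v ≠ 0 := (S.run_normal (by omega) (by omega) (S.Y_mem hτ) hYτ n
    fun j h1 h2 => hbt j (by omega) (by omega)).2
  have hYv0 := S.not_normal_last hvm hv0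
  have hXv0 := S.X_last_ne hvm hv0
  have hYvm : Y v ∈ ℒ k := S.Y_mem' hvm (by omega)
  have hXvm : X v ∈ ℒ k := S.X_mem' hvm (by omega)
  have hYY := S.Y_sq (by omega)
  have hsp : SpannedBy ℒ (k + 1) (X (Y v)) := by
    refine ⟨S.X_mem hYvm, fun w hw => ?_⟩
    obtain ⟨a, b, rfl⟩ := S.cover (by omega) hYvm hYv0 w hw
    exact ⟨a, by rw [hYY, smul_zero, add_zero]⟩
  have hz0 := hsp.ne_zero hk1
  obtain ⟨ρ, hρ⟩ := hsp.2 _ (S.Y_mem hXvm)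
  obtain ⟨σ, hσ⟩ := hsp.2 _ (S.X_mem hXvm)
  -- If ρ = 0, then Xv + σYv is a nonzero element of degree k killed by both X and Y.
  have hρ0 : ρ ≠ 0 := by
    rintro rfl
    have hu0 : X v + σ • Y v ≠ 0 := by
      intro h
      have := (S.indep hvm hv0 1 σ (by rw [one_smul, h])).1
      simp at this
    refine hk1 (S.bot_of_zero (by omega) ((ℒ k).add_mem hXvm ((ℒ k).smul_mem σ hYvm)) hu0 ?_ ?_)
    · rw [map_add, map_smul, hσ, add_self_zero F]
    · rw [map_add, map_smul, hρ, hYY, smul_zero, zero_smul, add_zero]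
  have hgap := S.gap he hq ht1 ht2 (by omega) ht3 S.not_normal_pred hbt
  have hn2 : q / 2 ≤ n + 1 := by
    rcases hgap with h | ⟨b, hb, h⟩
    · omega
    · have : 2 ^ b ≤ q / 2 := by
        obtain ⟨d, rfl⟩ : ∃ d, e = d + 1 := ⟨e - 1, by omega⟩
        rw [hq, pow_succ, Nat.mul_div_cancel _ (by norm_num)]
        exact Nat.pow_le_pow_right (by norm_num) (by omega)
      omega
  have h8 : 8 ∣ q := hq ▸ pow_dvd_pow 2 he
  -- Since Xτ = cYτ, pulling τ back by q/2 - 1 steps and applying a power of X of exponent at least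
  -- q gives cXv = 0.
  have hXτ : X τ = 0 := by
    obtain ⟨c, hc⟩ := S.line (by omega) (by omega) (S.Y_mem hτ) hYτ (S.X_mem hτ)
    obtain ⟨μ, hμ, hμτ⟩ := S.exists_pow_eq (i := t - (q / 2 - 1)) (by omega) (q / 2 - 1)
      (by omega) (by omega) hτ fun l h1 h2 =>
        S.half_le_gap he hq t ht1 (by omega) ht3 l h2 (by omega)
    have h0 : (X ^ (n + 1 + 1 + (q / 2 - 1))) μ = 0 := S.X_pow_q hq (by omega) μ
    rw [← pow_apply_pow, hμτ, ← pow_apply_apply, hc, map_smul, ← apply_pow, ← hv] at h0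
    rcases smul_eq_zero.1 h0 with h | h
    · rw [hc, h, zero_smul]
    · exact absurd h hXv0
  obtain ⟨b, hb, hnb⟩ : ∃ b, b < e ∧ k - 1 + 2 ^ b = t + q := by
    rcases hgap with h | h
    -- Difference q would give Xv = X^q Yτ = 0.
    · exfalso
      apply hXv0
      rw [hv, apply_pow]
      exact S.X_pow_q hq (by omega) _
    · exact h
  -- For b ≥ 2 the number n + 2 = q - 2^b + 1 is odd. With Xμ = τ, the bracket [μ, X^(n+2) y] equals
  -- (n + 2)X^(n+1) Yτ = Xv, and Y would kill it although YXv = ρXYv is nonzero.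
  have hb1 : b ≤ 1 := by
    by_contra hb2
    have h4 : 4 ∣ 2 ^ b := by
      have : 2 ^ 2 ∣ 2 ^ b := pow_dvd_pow 2 (by omega)
      simpa using this
    have h4' : 4 ∣ q := by
      have : 2 ^ 2 ∣ 2 ^ e := pow_dvd_pow 2 (by omega)
      rw [hq]; simpa using this
    have hpos : 0 < 2 ^ b := by positivity
    obtain ⟨μ, hμ, hμτ⟩ := S.exists_pow_eq (i := t - 1) (by omega) 1
      (by omega) (by omega) hτ fun l h1 h2 =>
        S.half_le_gap he hq t ht1 (by omega) ht3 l h2 (by omega)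
    have hμY : Y μ = 0 := S.half_le_gap he hq t ht1 (by omega) ht3 _ (by omega) (by omega) _ hμ
    have h0 : Y ⁅μ, (X ^ (n + 2)) y⁆ = 0 := by
      rw [S.derY, S.Y_b (by omega), hμY, zero_lie, lie_zero, add_zero]
    rw [S.derX.lie_pow_one (m := 1)] at h0
    · rw [S.lie_y, hμτ, map_smul, Nat.choose_one_right, cast_of_odd (by rw [Nat.odd_iff]; omega),
        one_smul, show n + 2 - 1 = n + 1 by omega, ← apply_pow, ← hv, hρ] at h0
      exact smul_ne_zero hρ0 hz0 h0
    · intro l hl _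
      obtain rfl : l = 0 := by omega
      rw [S.lie_y]; simpa using hμY
    · intro l hl _
      obtain ⟨j, rfl⟩ : ∃ j, l = j + 1 + 1 := ⟨l - 2, by omega⟩
      rw [← pow_apply_pow, hμτ, ← pow_apply_apply, hXτ, map_zero, zero_lie]
  have hd : 2 ^ b = 1 ∨ 2 ^ b = 2 := by
    interval_cases b <;> simp
  have hnq : n = q - 2 ^ b - 1 := by
    clear hgap
    rcases hd with h | h <;> rw [h] at hnb ⊢ <;> omega
  have htail : ∀ a, a + 3 ≤ q → Y ((X ^ a) (Y v)) = 0 := by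
    intro a
    induction a using Nat.strong_induction_on with
    | _ a ih =>
      intro ha
      rcases Nat.eq_zero_or_pos a with rfl | hapos
      · simpa using hYY v
      -- u lies m steps before v, with m + a = q - 2. The two surviving terms of [u, X^(q-2) y] are
      -- multiples of X^a Yv once Y is applied outside or YXv is rewritten as ρXYv.
      obtain ⟨m, hm⟩ : ∃ m, m = q - 2 - a := ⟨_, rfl⟩
      set u := (X ^ (n - m)) (Y τ) with hu
      have hum : u ∈ ℒ (t + 1 + (n - m)) := S.pow_mem (S.Y_mem hτ) _
      have huv : (X ^ m) u = v := by rw [hu, pow_apply_pow, hv, show m + (n - m) = n by omega]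
      have hun : ∀ l, l < m → Y ((X ^ l) u) = 0 := fun l hl =>
        hbt (t + 1 + (n - m) + l) (by omega) (by omega) _ (S.pow_mem hum l)
      have h0 : Y ⁅u, (X ^ (q - 2)) y⁆ = 0 := by
        have : Y u = 0 := by simpa using hun 0 (by omega)
        rw [S.derY, S.Y_b (by omega), this, zero_lie, lie_zero, add_zero]
      rw [S.derX.lie_pow_two (m := m)] at h0
      · rw [S.lie_y, S.lie_y, ← apply_pow, huv, hρ, show q - 2 - m = a by omega,
          show q - 2 - (m + 1) = a - 1 by omega, map_smul, pow_apply_apply,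
          show a - 1 + 1 = a by omega, smul_smul, ← add_smul, map_smul] at h0
        rcases smul_eq_zero.1 h0 with h | h
        · exfalso
          -- By Pascal the two binomials add up to C(q - 1, m + 1), which is odd. Exactly one of
          -- them is odd, so the total coefficient is 1 or ρ, nonzero in either case.
          have hodd : Odd ((q - 2).choose m + (q - 2).choose (m + 1)) := by
            rw [← Nat.choose_succ_succ, show (q - 2).succ = 2 ^ e - 1 by omega]
            exact odd_choose_two_pow_sub_one e _ (by omega)
          rcases Nat.even_or_odd ((q - 2).choose m) with h1 | h1
          · have h2 : Odd ((q - 2).choose (m + 1)) := by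
              rw [Nat.odd_add'] at hodd; exact hodd.2 h1
            rw [cast_of_even h1, cast_of_odd h2, one_mul, zero_add] at h
            exact hρ0 h
          · have h2 : Even ((q - 2).choose (m + 1)) := by
              rw [Nat.odd_add] at hodd; exact hodd.1 h1
            rw [cast_of_odd h1, cast_of_even h2, zero_mul, add_zero] at h
            exact one_ne_zero h
        · exact h
      · intro l hl _
        rw [S.lie_y]; exact hun l hl
      · intro l hl hl2
        obtain ⟨j, rfl⟩ : ∃ j, l = j + 1 + 1 + m := ⟨l - 2 - m, by omega⟩
        rw [S.lie_y, ← pow_apply_pow, huv, ← pow_apply_apply, ← pow_apply_apply, hσ, map_smul,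
          map_smul, pow_apply_apply, ih (j + 1) (by omega) (by omega), smul_zero]
  refine ⟨2 ^ b, t, τ, v, ρ, ⟨S, he, hq, hd, ht1, by omega, fun i h1 h2 => hbt i h1 (by omega), hτ,
    hXτ, by rw [hv, hnq], hv0, hρ, hρ0, hsp, htail⟩⟩

end Tails
end ThinLie

namespace ThinLie

/-! ### Brackets with w and passage to neighbouring noncentralized degrees -/

section Neighbours

variable {F L : Type*} [Field F] [CharP F 2] [LieRing L] [LieAlgebra F L]
variable {ℒ : ℕ → Submodule F L} {k q : ℕ} {x y : L} {X Y : Module.End F L}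

namespace Frame

/-- Brackets with `w = [y, x, …, x]` of degree `q`. -/
theorem lie_w (S : Frame ℒ k q x y X Y) {e : ℕ} (hq : q = 2 ^ e) {u A : L} {i : ℕ}
    (hi : i + 1 ≤ q) (hu : (X ^ i) u = A) (hA : X A = 0) (h : ∀ l, l < i → Y ((X ^ l) u) = 0) :
    ⁅u, (X ^ (q - 1)) y⁆ = (X ^ (q - 1 - i)) (Y A) := by
  rw [S.derX.lie_pow_one (m := i)]
  · rw [hu, S.lie_y, hq, cast_of_odd (odd_choose_two_pow_sub_one e i (by omega)), one_smul]
  · intro l hl _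
    rw [S.lie_y, h l hl]
  · intro l hl _
    obtain ⟨j, rfl⟩ : ∃ j, l = j + 1 + i := ⟨l - 1 - i, by omega⟩
    rw [← pow_apply_pow, hu, ← pow_apply_apply, hA, map_zero, zero_lie]

theorem exists_run (S : Frame ℒ k q x y X Y) {e : ℕ} (he : 3 ≤ e) (hq : q = 2 ^ e) {p i : ℕ}
    {A : L} (hp : q ≤ p) (hpk : p < k) (hpn : ¬ Normal ℒ Y p) (hA : A ∈ ℒ p) (hi : i < q / 2) :
    ∃ κ ∈ ℒ (p - i), (X ^ i) κ = A ∧ ∀ l, l < i → Y ((X ^ l) κ) = 0 := by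
  have hq8 : 8 ≤ q := by
    rw [hq]; calc 8 = 2 ^ 3 := by norm_num
      _ ≤ 2 ^ e := Nat.pow_le_pow_right (by norm_num) he
  obtain ⟨κ, h1, h2⟩ := S.exists_pow_eq (i := p - i) (by omega) i (by omega) hpk hA
    fun l h1 h2 => S.half_le_gap he hq p hp hpk hpn l h2 (by omega)
  exact ⟨κ, h1, h2, fun l hl =>
    S.half_le_gap he hq p hp hpk hpn (p - i + l) (by omega) (by omega) _ (S.pow_mem h1 l)⟩

/-- The scalar c exists because the next component is a line spanned by a Y-image. It lets X^(n+1)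
YA be replaced by a multiple of an element in the image of Y, which is how the difference n + 1 is
tested later. -/
theorem exists_next (S : Frame ℒ k q x y X Y) {e : ℕ} (he : 3 ≤ e) (hq : q = 2 ^ e) {p t : ℕ}
    {A : L} (hp : q ≤ p) (hpt : p < t) (htk : t + 1 < k) (ht : ¬ Normal ℒ Y t) (hA : A ∈ ℒ p)
    (hYA : Y A ≠ 0) :
    ∃ n, (n + 1 = q ∨ ∃ b, b < e ∧ n + 1 + 2 ^ b = q) ∧ p + 1 + n ≤ t ∧
      (X ^ n) (Y A) ≠ 0 ∧ Y ((X ^ n) (Y A)) ≠ 0 ∧ (∀ l, l < n → Y ((X ^ l) (Y A)) = 0) ∧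
      (∃ c : F, (X ^ (n + 1)) (Y A) = c • Y ((X ^ n) (Y A))) ∧ ¬ Normal ℒ Y (p + 1 + n) ∧
      ∀ i, p < i → i < p + 1 + n → Normal ℒ Y i := by
  have hq8 : 8 ≤ q := by
    rw [hq]; calc 8 = 2 ^ 3 := by norm_num
      _ ≤ 2 ^ e := Nat.pow_le_pow_right (by norm_num) he
  obtain ⟨s, h1, h2, h3, h4⟩ := exists_next_not_normal ℒ Y ht hpt
  obtain ⟨n, rfl⟩ : ∃ n, s = p + 1 + n := ⟨s - p - 1, by omega⟩
  have hg := S.gap he hq hp h1 (by omega) (fun h => hYA (h _ hA)) h3 h4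
  have hYm := S.Y_mem hA
  have hne := (S.run_normal (by omega) (by omega) hYm hYA n fun j h1 h2 =>
    h4 j (by omega) (by omega)).2
  have hYne := S.Y_ne_of_not_normal (by omega) (by omega) h3 (S.pow_mem hYm n) hne
  refine ⟨n, ?_, h2, hne, hYne, fun l hl => h4 (p + 1 + l) (by omega) (by omega) _
    (S.pow_mem hYm l), ?_, h3, h4⟩
  · rcases hg with h | ⟨b, hb, h⟩
    · left; omega
    · right; exact ⟨b, hb, by omega⟩
  · rw [← apply_pow]
    exact S.line (by omega) (by omega) (S.Y_mem (S.pow_mem hYm n)) hYne (S.X_mem (S.pow_mem hYm n))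

/-- For a difference of at least q - 1, the relation X^q = 0 applied one step below A reads cU = 0,
whence XA = 0. -/
theorem exists_prev (S : Frame ℒ k q x y X Y) {e : ℕ} (he : 3 ≤ e) (hq : q = 2 ^ e) {p : ℕ}
    {U : L} (hp : q < p) (hpk : p + 1 < k) (hU : U ∈ ℒ p) (hYU : Y U ≠ 0) :
    ∃ n A, (n + 1 = q ∨ ∃ b, b < e ∧ n + 1 + 2 ^ b = q) ∧ q + 1 + n ≤ p ∧
      A ∈ ℒ (p - 1 - n) ∧ (X ^ n) (Y A) = U ∧ (∀ l, l < n → Y ((X ^ l) (Y A)) = 0) ∧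
      (∃ c : F, X A = c • Y A) ∧ (q ≤ n + 2 → X A = 0) ∧ ¬ Normal ℒ Y (p - 1 - n) := by
  have hq8 : 8 ≤ q := by
    rw [hq]; calc 8 = 2 ^ 3 := by norm_num
      _ ≤ 2 ^ e := Nat.pow_le_pow_right (by norm_num) he
  have hpn : ¬ Normal ℒ Y p := fun h => hYU (h _ hU)
  have hU0 : U ≠ 0 := fun h => hYU (by rw [h, map_zero])
  obtain ⟨s, h1, h2, h3, h4⟩ := exists_prev_not_normal ℒ Y S.not_normal_q p hp
  obtain ⟨n, rfl⟩ : ∃ n, p = s + 1 + n := ⟨p - s - 1, by omega⟩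
  have hs : s + 1 + n - 1 - n = s := by omega
  have hg := S.gap he hq h1 h2 (by omega) h3 hpn h4
  obtain ⟨A₀, hA₀, hA₀0⟩ := S.exists_ne (i := s) (by omega) (by omega)
  have hYA₀ := S.Y_ne_of_not_normal (by omega) (by omega) h3 hA₀ hA₀0
  have hYm := S.Y_mem hA₀
  have hne := (S.run_normal (by omega) (by omega) hYm hYA₀ n fun j h1 h2 =>
    h4 j (by omega) (by omega)).2
  obtain ⟨a, ha⟩ := S.line (by omega) (by omega) (S.pow_mem hYm n) hne hU
  have hA : a • A₀ ∈ ℒ s := (ℒ s).smul_mem _ hA₀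
  have hAU : (X ^ n) (Y (a • A₀)) = U := by rw [map_smul, map_smul, ha]
  have hYA : Y (a • A₀) ≠ 0 := fun h => hU0 (by rw [← hAU, h, map_zero])
  obtain ⟨c, hc⟩ := S.line (by omega) (by omega) (S.Y_mem hA) hYA (S.X_mem hA)
  refine ⟨n, a • A₀, ?_, by omega, by rw [hs]; exact hA, hAU, fun l hl =>
    h4 (s + 1 + l) (by omega) (by omega) _ (S.pow_mem (S.Y_mem hA) l), ⟨c, hc⟩, ?_,
    by rw [hs]; exact h3⟩
  · rcases hg with h | ⟨b, hb, h⟩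
    · left; omega
    · right; exact ⟨b, hb, by omega⟩
  · intro hn
    obtain ⟨κ, hκ, hκA, -⟩ := S.exists_run he hq (i := 1) h1 (by omega) h3 hA (by omega)
    have h0 : (X ^ (n + 1 + 1)) κ = 0 := S.X_pow_q hq (by omega) κ
    rw [← pow_apply_pow, hκA, ← pow_apply_apply, hc, map_smul, hAU] at h0
    rcases smul_eq_zero.1 h0 with h | h
    · rw [hc, h, zero_smul]
    · exact absurd h hU0

end Frame

namespace Tail

variable {e d t : ℕ} {τ v : L} {ρ : F}

theorem q_ge (T : Tail ℒ k q e x y X Y d t τ v ρ) : 8 ≤ q := by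
  rw [T.hq]; calc 8 = 2 ^ 3 := by norm_num
    _ ≤ 2 ^ e := Nat.pow_le_pow_right (by norm_num) T.he

theorem q_dvd (T : Tail ℒ k q e x y X Y d t τ v ρ) : 8 ∣ q :=
  T.hq ▸ pow_dvd_pow 2 T.he

theorem t_lt (T : Tail ℒ k q e x y X Y d t τ v ρ) : t + 1 < k := by
  have := T.q_ge
  have := T.t_eq
  rcases T.hd with h | h <;> omega

theorem v_mem (T : Tail ℒ k q e x y X Y d t τ v ρ) : v ∈ ℒ (k - 1) := by
  have := T.q_ge
  have := T.t_eq
  rw [← T.v_eq]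
  exact T.S.pow_mem' _ (T.S.Y_mem T.τ_mem) (by rcases T.hd with h | h <;> omega)

theorem Yτ_ne (T : Tail ℒ k q e x y X Y d t τ v ρ) : Y τ ≠ 0 := by
  intro h
  apply T.v_ne
  rw [← T.v_eq, h, map_zero]

theorem not_normal_t (T : Tail ℒ k q e x y X Y d t τ v ρ) : ¬ Normal ℒ Y t :=
  fun h => T.Yτ_ne (h _ T.τ_mem)

theorem Y_sq (T : Tail ℒ k q e x y X Y d t τ v ρ) (u : L) : Y (Y u) = 0 :=
  T.S.Y_sq (by have := T.q_ge; omega) u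

theorem spanned_pow (T : Tail ℒ k q e x y X Y d t τ v ρ) {a : ℕ} (ha1 : 1 ≤ a)
    (ha : a + 2 ≤ q) : SpannedBy ℒ (k + a) ((X ^ a) (Y v)) := by
  have h := T.spanned.pow T.S (by omega) (a - 1) (fun l hl => by
    rw [pow_apply_apply]; exact T.tail _ (by omega))
  rwa [pow_apply_apply, show a - 1 + 1 = a by omega, show k + 1 + (a - 1) = k + a by omega] at h

theorem normal_k (T : Tail ℒ k q e x y X Y d t τ v ρ) {i : ℕ} (hi : k < i)
    (hi2 : i + 3 ≤ k + q) : Normal ℒ Y i := by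
  obtain ⟨a, rfl⟩ := Nat.exists_eq_add_of_lt hi
  exact (T.spanned_pow (a := a + 1) (by omega) (by omega)).normal (T.tail _ (by omega))

/-- The exponent q/2 + 1 is the largest one that occurs in the later comparisons of coefficients. -/
theorem Xpow_ne (T : Tail ℒ k q e x y X Y d t τ v ρ) (hbig : ℒ (k + q / 2 + 1) ≠ ⊥) {a : ℕ}
    (ha : a ≤ q / 2 + 1) : (X ^ a) (Y v) ≠ 0 := by
  have := T.q_ge
  have h1 := (T.spanned_pow (a := q / 2 + 1) (by omega) (by omega)).ne_zero hbig
  exact fun h => h1 (pow_apply_zero_of_le h ha)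

theorem z_ne (T : Tail ℒ k q e x y X Y d t τ v ρ) (hbig : ℒ (k + q / 2 + 1) ≠ ⊥) :
    X (Y v) ≠ 0 := by
  simpa using T.Xpow_ne hbig (a := 1) (by omega)

theorem Yv_ne (T : Tail ℒ k q e x y X Y d t τ v ρ) : Y v ≠ 0 :=
  T.S.not_normal_last T.v_mem T.v_ne

theorem exists_XXv (T : Tail ℒ k q e x y X Y d t τ v ρ) : ∃ σ : F, X (X v) = σ • X (Y v) := by
  have := T.S.q_le
  exact T.spanned.2 _ (T.S.X_mem' (T.S.X_mem' T.v_mem (j := k) (by omega)) rfl)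

theorem eq_v (T : Tail ℒ k q e x y X Y d t τ v ρ) {u : L} (hu : u ∈ ℒ (k - 1))
    (h : Y u = Y v) : u = v := by
  have := T.S.q_le
  have := T.q_ge
  obtain ⟨a, rfl⟩ := T.S.line (by omega) (by omega) T.v_mem T.v_ne hu
  have h0 : (a - 1) • Y v = 0 := by rw [sub_smul, one_smul, ← map_smul, h, sub_self]
  rcases smul_eq_zero.1 h0 with h1 | h1
  · rw [sub_eq_zero.1 h1, one_smul]
  · exact absurd h1 T.Yv_ne

theorem Y_pow_Yτ (T : Tail ℒ k q e x y X Y d t τ v ρ) {l : ℕ} (hl : l + d + 1 < q) :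
    Y ((X ^ l) (Y τ)) = 0 :=
  T.hbt (t + 1 + l) (by omega) (by have := T.t_eq; omega) _ (T.S.pow_mem (T.S.Y_mem T.τ_mem) l)

/-- Brackets of the elements just before the second diamond with `w`. -/
theorem lie_w_v (T : Tail ℒ k q e x y X Y d t τ v ρ) {u : L} {m : ℕ} (hm : m + 2 ≤ q)
    (h1 : 1 ≤ m ∨ X (X v) = 0) (hu : (X ^ m) u = v) (h : ∀ l, l < m → Y ((X ^ l) u) = 0) :
    ⁅u, (X ^ (q - 1)) y⁆ = (1 + ρ) • (X ^ (q - 1 - m)) (Y v) := by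
  obtain ⟨σ, hσ⟩ := T.exists_XXv
  rw [T.S.derX.lie_pow_two (m := m)]
  · rw [hu, ← apply_pow, hu, T.S.lie_y, T.S.lie_y, T.YXv, map_smul, pow_apply_apply,
      show q - 1 - (m + 1) + 1 = q - 1 - m by omega, T.hq,
      cast_of_odd (odd_choose_two_pow_sub_one e _ (by have := T.hq; omega)),
      cast_of_odd (odd_choose_two_pow_sub_one e _ (by have := T.hq; omega)), one_smul, one_smul,
      add_smul, one_smul]
  · intro l hl _
    rw [T.S.lie_y, h l hl]
  · intro l hl hl2
    obtain ⟨j, rfl⟩ : ∃ j, l = j + 1 + 1 + m := ⟨l - 2 - m, by omega⟩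
    rw [T.S.lie_y, ← pow_apply_pow, hu, ← pow_apply_apply, ← pow_apply_apply]
    rcases h1 with h1 | h1
    · rw [hσ, map_smul, map_smul, pow_apply_apply, T.tail _ (by omega), smul_zero]
    · rw [h1, map_zero, map_zero]

/-- The defining relation of `w` forces the second difference to be less than `q`. -/
theorem pow_Yw_eq_zero (T : Tail ℒ k q e x y X Y d t τ v ρ) :
    (X ^ (q - 1)) (Y ((X ^ (q - 1)) y)) = 0 := by
  have := T.q_ge
  have h := T.S.lie_w T.hq (i := 0) (u := (X ^ (q - 1)) y) (by omega) (by simp) T.S.X_w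
    (by intro l hl; omega)
  rw [lie_self] at h
  simpa using h.symm

end Tail

end Neighbours
end ThinLie

namespace ThinLie

/-! ### Last difference q - 2 -/

section SecondGapTwo

variable {F L : Type*} [Field F] [CharP F 2] [LieRing L] [LieAlgebra F L]
variable {ℒ : ℕ → Submodule F L} {k q : ℕ} {x y : L} {X Y : Module.End F L}
variable {e t : ℕ} {τ v : L} {ρ : F}

namespace Tail

/-- Brackets of the elements before `τ` with the elements after `w`, if the last difference is
`q - 2`. -/
theorem lie_three (T : Tail ℒ k q e x y X Y 2 t τ v ρ) {κ : L} {i a : ℕ} (hi : 2 ≤ i)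
    (hiq : i + 1 ≤ q) (hκ : (X ^ i) κ = τ) (h : ∀ l, l < i → Y ((X ^ l) κ) = 0) :
    ⁅κ, (X ^ (i - 2 + a)) (Y ((X ^ (q - 1)) y))⁆ =
      (((i - 2 + a).choose (i - 2) : ℕ) + ρ * ((i - 2 + a).choose (i - 1) : ℕ) +
        (1 + ρ) * ((i - 2 + a).choose i : ℕ) : F) • (X ^ a) (Y v) := by
  have hq8 := T.q_ge
  obtain ⟨m, rfl⟩ : ∃ m, i = m + 2 := ⟨i - 2, by omega⟩
  have hv := T.v_eq
  have hw : ∀ l, l ≤ m + 2 → ⁅(X ^ l) κ, (X ^ (q - 1)) y⁆ =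
      (X ^ (q - 1 - (m + 2 - l))) (Y τ) := fun l hl =>
    T.S.lie_w T.hq (by omega) (by rw [pow_apply_pow, show m + 2 - l + l = m + 2 by omega, hκ])
      T.X_τ fun j hj => by rw [pow_apply_pow]; exact h _ (by omega)
  have hY : ∀ l, l < m + 2 → ⁅(X ^ l) κ, Y ((X ^ (q - 1)) y)⁆ =
      Y ((X ^ (q - 1 - (m + 2 - l))) (Y τ)) := fun l hl => by
    rw [← hw l hl.le, T.S.derY, h l hl, zero_lie, zero_add]
  rw [T.S.derX.lie_pow_three (m := m)]
  · rw [show m + 2 - 2 = m by omega, show m + 2 - 1 = m + 1 by omega]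
    have e0 : ⁅(X ^ m) κ, Y ((X ^ (q - 1)) y)⁆ = Y v := by
      rw [hY m (by omega), ← hv, show q - 1 - (m + 2 - m) = q - 2 - 1 by omega]
    have e1 : ⁅(X ^ (m + 1)) κ, Y ((X ^ (q - 1)) y)⁆ = ρ • X (Y v) := by
      rw [hY _ (by omega), ← T.YXv, ← hv, apply_pow,
        show q - 1 - (m + 2 - (m + 1)) = q - 2 - 1 + 1 by omega]
    -- [τ, w] = X^(q-1) Yτ = X(Xv) is a multiple of XYv, which Y kills. Therefore [τ, Yw] = [Yτ, w].
    have e2 : ⁅(X ^ (m + 2)) κ, Y ((X ^ (q - 1)) y)⁆ = (1 + ρ) • (X ^ 2) (Y v) := by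
      obtain ⟨σ, hσ⟩ := T.exists_XXv
      have h1 := T.S.derY ((X ^ (m + 2)) κ) ((X ^ (q - 1)) y)
      have h2 : ⁅Y τ, (X ^ (q - 1)) y⁆ = (1 + ρ) • (X ^ (q - 1 - (q - 3))) (Y v) :=
        T.lie_w_v (by omega) (by left; omega) (by rw [← hv, show q - 3 = q - 2 - 1 by omega])
          fun l hl => T.Y_pow_Yτ (by omega)
      have h3 : (X ^ (q - 1)) (Y τ) = σ • X (Y v) := by
        rw [← hσ, ← hv, apply_pow, apply_pow, show q - 1 = q - 2 - 1 + 1 + 1 by omega]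
      have h4 := T.tail 1 (by omega)
      rw [pow_one] at h4
      rw [hw _ le_rfl, hκ, Nat.sub_self, Nat.sub_zero, h3, map_smul, h4, smul_zero, h2,
        show q - 1 - (q - 3) = 2 by omega] at h1
      rw [hκ]
      have := eq_of_add_eq_zero F h1.symm
      rw [← this]
    rw [e0, e1, e2, Nat.add_sub_cancel_left, map_smul, map_smul, pow_apply_apply, pow_apply_pow]
    -- For a = 0 and a = 1 the truncated exponents are not those of the formula, but the
    -- corresponding binomials vanish.
    rcases Nat.lt_or_ge a 1 with ha | ha
    · obtain rfl : a = 0 := by omega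
      rw [Nat.add_zero, Nat.choose_succ_self, Nat.choose_eq_zero_of_lt (by omega : m < m + 2)]
      simp
    rcases Nat.lt_or_ge a 2 with ha2 | ha2
    · obtain rfl : a = 1 := by omega
      rw [Nat.choose_succ_self (m + 1), show m + 1 - (m + 1) + 1 = 1 by omega]
      simp only [Nat.cast_zero, zero_smul, mul_zero, add_zero]
      module
    · rw [show m + a - (m + 1) + 1 = a by omega, show m + a - (m + 2) + 2 = a by omega]
      module
  · intro l hl _
    rw [hY l (by omega)]
    exact T.Y_pow_Yτ (by omega)
  · intro l hl _
    obtain ⟨j, rfl⟩ : ∃ j, l = j + 1 + (m + 2) := ⟨l - 3 - m, by omega⟩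
    rw [← pow_apply_pow, hκ, ← pow_apply_apply, T.X_τ, map_zero, zero_lie]

/-- If the last difference is `q - 2`, then `w` spans the only component centralized by `x` before
the second diamond. -/
theorem eq_of_two (T : Tail ℒ k q e x y X Y 2 t τ v ρ) (hbig : ℒ (k + q / 2 + 1) ≠ ⊥) :
    t = q := by
  by_contra htq
  have hq8 := T.q_ge
  have hqd := T.q_dvd
  have hqt : q < t := lt_of_le_of_ne T.q_le (Ne.symm htq)
  have hte := T.t_eq
  have htk := T.t_lt
  have hS := T.S
  have hhalf : ∀ b, b < e → 2 ^ b ≤ q / 2 := fun b hb => by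
    obtain ⟨d, rfl⟩ : ∃ d, e = d + 1 := ⟨e - 1, by omega⟩
    rw [T.hq, pow_succ, Nat.mul_div_cancel _ (by norm_num)]
    exact Nat.pow_le_pow_right (by norm_num) (by omega)
  set E := Y ((X ^ (q - 1)) y) with hE
  have hEm : E ∈ ℒ (q + 1) := hS.Y_mem hS.w_mem
  obtain ⟨n, hn, hnt, hne, hYne, hrun, ⟨c, hc⟩, -, -⟩ :=
    hS.exists_next T.he T.hq (p := q) le_rfl hqt htk T.not_normal_t hS.w_mem hS.Y_w_ne
  rw [← hE] at hne hYne hrun hc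
  -- Take κ lying i steps below τ. Since [κ, X^n E] is a multiple of a tail element killed by Y, and
  -- Yκ = 0, also [κ, Y X^n E] = 0. As X^(n+1) E is a multiple of Y X^n E, the coefficient of [κ,
  -- X^(n+1) E] vanishes.
  have key : ∀ i, 2 ≤ i → i < q / 2 → i ≤ n → n + 5 ≤ q + i → n + 3 - i ≤ q / 2 + 1 →
      (((n + 1).choose (i - 2) : ℕ) + ρ * ((n + 1).choose (i - 1) : ℕ) +
        (1 + ρ) * ((n + 1).choose i : ℕ) : F) = 0 := by
    intro i h1 h2 h3 h4 h5
    obtain ⟨κ, -, hκ, hκY⟩ := hS.exists_run T.he T.hq T.q_le (by omega) T.not_normal_t T.τ_mem h2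
    have a1 := T.lie_three (a := n + 3 - i) h1 (by omega) hκ hκY
    have a2 := T.lie_three (a := n + 2 - i) h1 (by omega) hκ hκY
    rw [← hE, show i - 2 + (n + 3 - i) = n + 1 by omega] at a1
    rw [← hE, show i - 2 + (n + 2 - i) = n by omega] at a2
    have hκ0 : Y κ = 0 := by simpa using hκY 0 (by omega)
    have a3 := hS.derY κ ((X ^ n) E)
    rw [a2, map_smul, T.tail _ (by omega), smul_zero, hκ0, zero_lie, zero_add] at a3
    rw [hc, lie_smul, ← a3, smul_zero] at a1
    exact (smul_eq_zero.1 a1.symm).resolve_right (T.Xpow_ne hbig h5)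
  have hn2 : n + 2 = q := by
    rcases hn with h | ⟨b, hb, h⟩
    · exfalso
      apply hne
      rw [show n = q - 1 by omega]
      exact T.pow_Yw_eq_zero
    have hb2 := hhalf b hb
    rcases Nat.lt_or_ge b 1 with h1 | h1
    · obtain rfl : b = 0 := by omega
      omega
    exfalso
    rcases Nat.lt_or_ge b 2 with h2 | h2
    · obtain rfl : b = 1 := by omega
      -- Here n + 1 = q - 2 and i is odd, so only the middle binomial is odd and the relation reads
      -- ρ = 0.
      have := key (q / 2 - 1) (by omega) (by omega) (by omega) (by omega) (by omega)
      rw [show n + 1 = 2 ^ e - 2 by rw [← T.hq]; omega,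
        cast_of_even (even_choose_sub_two (by have := T.he; omega) (by rw [Nat.odd_iff]; omega)),
        cast_of_odd (odd_choose_sub_two (by have := T.he; omega) (by rw [← T.hq]; omega)
          (by rw [Nat.even_iff]; omega)),
        cast_of_even (even_choose_sub_two (by have := T.he; omega) (by rw [Nat.odd_iff]; omega)),
        mul_zero, mul_one, add_zero, zero_add] at this
      exact T.ρ_ne this
    · have h4 : 4 ≤ 2 ^ b := by
        calc 4 = 2 ^ 2 := by norm_num
          _ ≤ 2 ^ b := Nat.pow_le_pow_right (by norm_num) h2
      have h5 : n + 1 = 2 ^ e - 2 ^ b + 0 := by rw [← T.hq]; omega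
      have hqe := T.hq
      have c0 := choose_sub_two_pow_modEq (s := 0) (r := 0) hb (by omega) (by omega)
      have c1 := choose_sub_two_pow_modEq (s := 1) (r := 0) hb (by omega) (by omega)
      have c2 := choose_sub_two_pow_modEq (s := 2) (r := 0) hb (by omega) (by omega)
      -- This i makes i - 2 equal to q/2 - 2^b, whose binary digits are among those of n + 1 = q -
      -- 2^b. The first binomial is odd and the other two are even, so the relation reads 1 = 0.
      have := key (q / 2 - 2 ^ b + 2) (by omega) (by omega) (by omega) (by omega) (by omega)
      rw [h5, show q / 2 - 2 ^ b + 2 - 2 = 2 ^ e / 2 - 2 ^ b + 0 by omega,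
        show q / 2 - 2 ^ b + 2 - 1 = 2 ^ e / 2 - 2 ^ b + 1 by omega,
        show q / 2 - 2 ^ b + 2 = 2 ^ e / 2 - 2 ^ b + 2 by omega,
        cast_of_odd (odd_of_modEq c0 (by simp)), cast_of_even (even_of_modEq c1 (by simp)),
        cast_of_even (even_of_modEq c2 (by simp))] at this
      simp at this
  have hEY : ∀ j, j + 2 < q → Y ((X ^ j) E) = 0 := fun j hj => hrun j (by omega)
  clear hn key hne hYne hrun hc
  -- The first difference after degree q is now q - 1. Each possible difference before τ is refuted
  -- by comparing Y[A, X^j E] with [YA, X^j E].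
  obtain ⟨m, A, hm, hmt, hA, hAτ, hAY, -, hXA, -⟩ :=
    hS.exists_prev T.he T.hq hqt htk T.τ_mem T.Yτ_ne
  have hm3 : q / 2 ≤ m + 1 := by
    rcases hm with h | ⟨b, hb, h⟩
    · omega
    · have := hhalf b hb; omega
  have hcomm : ∀ j, j + 2 < q → Y ⁅A, (X ^ j) E⁆ = ⁅Y A, (X ^ j) E⁆ := fun j hj => by
    rw [hS.derY, hEY j hj, lie_zero, add_zero]
  have hform : ∀ a, _ := fun a => T.lie_three (a := a) (i := m) (by omega)
    (by
      rcases hm with h | ⟨b, hb, h⟩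
      · omega
      · exact h ▸ Nat.le_add_right _ _) hAτ hAY
  rw [← hE] at hform
  have hpowA : X A = 0 → ∀ j, ⁅A, (X ^ j) E⁆ = (X ^ j) ⁅A, E⁆ := fun h j => by
    rw [hS.derX.lie_pow_one (m := 0)]
    · simp
    · intro l hl; omega
    · intro l hl _
      obtain ⟨i, rfl⟩ : ∃ i, l = i + 1 := ⟨l - 1, by omega⟩
      rw [← pow_apply_apply, h, map_zero, zero_lie]
  rcases hm with h | ⟨b, hb, h⟩
  · have hXA := hXA (by omega)
    -- Both [A, w] = τ and [YA, w] = Yτ hold, so the derivation rule for Y leaves nothing for [A,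
    -- Yw]. This contradicts [YA, X^(q-3) E] = Yv.
    have h0 : ⁅A, E⁆ = 0 := by
      have h1 := hS.derY A ((X ^ (q - 1)) y)
      rw [hS.lie_w T.hq (i := 0) (by omega) (by simp) hXA (by intro l hl; omega),
        hS.lie_w T.hq (i := q - 1) (u := Y A) (A := τ) (by omega) (by rw [← hAτ]; congr 2; omega)
          T.X_τ (fun l hl => hAY l (by omega)), Nat.sub_zero, Nat.sub_self,
        show q - 1 = m by omega, hAτ, pow_zero, Module.End.one_apply,
        show m = q - 1 by omega] at h1
      simpa using h1
    have h2 := hcomm (q - 3) (by omega)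
    have h3 := hform 0
    rw [show m - 2 + 0 = q - 3 by omega] at h3
    rw [hpowA hXA, h0, map_zero, map_zero, h3, show m - 2 = q - 3 by omega, Nat.choose_self,
      Nat.choose_eq_zero_of_lt (by omega : q - 3 < m - 1),
      Nat.choose_eq_zero_of_lt (by omega : q - 3 < m)] at h2
    simp at h2
    exact T.Yv_ne h2.symm
  · have hb2 := hhalf b hb
    rcases Nat.lt_or_ge b 1 with hb1 | hb1
    · obtain rfl : b = 0 := by omega
      have hXA := hXA (by omega)
      have h2 := hcomm (q - 4) (by omega)
      have h3 := hform 0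
      rw [show m - 2 + 0 = q - 4 by omega] at h3
      rw [h3, show m - 2 = q - 4 by omega, Nat.choose_self,
        Nat.choose_eq_zero_of_lt (by omega : q - 4 < m - 1),
        Nat.choose_eq_zero_of_lt (by omega : q - 4 < m)] at h2
      -- Applying X and then Y gives ρXYv on one side and (1 + ρ)XYv on the other.
      have h4 : ⁅A, (X ^ (q - 4)) E⁆ = v :=
        T.eq_v (hS.lie_mem' hA (hS.pow_mem hEm _) (by omega)) (by simpa using h2)
      have h5 := hcomm (q - 3) (by omega)
      have h6 := hform 1
      rw [show m - 2 + 1 = q - 3 by omega] at h6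
      rw [hpowA hXA, show q - 3 = q - 4 + 1 by omega, ← apply_pow, ← hpowA hXA, h4, T.YXv,
        show q - 4 + 1 = q - 3 by omega, h6, show m - 2 = q - 4 by omega,
        show m - 1 = q - 3 by omega, Nat.choose_self,
        Nat.choose_eq_zero_of_lt (by omega : q - 3 < m),
        show (q - 3).choose (q - 4) = q - 3 by
          rw [← Nat.choose_symm (by omega), show q - 3 - (q - 4) = 1 by omega,
            Nat.choose_one_right],
        cast_of_odd (by rw [Nat.odd_iff]; omega), pow_one] at h5
      have h7 : X (Y v) = 0 := by
        have : (1 + ρ) • X (Y v) = ρ • X (Y v) := by rw [h5]; simp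
        rw [add_smul, one_smul] at this
        simpa using this
      exact T.z_ne hbig h7
    · have hb2' : 2 ≤ 2 ^ b := by
        calc 2 = 2 ^ 1 := by norm_num
          _ ≤ 2 ^ b := Nat.pow_le_pow_right (by norm_num) hb1
      -- [A, X^(q-3) E] has degree k - 1 + 2^b, which y centralizes. So the coefficient of [YA,
      -- X^(q-3) E] must vanish, whereas the parities of the three binomials make it 1.
      have h2 := hcomm (q - 3) (by omega)
      have h3 := hform (2 ^ b)
      rw [show m - 2 + 2 ^ b = q - 3 by omega] at h3
      rw [T.normal_k (i := k - 1 + 2 ^ b) (by omega) (by omega) _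
        (hS.lie_mem' hA (hS.pow_mem hEm _) (by omega)), h3] at h2
      have h4 := (smul_eq_zero.1 h2.symm).resolve_right (T.Xpow_ne hbig (by omega))
      rw [← Nat.choose_symm (show m - 2 ≤ q - 3 by omega),
        ← Nat.choose_symm (show m - 1 ≤ q - 3 by omega),
        ← Nat.choose_symm (show m ≤ q - 3 by omega), show q - 3 - (m - 2) = 2 ^ b by omega,
        show q - 3 - (m - 1) = 2 ^ b - 1 by omega, show q - 3 - m = 2 ^ b - 2 by omega] at h4
      rcases Nat.lt_or_ge b 2 with hb3 | hb3
      · obtain rfl : b = 1 := by omega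
        have c2 := choose_sub_three_modEq (e := e) (b := 2) (s := 2) (m := 0)
          (by have := T.he; omega) le_rfl (by norm_num) (by norm_num)
        rw [← T.hq, show 2 ^ 2 * 0 + 2 = 2 ^ 1 by norm_num] at c2
        rw [cast_of_even (even_of_modEq c2 (by decide)), show 2 ^ 1 - 1 = 1 by norm_num,
          show 2 ^ 1 - 2 = 0 by norm_num, Nat.choose_one_right, Nat.choose_zero_right,
          cast_of_odd (by rw [Nat.odd_iff]; omega)] at h4
        have : (1 : F) = 0 := by
          rw [← h4]
          have := CharTwo.add_self_eq_zero ρ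
          push_cast
          linear_combination -this
        exact one_ne_zero this
      · have h8 : 4 ≤ 2 ^ b := by
          calc 4 = 2 ^ 2 := by norm_num
            _ ≤ 2 ^ b := Nat.pow_le_pow_right (by norm_num) hb3
        have c0 := choose_sub_three_modEq (s := 0) (m := 1) hb hb3 (by omega) (by norm_num)
        have c1 := choose_sub_three_modEq (s := 2 ^ b - 1) (m := 0) hb hb3 (by omega)
          (by norm_num)
        have c2 := choose_sub_three_modEq (s := 2 ^ b - 2) (m := 0) hb hb3 (by omega)
          (by norm_num)
        rw [← T.hq, mul_one, add_zero] at c0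
        rw [← T.hq, mul_zero, zero_add] at c1 c2
        rw [cast_of_odd (odd_of_modEq c0 (by simp)),
          cast_of_even (even_of_modEq c1 (by
            rw [Nat.choose_eq_zero_of_lt (by omega)]; simp)),
          cast_of_even (even_of_modEq c2 (by
            rw [Nat.choose_eq_zero_of_lt (by omega)]; simp))] at h4
        simp at h4

end Tail

end SecondGapTwo
end ThinLie

namespace ThinLie

/-! ### Opposite elements when the last difference is q - 1 -/

section Chains

variable {F L : Type*} [Field F] [CharP F 2] [LieRing L] [LieAlgebra F L]
variable {ℒ : ℕ → Submodule F L} {k q : ℕ} {x y : L} {X Y : Module.End F L}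
variable {e t : ℕ} {τ v : L} {ρ : F}

theorem IsDer.lie_pow_of_apply_eq_zero {X : Module.End F L} (h : IsDer X) {u : L} (hu : X u = 0)
    (n : ℕ) (a : L) : ⁅u, (X ^ n) a⁆ = (X ^ n) ⁅u, a⁆ := by
  rw [h.lie_pow_one (m := 0)]
  · simp
  · intro l hl; omega
  · intro l hl _
    obtain ⟨i, rfl⟩ : ∃ i, l = i + 1 := ⟨l - 1, by omega⟩
    rw [← pow_apply_apply, hu, map_zero, zero_lie]

/-- An element `U` centralized by `x` and opposite to `A`, whose degrees add up to `k - 1`. -/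
structure OppositeLow (ℒ : ℕ → Submodule F L) (k q : ℕ) (X Y : Module.End F L) (v : L) (p : ℕ)
    (A U : L) : Prop where
  mem : U ∈ ℒ (k - p - 1)
  X_eq : X U = 0
  Y_ne : Y U ≠ 0
  lie : ⁅U, Y A⁆ = Y v
  run : ∀ l, l + 1 < q → Y ((X ^ l) (Y U)) = 0

/-- An element `U` centralized by `x` and opposite to `A`, whose degrees add up to `k`. -/
structure OppositeHigh (ℒ : ℕ → Submodule F L) (k : ℕ) (X Y : Module.End F L) (v : L) (p : ℕ)
    (A U : L) (c : F) : Prop where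
  mem : U ∈ ℒ (k - p)
  X_eq : X U = 0
  Y_ne : Y U ≠ 0
  lie : ⁅U, Y A⁆ = c • X (Y v)
  pred : ∀ κ ∈ ℒ (k - p - 1), X κ = U → ⁅κ, Y A⁆ = Y v

namespace Tail

theorem two_pow_le (T : Tail ℒ k q e x y X Y 1 t τ v ρ) {b : ℕ} (hb : b < e) :
    2 ^ b ≤ q / 2 := by
  obtain ⟨d, rfl⟩ : ∃ d, e = d + 1 := ⟨e - 1, by omega⟩
  rw [T.hq, pow_succ, Nat.mul_div_cancel _ (by norm_num)]
  exact Nat.pow_le_pow_right (by norm_num) (by omega)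

theorem k_eq (T : Tail ℒ k q e x y X Y 1 t τ v ρ) : k = t + q := by
  have := T.t_eq; omega

theorem pow_Yτ (T : Tail ℒ k q e x y X Y 1 t τ v ρ) : (X ^ (q - 2)) (Y τ) = v := T.v_eq

theorem pow_succ_Yτ (T : Tail ℒ k q e x y X Y 1 t τ v ρ) : (X ^ (q - 1)) (Y τ) = X v := by
  have := T.q_ge
  rw [← T.pow_Yτ, apply_pow, show q - 2 + 1 = q - 1 by omega]

/-- If t = q, then τ is a multiple of w and Xv = X^(q-1) Yτ is a multiple of X^(q-1) Yw = 0. -/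
theorem lt_t (T : Tail ℒ k q e x y X Y 1 t τ v ρ) : q < t := by
  have := T.q_ge
  have := T.S.q_le
  refine lt_of_le_of_ne T.q_le ?_
  intro h
  have hτ := T.τ_mem
  rw [← h] at hτ
  obtain ⟨a, ha⟩ := T.S.line (by omega) (by omega) T.S.w_mem T.S.w_ne hτ
  refine T.S.X_last_ne T.v_mem T.v_ne ?_
  rw [← T.pow_succ_Yτ, ha, map_smul, map_smul, T.pow_Yw_eq_zero, smul_zero]

theorem smul_τ (T : Tail ℒ k q e x y X Y 1 t τ v ρ) {u : L} (hu : u ∈ ℒ t) :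
    ∃ a : F, u = a • τ := by
  have := T.q_ge
  exact T.S.line (by have := T.q_le; omega) (by have := T.t_lt; omega) T.τ_mem
    (fun h => T.Yτ_ne (by rw [h, map_zero])) hu

theorem X_t (T : Tail ℒ k q e x y X Y 1 t τ v ρ) {u : L} (hu : u ∈ ℒ t) : X u = 0 := by
  obtain ⟨a, rfl⟩ := T.smul_τ hu
  rw [map_smul, T.X_τ, smul_zero]

/-- As Yκ = 0, the bracket is Y[κ, A], and y centralizes the degrees strictly between t and k - 1.
This removes the early terms of the expansions below. -/
theorem lie_Y_eq_zero (T : Tail ℒ k q e x y X Y 1 t τ v ρ) {A κ : L} {i j r : ℕ} (hA : A ∈ ℒ i)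
    (hκ : κ ∈ ℒ j) (hY : Y κ = 0) (hr : i + j = r) (h1 : t < r) (h2 : r + 1 < k) :
    ⁅κ, Y A⁆ = 0 := by
  have h := T.S.derY κ A
  rw [T.hbt r h1 h2 _ (T.S.lie_mem' hκ hA (by omega)), hY, zero_lie, zero_add] at h
  exact h.symm

section High

variable {p : ℕ} {A U : L} {c : F}

/-- Only two terms survive: the predecessor of U contributes Yv and U itself contributes cXYv. Later
terms contain XU = 0. -/
theorem lie_high (T : Tail ℒ k q e x y X Y 1 t τ v ρ) (hpt : p < t) (hA : A ∈ ℒ p)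
    (H : OppositeHigh ℒ k X Y v p A U c) {κ : L} {i a : ℕ} (hi : 1 ≤ i)
    (hiq : i + 1 ≤ q) (hip : i ≤ k - p) (hκm : κ ∈ ℒ (k - p - i)) (hκ : (X ^ i) κ = U)
    (h : ∀ l, l < i → Y ((X ^ l) κ) = 0) :
    ⁅κ, (X ^ (i - 1 + a)) (Y A)⁆ =
      (((i - 1 + a).choose (i - 1) : ℕ) + c * ((i - 1 + a).choose i : ℕ) : F) •
        (X ^ a) (Y v) := by
  have hke := T.k_eq
  obtain ⟨m, rfl⟩ : ∃ m, i = m + 1 := ⟨i - 1, by omega⟩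
  rw [Nat.add_sub_cancel, T.S.derX.lie_pow_two (m := m)]
  · have e0 : ⁅(X ^ m) κ, Y A⁆ = Y v :=
      H.pred _ (T.S.pow_mem' m hκm (by omega)) (by rw [apply_pow, hκ])
    rw [e0, hκ, H.lie, Nat.add_sub_cancel_left, map_smul, pow_apply_apply]
    rcases Nat.lt_or_ge a 1 with ha | ha
    · obtain rfl : a = 0 := by omega
      simp
    · rw [show m + a - (m + 1) + 1 = a by omega]
      module
  · intro l hl _
    exact T.lie_Y_eq_zero (r := k - (m + 1) + l) hA (T.S.pow_mem hκm l) (h l (by omega)) (by omega)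
      (by omega) (by omega)
  · intro l hl _
    obtain ⟨j, rfl⟩ : ∃ j, l = j + 1 + (m + 1) := ⟨l - 2 - m, by omega⟩
    rw [← pow_apply_pow, hκ, ← pow_apply_apply, H.X_eq, map_zero, zero_lie]

theorem next_high (T : Tail ℒ k q e x y X Y 1 t τ v ρ) (hbig : ℒ (k + q / 2 + 1) ≠ ⊥)
    (hp : q ≤ p) (hpt : p < t) (hA : A ∈ ℒ p) (H : OppositeHigh ℒ k X Y v p A U c) {n : ℕ}
    (hn : n + 1 = q ∨ ∃ b, b < e ∧ n + 1 + 2 ^ b = q)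
    (hc : ∃ d : F, (X ^ (n + 1)) (Y A) = d • Y ((X ^ n) (Y A))) :
    n + 1 = q ∨ n + 2 = q ∧ c = 1 := by
  have hq8 := T.q_ge
  have hqd := T.q_dvd
  have hke := T.k_eq
  have hS := T.S
  rcases hn with h | ⟨b, hb, h⟩
  · exact Or.inl h
  obtain ⟨d, hd⟩ := hc
  have hUn : ¬ Normal ℒ Y (k - p) := fun h => H.Y_ne (h _ H.mem)
  have hb2 := T.two_pow_le hb
  -- The coefficient of [κ, X^(n+1) YA] vanishes, since X^(n+1) YA is a multiple of Y X^n YA and Y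
  -- kills both κ and [κ, X^n YA].
  have key : ∀ i, 1 ≤ i → i < q / 2 → i ≤ n + 1 → n + 4 ≤ q + i → n + 2 - i ≤ q / 2 + 1 →
      (((n + 1).choose (i - 1) : ℕ) + c * ((n + 1).choose i : ℕ) : F) = 0 := by
    intro i h1 h2 h3 h4 h5
    obtain ⟨κ, hκm, hκ, hκY⟩ := hS.exists_run T.he T.hq (by omega) (by omega) hUn H.mem h2
    have a1 := T.lie_high (a := n + 2 - i) hpt hA H h1 (by omega) (by omega) hκm hκ hκY
    have a2 := T.lie_high (a := n + 1 - i) hpt hA H h1 (by omega) (by omega) hκm hκ hκY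
    rw [show i - 1 + (n + 2 - i) = n + 1 by omega] at a1
    rw [show i - 1 + (n + 1 - i) = n by omega] at a2
    have hκ0 : Y κ = 0 := by simpa using hκY 0 (by omega)
    have a3 := hS.derY κ ((X ^ n) (Y A))
    rw [a2, map_smul, T.tail _ (by omega), smul_zero, hκ0, zero_lie, zero_add] at a3
    rw [hd, lie_smul, ← a3, smul_zero] at a1
    exact (smul_eq_zero.1 a1.symm).resolve_right (T.Xpow_ne hbig h5)
  have hqe := T.hq
  rcases Nat.lt_or_ge b 1 with h1 | h1
  · obtain rfl : b = 0 := by omega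
    right
    refine ⟨by omega, ?_⟩
    -- All binomials C(q - 1, i) are odd, so the relation reads 1 + c = 0.
    have := key (q / 2 - 1) (by omega) (by omega) (by omega) (by omega) (by omega)
    rw [show n + 1 = 2 ^ e - 1 by rw [← T.hq]; omega,
      cast_of_odd (odd_choose_two_pow_sub_one e _ (by rw [← T.hq]; omega)),
      cast_of_odd (odd_choose_two_pow_sub_one e _ (by rw [← T.hq]; omega)), mul_one] at this
    exact ((CharTwo.add_eq_zero).1 this).symm
  · exfalso
    have h2 : 2 ≤ 2 ^ b := by
      calc 2 = 2 ^ 1 := by norm_num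
        _ ≤ 2 ^ b := Nat.pow_le_pow_right (by norm_num) h1
    have c0 := choose_sub_two_pow_modEq (s := 0) (r := 0) hb (by omega) (by omega)
    have c1 := choose_sub_two_pow_modEq (s := 1) (r := 0) hb (by omega) (by omega)
    -- Now i - 1 = q/2 - 2^b gives an odd binomial in the row q - 2^b and i gives an even one, so 1
    -- = 0.
    have := key (q / 2 - 2 ^ b + 1) (by omega) (by omega) (by omega) (by omega) (by omega)
    rw [show n + 1 = 2 ^ e - 2 ^ b + 0 by omega,
      show q / 2 - 2 ^ b + 1 - 1 = 2 ^ e / 2 - 2 ^ b + 0 by omega,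
      show q / 2 - 2 ^ b + 1 = 2 ^ e / 2 - 2 ^ b + 1 by omega,
      cast_of_odd (odd_of_modEq c0 (by simp)), cast_of_even (even_of_modEq c1 (by simp))] at this
    simp at this

variable {B : L} {m n : ℕ}

theorem lie_prev_high (T : Tail ℒ k q e x y X Y 1 t τ v ρ) (hpt : p < t) (hA : A ∈ ℒ p)
    (H : OppositeHigh ℒ k X Y v p A U c) (hm : 1 ≤ m) (hmq : m + 1 ≤ q) (hmp : m + 1 ≤ k - p)
    (hB : B ∈ ℒ (k - p - 1 - m)) (hBU : (X ^ m) (Y B) = U)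
    (hBY : ∀ l, l < m → Y ((X ^ l) (Y B)) = 0) (hAY : ∀ l, l < n → Y ((X ^ l) (Y A)) = 0)
    (hmn : m ≤ n) : ⁅B, (X ^ (m - 1)) (Y A)⁆ = v := by
  have hke := T.k_eq
  refine T.eq_v (T.S.lie_mem' hB (T.S.pow_mem (T.S.Y_mem hA) _) (by omega)) ?_
  have h := T.lie_high (a := 0) hpt hA H hm hmq (by omega)
    (T.S.Y_mem' hB (by omega)) hBU hBY
  rw [T.S.derY, hAY _ (by omega), lie_zero, add_zero]
  simpa [Nat.choose_eq_zero_of_lt (show m - 1 < m by omega)] using h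

/-- YX[B, X^(m-1) YA] is computed twice: as YXv = ρXYv, and by the Leibniz rule as [YB, X^m YA],
with coefficient m + c. The contribution of XB lies in the image of Y and is killed by the second Y.
-/
theorem rho_eq_high (T : Tail ℒ k q e x y X Y 1 t τ v ρ) (hbig : ℒ (k + q / 2 + 1) ≠ ⊥)
    (hpt : p < t) (hA : A ∈ ℒ p)
    (H : OppositeHigh ℒ k X Y v p A U c) (hm : 1 ≤ m) (hmq : m + 1 ≤ q) (hmp : m + 1 ≤ k - p)
    (hB : B ∈ ℒ (k - p - 1 - m)) (hBU : (X ^ m) (Y B) = U)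
    (hBY : ∀ l, l < m → Y ((X ^ l) (Y B)) = 0) (hXB : ∃ d : F, X B = d • Y B)
    (hAY : ∀ l, l < n → Y ((X ^ l) (Y A)) = 0)
    (hmn : m < n) : ρ = (m : F) + c := by
  have hke := T.k_eq
  have h0 := T.lie_prev_high hpt hA H hm hmq hmp hB hBU hBY hAY hmn.le
  have h1 := T.lie_high (a := 1) hpt hA H hm hmq (by omega)
    (T.S.Y_mem' hB (by omega)) hBU hBY
  have h2 := T.lie_high (a := 0) hpt hA H hm hmq (by omega)
    (T.S.Y_mem' hB (by omega)) hBU hBY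
  obtain ⟨d, hd⟩ := hXB
  rw [show m - 1 + 1 = m by omega, Nat.choose_self, ← Nat.choose_symm (show m - 1 ≤ m by omega),
    show m - (m - 1) = 1 by omega, Nat.choose_one_right] at h1
  have h3 := T.S.derX B ((X ^ (m - 1)) (Y A))
  rw [Nat.add_zero] at h2
  rw [h0, hd, smul_lie, h2, apply_pow, show m - 1 + 1 = m by omega] at h3
  have h4 := T.S.derY B ((X ^ m) (Y A))
  rw [hAY _ hmn, lie_zero, add_zero, h1] at h4
  have h5 := congrArg Y h3
  rw [map_add, h4, T.YXv, pow_zero, Module.End.one_apply, map_smul, map_smul, T.Y_sq, smul_zero,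
    smul_zero, zero_add] at h5
  have h6 : (ρ - ((m : F) + c)) • X (Y v) = 0 := by
    rw [sub_smul, h5]; simp
  exact sub_eq_zero.1 ((smul_eq_zero.1 h6).resolve_right (T.z_ne hbig))

end High

section Low

variable {p : ℕ} {A U : L}

theorem lie_low (T : Tail ℒ k q e x y X Y 1 t τ v ρ) (hpt : p + 1 < t) (hA : A ∈ ℒ p)
    (H : OppositeLow ℒ k q X Y v p A U) {κ : L} {i a : ℕ}
    (hiq : i + 2 ≤ q) (hκm : κ ∈ ℒ (k - p - 1 - i)) (hκ : (X ^ i) κ = U)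
    (h : ∀ l, l < i → Y ((X ^ l) κ) = 0) :
    ⁅κ, (X ^ (i + a)) (Y A)⁆ = ((i + a).choose i : F) • (X ^ a) (Y v) := by
  have hke := T.k_eq
  rw [T.S.derX.lie_pow_one (m := i)]
  · rw [hκ, H.lie, Nat.add_sub_cancel_left]
  · intro l hl _
    exact T.lie_Y_eq_zero (r := k - 1 - i + l) hA (T.S.pow_mem hκm l) (h l (by omega)) (by omega)
      (by omega) (by omega)
  · intro l hl _
    obtain ⟨j, rfl⟩ : ∃ j, l = j + 1 + i := ⟨l - 1 - i, by omega⟩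
    rw [← pow_apply_pow, hκ, ← pow_apply_apply, H.X_eq, map_zero, zero_lie]

theorem next_low (T : Tail ℒ k q e x y X Y 1 t τ v ρ) (hbig : ℒ (k + q / 2 + 1) ≠ ⊥)
    (hp : q ≤ p) (hpt : p + 1 < t) (hA : A ∈ ℒ p) (hXA : X A = 0)
    (H : OppositeLow ℒ k q X Y v p A U) {n : ℕ}
    (hn : n + 1 = q ∨ ∃ b, b < e ∧ n + 1 + 2 ^ b = q)
    (hc : ∃ d : F, (X ^ (n + 1)) (Y A) = d • Y ((X ^ n) (Y A))) : n + 1 = q := by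
  have hq8 := T.q_ge
  have hqd := T.q_dvd
  have hke := T.k_eq
  have hS := T.S
  rcases hn with h | ⟨b, hb, h⟩
  · exact h
  exfalso
  obtain ⟨d, hd⟩ := hc
  have hUn : ¬ Normal ℒ Y (k - p - 1) := fun h => H.Y_ne (h _ H.mem)
  have hb2 := T.two_pow_le hb
  have hqe := T.hq
  have hpos : 0 < 2 ^ b := by positivity
  have c0 := choose_sub_two_pow_modEq (s := 0) (r := 0) hb (by omega) (by omega)
  -- With this i the binomial C(n + 1, i) in the row n + 1 = q - 2^b is odd, and the exponent n + 1
  -- - i = q/2 stays within the range where powers of X on Yv are nonzero.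
  obtain ⟨i, hi⟩ : ∃ i, i = q / 2 - 2 ^ b := ⟨_, rfl⟩
  rw [show 2 ^ e - 2 ^ b + 0 = n + 1 by omega, show 2 ^ e / 2 - 2 ^ b + 0 = i by omega] at c0
  obtain ⟨κ, hκm, hκ, hκY⟩ := hS.exists_run (i := i) T.he T.hq (by omega) (by omega) hUn H.mem
    (by omega)
  have a1 := T.lie_low (a := n + 1 - i) hpt hA H (by omega) hκm hκ hκY
  have a2 := T.lie_low (a := n - i) hpt hA H (by omega) hκm hκ hκY
  rw [show i + (n + 1 - i) = n + 1 by omega, cast_of_odd (odd_of_modEq c0 (by simp)),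
    one_smul] at a1
  rw [show i + (n - i) = n by omega] at a2
  have a3 := hS.derY κ ((X ^ n) (Y A))
  rw [a2, map_smul, T.tail _ (by omega), smul_zero] at a3
  have hY : ⁅Y κ, (X ^ n) (Y A)⁆ = 0 := by
    -- If 2^b = q/2, then κ = U and Yκ is not zero. Since XA = 0, each [X^l YU, A] is a multiple of
    -- X^l Yv, which Y kills, so [X^l YU, YA] = 0 for all l ≤ n and the bracket still vanishes.
    rcases Nat.eq_zero_or_pos i with h0 | h0
    · have hκU : κ = U := by rw [← hκ, h0]; rfl
      rw [hκU]
      obtain ⟨a, ha⟩ : ∃ a : F, ⁅U, A⁆ = a • v :=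
        hS.line (by omega) (by omega) T.v_mem T.v_ne (hS.lie_mem' H.mem hA (by omega))
      have h1 := hS.derY U A
      rw [ha, map_smul, H.lie] at h1
      have h2 : ⁅Y U, A⁆ = (a - 1) • Y v := by
        rw [sub_smul, one_smul, h1, add_sub_cancel_right]
      have h3 : ∀ l, ⁅(X ^ l) (Y U), A⁆ = (a - 1) • (X ^ l) (Y v) := by
        intro l
        induction l with
        | zero => simpa using h2
        | succ l ih =>
          have := hS.derX ((X ^ l) (Y U)) A
          rw [hXA, lie_zero, add_zero, ih, map_smul, apply_pow, apply_pow] at this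
          exact this.symm
      apply hS.derX.lie_pow_zero
      intro l hl
      have h4 := hS.derY ((X ^ l) (Y U)) A
      rw [h3, map_smul, T.tail _ (by omega), smul_zero, H.run l (by omega), zero_lie,
        zero_add] at h4
      exact h4.symm
    · have hκ0 : Y κ = 0 := by simpa using hκY 0 h0
      rw [hκ0, zero_lie]
  rw [hY, zero_add] at a3
  rw [hd, lie_smul, ← a3, smul_zero] at a1
  exact T.Xpow_ne hbig (by omega) a1.symm

variable {B : L} {m n : ℕ}

theorem lie_prev_low (T : Tail ℒ k q e x y X Y 1 t τ v ρ) (hpt : p + 1 < t) (hA : A ∈ ℒ p)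
    (H : OppositeLow ℒ k q X Y v p A U) (hmq : m + 2 ≤ q) (hmp : m + 2 ≤ k - p)
    (hB : B ∈ ℒ (k - p - 1 - 1 - m)) (hBU : (X ^ m) (Y B) = U)
    (hBY : ∀ l, l < m → Y ((X ^ l) (Y B)) = 0) (hAY : ∀ l, l < n → Y ((X ^ l) (Y A)) = 0)
    (hmn : m < n) : ⁅B, (X ^ m) (Y A)⁆ = v := by
  have hke := T.k_eq
  refine T.eq_v (T.S.lie_mem' hB (T.S.pow_mem (T.S.Y_mem hA) _) (by omega)) ?_
  have h := T.lie_low (a := 0) hpt hA H hmq (T.S.Y_mem' hB (by omega)) hBU hBY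
  rw [T.S.derY, hAY _ (by omega), lie_zero, add_zero]
  simpa using h

/-- The same double computation, now from [B, X^m YA] = v: the coefficient of [YB, X^(m+1) YA] is m
+ 1. -/
theorem rho_eq_low (T : Tail ℒ k q e x y X Y 1 t τ v ρ) (hbig : ℒ (k + q / 2 + 1) ≠ ⊥)
    (hpt : p + 1 < t) (hA : A ∈ ℒ p)
    (H : OppositeLow ℒ k q X Y v p A U) (hmq : m + 2 ≤ q) (hmp : m + 2 ≤ k - p)
    (hB : B ∈ ℒ (k - p - 1 - 1 - m)) (hBU : (X ^ m) (Y B) = U)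
    (hBY : ∀ l, l < m → Y ((X ^ l) (Y B)) = 0) (hXB : ∃ d : F, X B = d • Y B)
    (hAY : ∀ l, l < n → Y ((X ^ l) (Y A)) = 0)
    (hmn : m + 1 < n) : ρ = ((m + 1 : ℕ) : F) := by
  have hke := T.k_eq
  have h0 := T.lie_prev_low hpt hA H hmq hmp hB hBU hBY hAY (by omega)
  have h1 := T.lie_low (a := 1) hpt hA H hmq (T.S.Y_mem' hB (by omega)) hBU hBY
  have h2 := T.lie_low (a := 0) hpt hA H hmq (T.S.Y_mem' hB (by omega)) hBU hBY
  obtain ⟨d, hd⟩ := hXB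
  rw [Nat.add_zero, Nat.choose_self] at h2
  rw [← Nat.choose_symm (show m ≤ m + 1 by omega), Nat.add_sub_cancel_left,
    Nat.choose_one_right] at h1
  have h3 := T.S.derX B ((X ^ m) (Y A))
  rw [h0, hd, smul_lie, h2, apply_pow] at h3
  have h4 := T.S.derY B ((X ^ (m + 1)) (Y A))
  rw [hAY _ hmn, lie_zero, add_zero, h1] at h4
  have h5 := congrArg Y h3
  rw [map_add, h4, T.YXv, pow_zero, Module.End.one_apply, map_smul, map_smul, T.Y_sq, smul_zero,
    smul_zero, zero_add, pow_one] at h5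
  have h6 : (ρ - ((m + 1 : ℕ) : F)) • X (Y v) = 0 := by
    rw [sub_smul, h5]; simp
  exact sub_eq_zero.1 ((smul_eq_zero.1 h6).resolve_right (T.z_ne hbig))

end Low

end Tail

end Chains
end ThinLie

namespace ThinLie

/-! ### The induction step: all later differences equal q -/

section ChainSteps

variable {F L : Type*} [Field F] [CharP F 2] [LieRing L] [LieAlgebra F L]
variable {ℒ : ℕ → Submodule F L} {k q : ℕ} {x y : L} {X Y : Module.End F L}
variable {e t : ℕ} {τ v : L} {ρ : F}

/-- An element `A` of degree at most `t`, centralized by `x` and not by `y`, which has an opposite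
element unless its degree is `t`. -/
structure Link (ℒ : ℕ → Submodule F L) (k q : ℕ) (X Y : Module.End F L) (t : ℕ) (v : L) (ρ : F)
    (p : ℕ) (A : L) : Prop where
  mem : A ∈ ℒ p
  X_eq : X A = 0
  Y_ne : Y A ≠ 0
  le : p ≤ t
  opposite : p < t → (∃ U, OppositeLow ℒ k q X Y v p A U) ∨
    ∃ U c, (c = 0 ∨ c = 1 + ρ) ∧ OppositeHigh ℒ k X Y v p A U c

namespace Tail

/-- [κ, YA] has degree t and is killed by X. Only the term l = 1 remains, with the odd coefficient q
- 1. -/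
theorem lie_pred (T : Tail ℒ k q e x y X Y 1 t τ v ρ) {p j : ℕ} {A B κ : L} (hA : A ∈ ℒ p)
    (hκ : κ ∈ ℒ j) (hj : j + p + 1 = t) (hκB : X κ = B) (hXB : X B = 0)
    (h : ⁅B, (X ^ (q - 2)) (Y A)⁆ = v) : ⁅κ, (X ^ (q - 1)) (Y A)⁆ = v := by
  have hq8 := T.q_ge
  rw [T.S.derX.lie_pow_two (m := 0)]
  · have h1 : X ⁅κ, Y A⁆ = 0 := T.X_t (T.S.lie_mem' hκ (T.S.Y_mem hA) (by omega))
    rw [pow_zero, Module.End.one_apply, show q - 1 - 0 = q - 2 + 1 by omega, ← pow_apply_apply, h1,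
      map_zero, smul_zero, zero_add, zero_add, pow_one, hκB, Nat.choose_one_right,
      show q - 1 - 1 = q - 2 by omega, ← T.S.derX.lie_pow_of_apply_eq_zero hXB, h,
      cast_of_odd (by have := T.q_dvd; rw [Nat.odd_iff]; omega), one_smul]
  · intro l hl; omega
  · intro l hl _
    obtain ⟨i, rfl⟩ : ∃ i, l = i + 1 + 1 := ⟨l - 2, by omega⟩
    rw [← pow_apply_apply, hκB, ← pow_apply_apply, hXB, map_zero, zero_lie]

theorem pow_Y_ne (T : Tail ℒ k q e x y X Y 1 t τ v ρ) : X (Y τ) ≠ 0 := fun h => by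
  have hq8 := T.q_ge
  apply T.v_ne
  rw [← T.pow_Yτ, show q - 2 = q - 3 + 1 by omega, ← pow_apply_apply, h, map_zero]

/-- A ascends by q. If U descends by q, the sum of the degrees remains k - 1; if it descends by q -
1, the sum becomes k. A difference q - 2^b with b ≥ 1 is even and would give ρ = m + 1 = 0. -/
theorem opposite_of_low (T : Tail ℒ k q e x y X Y 1 t τ v ρ) (hbig : ℒ (k + q / 2 + 1) ≠ ⊥)
    {p : ℕ} {A U : L} (hp : q ≤ p) (hpt : p + q < t) (hA : A ∈ ℒ p)
    (hAY : ∀ l, l < q - 1 → Y ((X ^ l) (Y A)) = 0) (H : OppositeLow ℒ k q X Y v p A U) :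
    (∃ U, OppositeLow ℒ k q X Y v (p + q) ((X ^ (q - 1)) (Y A)) U) ∨
      ∃ U c, (c = 0 ∨ c = 1 + ρ) ∧ OppositeHigh ℒ k X Y v (p + q) ((X ^ (q - 1)) (Y A)) U c := by
  have hq8 := T.q_ge
  have hqd := T.q_dvd
  have hke := T.k_eq
  have hS := T.S
  have hU0 : U ≠ 0 := fun h => H.Y_ne (by rw [h, map_zero])
  obtain ⟨m, B, hm, hmle, hB, hBU, hBY, hXB', hXB, hBn⟩ :=
    hS.exists_prev T.he T.hq (p := k - p - 1) (by omega) (by omega) H.mem H.Y_ne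
  have hYB : Y B ≠ 0 := fun h => hU0 (by rw [← hBU, h, map_zero])
  rcases hm with hm | ⟨b, hb, hm⟩
  · left
    have hXB := hXB (by omega)
    have hκ : ∀ l, 1 ≤ l → l < m → ⁅(X ^ l) (Y B), Y A⁆ = 0 := fun l h1 h2 =>
      T.lie_Y_eq_zero (r := t + l) hA (hS.pow_mem (hS.Y_mem hB) l) (hBY l h2) (by omega)
        (by omega) (by omega)
    -- [B, YA] falls in degree t, just outside the range of `lie_Y_eq_zero`, so it is a multiple ητ.
    -- Comparing two expressions for X[YB, YA] gives ηXYτ = 0, hence η = 0.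
    obtain ⟨η, hη⟩ := T.smul_τ (hS.lie_mem' hB (hS.Y_mem hA) (n := t) (by omega))
    have h1 : ⁅Y B, Y A⁆ = η • Y τ := by
      rw [← map_smul, ← hη, hS.derY, T.Y_sq, lie_zero, add_zero]
    have h2 : η = 0 := by
      have h3 : ⁅B, X (Y A)⁆ = 0 := by
        have := hS.derX B (Y A)
        rw [hη, map_smul, T.X_τ, smul_zero, hXB, zero_lie, zero_add] at this
        exact this.symm
      have h4 := hS.derY B (X (Y A))
      have h5 := hAY 1 (by omega)
      have h6 := hκ 1 le_rfl (by omega)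
      have h7 := hS.derX (Y B) (Y A)
      rw [pow_one] at h5 h6
      rw [h3, map_zero, h5, lie_zero, add_zero] at h4
      rw [h1, map_smul, h6, ← h4, zero_add] at h7
      exact (smul_eq_zero.1 h7).resolve_right T.pow_Y_ne
    rw [h2, zero_smul] at h1 hη
    refine ⟨B, by convert hB using 2; omega, hXB, hYB, ?_, fun l hl => hBY l (by omega)⟩
    have h3 : ⁅Y B, (X ^ (q - 1)) (Y A)⁆ = Y v := by
      rw [hS.derX.lie_pow_one (m := m)]
      · rw [hBU, H.lie, show q - 1 = m by omega, Nat.choose_self, Nat.sub_self]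
        simp
      · intro l hl _
        rcases Nat.eq_zero_or_pos l with rfl | h
        · simpa using h1
        · exact hκ l h hl
      · intro l hl hl2; omega
    have h4 := hS.derY B ((X ^ (q - 1)) (Y A))
    rw [hS.derX.lie_pow_of_apply_eq_zero hXB, hη, map_zero, map_zero, h3] at h4
    exact (eq_of_add_eq_zero F h4.symm).symm
  · have hb2 := T.two_pow_le hb
    rcases Nat.eq_zero_or_pos b with rfl | hb1
    · right
      have hXB := hXB (by omega)
      have h0 := T.lie_prev_low (n := q - 1) (by omega) hA H (by omega) (by omega) hB hBU hBY hAY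
        (by omega)
      rw [show m = q - 2 by omega] at h0
      refine ⟨B, 1 + ρ, Or.inr rfl, by convert hB using 2; omega, hXB, hYB, ?_, ?_⟩
      · have h1 := T.lie_low (a := 1) (by omega) hA H (by omega)
          (hS.Y_mem' hB (by omega)) hBU hBY
        rw [← Nat.choose_symm (show m ≤ m + 1 by omega), Nat.add_sub_cancel_left,
          Nat.choose_one_right, cast_of_odd (by rw [Nat.odd_iff]; omega), one_smul, pow_one,
          show m + 1 = q - 1 by omega] at h1
        have h2 : ⁅B, (X ^ (q - 1)) (Y A)⁆ = X v := by
          rw [hS.derX.lie_pow_of_apply_eq_zero hXB, show q - 1 = q - 2 + 1 by omega, ← apply_pow,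
            ← hS.derX.lie_pow_of_apply_eq_zero hXB, h0]
        have h3 := hS.derY B ((X ^ (q - 1)) (Y A))
        rw [h2, T.YXv, h1] at h3
        apply eq_of_add_eq_zero F
        rw [add_smul, one_smul, h3, add_left_comm, ← add_assoc, ← add_assoc, add_assoc _ _ ⁅B, _⁆,
          add_self_zero F]
      · intro κ hκ hκB
        have hκY : Y κ = 0 := hS.half_le_gap T.he T.hq _ (by omega) (by omega) hBn _
          (by omega) (by omega) _ hκ
        have h1 := T.lie_pred hA hκ (by omega) hκB hXB h0
        have h2 := hS.derY κ ((X ^ (q - 1)) (Y A))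
        rw [h1, hκY, zero_lie, zero_add] at h2
        exact h2.symm
    · exfalso
      have h2 : 2 ∣ 2 ^ b := by
        have : 2 ^ 1 ∣ 2 ^ b := pow_dvd_pow 2 hb1
        simpa using this
      have hpos : 0 < 2 ^ b := by positivity
      have := T.rho_eq_low (n := q - 1) hbig (by omega) hA H (by omega) (by omega) hB hBU hBY hXB'
        hAY (by omega)
      rw [cast_of_even (by rw [Nat.even_iff]; omega)] at this
      exact T.ρ_ne this

/-- A descent of U by q replaces c by 1 + c + ρ, which exchanges the two values 0 and 1 + ρ. A
descent by q - 1 would give ρ = c, impossible for both values. A descent by q - 2^b with b ≥ 1 would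
require C(q - 2, m - 1) + cC(q - 2, m) = 0, but the first binomial is odd and the second even. -/
theorem opposite_of_high (T : Tail ℒ k q e x y X Y 1 t τ v ρ) (hbig : ℒ (k + q / 2 + 1) ≠ ⊥)
    {p : ℕ} {A U : L} {c : F} (hp : q ≤ p) (hpt : p + q < t) (hA : A ∈ ℒ p)
    (hAY : ∀ l, l < q - 1 → Y ((X ^ l) (Y A)) = 0) (hc : c = 0 ∨ c = 1 + ρ)
    (H : OppositeHigh ℒ k X Y v p A U c) :
    ∃ U c, (c = 0 ∨ c = 1 + ρ) ∧ OppositeHigh ℒ k X Y v (p + q) ((X ^ (q - 1)) (Y A)) U c := by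
  have hq8 := T.q_ge
  have hqd := T.q_dvd
  have hke := T.k_eq
  have hS := T.S
  have hU0 : U ≠ 0 := fun h => H.Y_ne (by rw [h, map_zero])
  obtain ⟨m, B, hm, hmle, hB, hBU, hBY, hXB', hXB, hBn⟩ :=
    hS.exists_prev T.he T.hq (p := k - p) (by omega) (by omega) H.mem H.Y_ne
  have hYB : Y B ≠ 0 := fun h => hU0 (by rw [← hBU, h, map_zero])
  rcases hm with hm | ⟨b, hb, hm⟩
  · have hXB := hXB (by omega)
    have h0 := T.lie_prev_high (n := q - 1) (by omega) hA H (by omega) (by omega) (by omega) hB hBU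
      hBY hAY (by omega)
    rw [show m - 1 = q - 2 by omega] at h0
    refine ⟨B, 1 + c + ρ, ?_, by convert hB using 2; omega, hXB, hYB, ?_, ?_⟩
    · rcases hc with rfl | rfl
      · right; ring
      · left
        have h1 := CharTwo.add_self_eq_zero (1 + ρ)
        linear_combination h1
    · have h1 := T.lie_high (a := 1) (by omega) hA H (by omega) (by omega) (by omega)
          (hS.Y_mem' hB (by omega)) hBU hBY
      rw [show m - 1 + 1 = m by omega, ← Nat.choose_symm (show m - 1 ≤ m by omega),
        show m - (m - 1) = 1 by omega,
        Nat.choose_one_right, cast_of_odd (by rw [Nat.odd_iff]; omega), Nat.choose_self,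
        Nat.cast_one, mul_one, pow_one, show m = q - 1 by omega] at h1
      have h2 : ⁅B, (X ^ (q - 1)) (Y A)⁆ = X v := by
        rw [hS.derX.lie_pow_of_apply_eq_zero hXB, show q - 1 = q - 2 + 1 by omega, ← apply_pow,
          ← hS.derX.lie_pow_of_apply_eq_zero hXB, h0]
      have h3 := hS.derY B ((X ^ (q - 1)) (Y A))
      rw [h2, T.YXv, h1] at h3
      apply eq_of_add_eq_zero F
      rw [add_smul, h3, add_left_comm, ← add_assoc, ← add_assoc, add_assoc _ _ ⁅B, _⁆,
        add_self_zero F]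
    · intro κ hκ hκB
      have hκY : Y κ = 0 := hS.half_le_gap T.he T.hq _ (by omega) (by omega) hBn _
        (by omega) (by omega) _ hκ
      have h1 := T.lie_pred hA hκ (by omega) hκB hXB h0
      have h2 := hS.derY κ ((X ^ (q - 1)) (Y A))
      rw [h1, hκY, zero_lie, zero_add] at h2
      exact h2.symm
  · exfalso
    have hb2 := T.two_pow_le hb
    rcases Nat.eq_zero_or_pos b with rfl | hb1
    · have := T.rho_eq_high (n := q - 1) hbig (by omega) hA H (by omega) (by omega) (by omega) hB
        hBU hBY hXB' hAY (by omega)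
      rw [cast_of_even (by rw [Nat.even_iff]; omega), zero_add] at this
      rcases hc with rfl | rfl
      · exact T.ρ_ne this
      · exact one_ne_zero (α := F) (by simpa using this)
    · have hpos : 2 ≤ 2 ^ b := by
        calc 2 = 2 ^ 1 := by norm_num
          _ ≤ 2 ^ b := Nat.pow_le_pow_right (by norm_num) hb1
      have h2 : 2 ∣ 2 ^ b := by
        have : 2 ^ 1 ∣ 2 ^ b := pow_dvd_pow 2 hb1
        simpa using this
      have h1 := T.lie_high (a := 2 ^ b) (by omega) hA H (by omega) (by omega) (by omega)
          (hS.Y_mem' hB (by omega)) hBU hBY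
      have h3 := hS.derY B ((X ^ (m - 1 + 2 ^ b)) (Y A))
      rw [hAY _ (by omega), lie_zero, add_zero, h1,
        T.normal_k (i := k - 1 + 2 ^ b) (by omega) (by omega) _
          (hS.lie_mem' hB (hS.pow_mem (hS.Y_mem hA) _) (by omega))] at h3
      have h4 := (smul_eq_zero.1 h3.symm).resolve_right (T.Xpow_ne hbig (by omega))
      have he1 : 1 ≤ e := by have := T.he; omega
      have hqe := T.hq
      rw [show m - 1 + 2 ^ b = 2 ^ e - 2 by omega,
        cast_of_odd (odd_choose_sub_two he1 (by omega) (by rw [Nat.even_iff]; omega)),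
        cast_of_even (even_choose_sub_two he1 (by rw [Nat.odd_iff]; omega)), mul_zero,
        add_zero] at h4
      exact one_ne_zero h4

/-- A difference q - 1 requires c = 1, while c is 0 or 1 + ρ with ρ nonzero. So the difference is q,
and X kills the new element because X^q = 0. -/
theorem link_next (T : Tail ℒ k q e x y X Y 1 t τ v ρ) (hbig : ℒ (k + q / 2 + 1) ≠ ⊥)
    {p : ℕ} {A : L} (hp : q ≤ p) (hpt : p < t) (K : Link ℒ k q X Y t v ρ p A) :
    Link ℒ k q X Y t v ρ (p + q) ((X ^ (q - 1)) (Y A)) ∧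
      ∀ i, p < i → i < p + q → Normal ℒ Y i := by
  have hq8 := T.q_ge
  have hke := T.k_eq
  have hS := T.S
  have hopp := K.opposite hpt
  obtain ⟨n, hn, hnt, hne, hYne, hrun, hc, -, hnor⟩ :=
    hS.exists_next T.he T.hq (p := p) hp hpt T.t_lt T.not_normal_t K.mem K.Y_ne
  have hn2 : q / 2 ≤ n + 1 := by
    rcases hn with h | ⟨b, hb, h⟩
    · omega
    · have := T.two_pow_le hb; omega
  have hn' : n + 1 = q := by
    rcases hopp with ⟨U, H⟩ | ⟨U, c, hc', H⟩
    · exact T.next_low hbig hp (by omega) K.mem K.X_eq H hn hc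
    · rcases T.next_high hbig hp hpt K.mem H hn hc with h | ⟨-, h⟩
      · exact h
      · exfalso
        subst h
        rcases hc' with h | h
        · exact one_ne_zero h
        · exact T.ρ_ne (by simpa using h.symm)
  obtain rfl : n = q - 1 := by omega
  refine ⟨⟨hS.pow_mem' _ (hS.Y_mem K.mem) (by omega), ?_, hYne, by omega, fun h => ?_⟩,
    fun i h1 h2 => hnor i h1 (by omega)⟩
  · rw [apply_pow]; exact hS.X_pow_q T.hq (by omega) _
  · rcases hopp with ⟨U, H⟩ | ⟨U, c, hc', H⟩
    · exact T.opposite_of_low hbig hp h K.mem hrun H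
    · exact Or.inr (T.opposite_of_high hbig hp h K.mem hrun hc' H)

end Tail

end ChainSteps
end ThinLie

namespace ThinLie

/-! ### The start of the chain and the degree of the second diamond -/

section ChainStart

variable {F L : Type*} [Field F] [CharP F 2] [LieRing L] [LieAlgebra F L]
variable {ℒ : ℕ → Submodule F L} {k q : ℕ} {x y : L} {X Y : Module.End F L}
variable {e t : ℕ} {τ v : L} {ρ : F}

namespace Tail

/-- Expanding Y[τ, w] gives [τ, Yw] = ρXYv + (1 + ρ)XYv = XYv. The exceptional value c = 1 is what
makes the first difference q - 1 instead of q. -/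
theorem opposite_w (T : Tail ℒ k q e x y X Y 1 t τ v ρ) :
    OppositeHigh ℒ k X Y v q ((X ^ (q - 1)) y) τ (1 : F) := by
  have hq8 := T.q_ge
  have hke := T.k_eq
  have hS := T.S
  have hXXv : X (X v) = 0 := by
    rw [← T.pow_succ_Yτ, apply_pow]; exact hS.X_pow_q T.hq (by omega) _
  refine ⟨by convert T.τ_mem using 2; omega, T.X_τ, T.Yτ_ne, ?_, ?_⟩
  · have h1 := hS.derY τ ((X ^ (q - 1)) y)
    rw [hS.lie_w T.hq (i := 0) (by omega) (by simp) T.X_τ (by intro l hl; omega), Nat.sub_zero,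
      T.pow_succ_Yτ, T.YXv, T.lie_w_v (m := q - 2) (by omega) (Or.inr hXXv) T.pow_Yτ
        (fun l hl => T.Y_pow_Yτ (by omega)), show q - 1 - (q - 2) = 1 by omega, pow_one] at h1
    apply eq_of_add_eq_zero F
    rw [show ⁅τ, Y ((X ^ (q - 1)) y)⁆ = ρ • X (Y v) - (1 + ρ) • X (Y v) by rw [h1]; abel]
    module
  · intro κ hκ hκτ
    have hκY : Y κ = 0 := hS.half_le_gap T.he T.hq t T.q_le (by omega) T.not_normal_t (k - q - 1)
      (by have := T.q_le; omega) (by omega) _ hκ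
    have h1 := hS.derY κ ((X ^ (q - 1)) y)
    rw [hS.lie_w T.hq (i := 1) (by omega) (by simpa using hκτ) T.X_τ (by
      intro l hl
      obtain rfl : l = 0 := by omega
      simpa using hκY), show q - 1 - 1 = q - 2 by omega, T.pow_Yτ, hκY, zero_lie, zero_add] at h1
    exact h1.symm

/-- Here A ascends by q - 1 only, so a descent of U by q lowers the sum of the degrees from k to k -
1 and a descent by q - 1 preserves it. For the other differences m is odd and c = 1, which would
give ρ = m + 1 = 0. -/
theorem opposite_start (T : Tail ℒ k q e x y X Y 1 t τ v ρ) (hbig : ℒ (k + q / 2 + 1) ≠ ⊥)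
    (hpt : 2 * q - 1 < t)
    (hAY : ∀ l, l < q - 2 → Y ((X ^ l) (Y ((X ^ (q - 1)) y))) = 0) :
    (∃ U, OppositeLow ℒ k q X Y v (2 * q - 1) ((X ^ (q - 2)) (Y ((X ^ (q - 1)) y))) U) ∨
      ∃ U c, (c = 0 ∨ c = 1 + ρ) ∧
        OppositeHigh ℒ k X Y v (2 * q - 1) ((X ^ (q - 2)) (Y ((X ^ (q - 1)) y))) U c := by
  have hq8 := T.q_ge
  have hqd := T.q_dvd
  have hke := T.k_eq
  have hS := T.S
  have H := T.opposite_w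
  have hA := hS.w_mem
  obtain ⟨m, B, hm, hmle, hB, hBU, hBY, hXB', hXB, hBn⟩ :=
    hS.exists_prev T.he T.hq (p := k - q) (by omega) (by omega) H.mem H.Y_ne
  have hYB : Y B ≠ 0 := fun h => T.Yτ_ne (by rw [← hBU, h, map_zero, map_zero])
  rcases hm with hm | ⟨b, hb, hm⟩
  · left
    have hXB := hXB (by omega)
    refine ⟨B, by convert hB using 2; omega, hXB, hYB, ?_, fun l hl => hBY l (by omega)⟩
    have h1 : ⁅B, Y ((X ^ (q - 1)) y)⁆ = 0 := by
      have h1 := hS.derY B ((X ^ (q - 1)) y)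
      rw [hS.lie_w T.hq (i := 0) (by omega) (by simp) hXB (by intro l hl; omega),
        hS.lie_w T.hq (i := q - 1) (u := Y B) (A := τ) (by omega) (by rw [← hBU]; congr 2; omega)
          T.X_τ (fun l hl => hBY l (by omega)), Nat.sub_zero, Nat.sub_self,
        show q - 1 = m by omega, hBU, pow_zero, Module.End.one_apply,
        show m = q - 1 by omega] at h1
      simpa using h1
    have h2 := T.lie_high (a := 0) (by omega) hA H (by omega) (by omega) (by omega)
          (hS.Y_mem' hB (by omega)) hBU hBY
    rw [show m - 1 + 0 = q - 2 by omega, show m - 1 = q - 2 by omega, Nat.choose_self,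
      Nat.choose_eq_zero_of_lt (by omega : q - 2 < m)] at h2
    have h3 := hS.derY B ((X ^ (q - 2)) (Y ((X ^ (q - 1)) y)))
    rw [hS.derX.lie_pow_of_apply_eq_zero hXB, h1, map_zero, map_zero, h2] at h3
    simpa using (eq_of_add_eq_zero F h3.symm).symm
  · have hb2 := T.two_pow_le hb
    rcases Nat.eq_zero_or_pos b with rfl | hb1
    · right
      have hXB := hXB (by omega)
      have h0 := T.lie_prev_high (n := q - 2) (by omega) hA H (by omega) (by omega) (by omega) hB
        hBU hBY hAY (by omega)
      rw [show m - 1 = q - 3 by omega] at h0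
      refine ⟨B, 1 + ρ, Or.inr rfl, by convert hB using 2; omega, hXB, hYB, ?_, ?_⟩
      · have h1 := T.lie_high (a := 1) (by omega) hA H (by omega) (by omega) (by omega)
          (hS.Y_mem' hB (by omega)) hBU hBY
        rw [show m - 1 + 1 = m by omega, ← Nat.choose_symm (show m - 1 ≤ m by omega),
          show m - (m - 1) = 1 by omega, Nat.choose_one_right,
          cast_of_even (by rw [Nat.even_iff]; omega), Nat.choose_self, Nat.cast_one, mul_one,
          pow_one, zero_add, one_smul, show m = q - 2 by omega] at h1
        have h2 : ⁅B, (X ^ (q - 2)) (Y ((X ^ (q - 1)) y))⁆ = X v := by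
          rw [hS.derX.lie_pow_of_apply_eq_zero hXB, show q - 2 = q - 3 + 1 by omega, ← apply_pow,
            ← hS.derX.lie_pow_of_apply_eq_zero hXB, h0]
        have h3 := hS.derY B ((X ^ (q - 2)) (Y ((X ^ (q - 1)) y)))
        rw [h2, T.YXv, h1] at h3
        apply eq_of_add_eq_zero F
        rw [add_smul, one_smul, h3, add_left_comm, ← add_assoc, ← add_assoc, add_assoc _ _ ⁅B, _⁆,
          add_self_zero F]
      · intro κ hκ hκB
        have hκY : Y κ = 0 := hS.half_le_gap T.he T.hq _ (by omega) (by omega) hBn _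
          (by omega) (by omega) _ hκ
        have h1 : ⁅κ, Y ((X ^ (q - 1)) y)⁆ = Y τ := by
          have h1 := hS.derY κ ((X ^ (q - 1)) y)
          rw [hS.lie_w T.hq (i := 1) (by omega) (by simpa using hκB) hXB (by
            intro l hl
            obtain rfl : l = 0 := by omega
            simpa using hκY), show q - 1 - 1 = m by omega, hBU, hκY, zero_lie, zero_add] at h1
          rw [show q - 1 = m + 1 by omega]
          rw [show q - 1 = m + 1 by omega] at h1
          exact h1.symm
        have h2 : ⁅κ, (X ^ (q - 2)) (Y ((X ^ (q - 1)) y))⁆ = v := by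
          rw [hS.derX.lie_pow_two (m := 0)]
          · rw [pow_zero, Module.End.one_apply, h1, zero_add, Nat.choose_one_right,
              cast_of_even (n := q - 2) (by rw [Nat.even_iff]; omega), zero_smul, add_zero, Nat.sub_zero,
              T.pow_Yτ]
            simp
          · intro l hl; omega
          · intro l hl _
            obtain ⟨i, rfl⟩ : ∃ i, l = i + 1 + 1 := ⟨l - 2, by omega⟩
            rw [← pow_apply_apply, hκB, ← pow_apply_apply, hXB, map_zero, zero_lie]
        have h3 := hS.derY κ ((X ^ (q - 2)) (Y ((X ^ (q - 1)) y)))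
        rw [h2, hκY, zero_lie, zero_add] at h3
        exact h3.symm
    · exfalso
      have h2 : 2 ∣ 2 ^ b := by
        have : 2 ^ 1 ∣ 2 ^ b := pow_dvd_pow 2 hb1
        simpa using this
      have hpos : 0 < 2 ^ b := by positivity
      have := T.rho_eq_high (n := q - 2) hbig (by omega) hA H (by omega) (by omega) (by omega) hB
        hBU hBY hXB' hAY (by omega)
      rw [cast_of_odd (by rw [Nat.odd_iff]; omega), CharTwo.add_self_eq_zero] at this
      exact T.ρ_ne this

theorem link_start (T : Tail ℒ k q e x y X Y 1 t τ v ρ) (hbig : ℒ (k + q / 2 + 1) ≠ ⊥) :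
    Link ℒ k q X Y t v ρ (2 * q - 1) ((X ^ (q - 2)) (Y ((X ^ (q - 1)) y))) ∧
      ∀ i, q < i → i < 2 * q - 1 → Normal ℒ Y i := by
  have hq8 := T.q_ge
  have hke := T.k_eq
  have hS := T.S
  obtain ⟨n, hn, hnt, hne, hYne, hrun, hc, -, hnor⟩ :=
    hS.exists_next T.he T.hq (p := q) le_rfl T.lt_t T.t_lt T.not_normal_t hS.w_mem hS.Y_w_ne
  have hn' : n + 2 = q := by
    rcases T.next_high hbig le_rfl T.lt_t hS.w_mem T.opposite_w hn hc with h | ⟨h, -⟩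
    · exfalso
      apply hne
      rw [show n = q - 1 by omega]
      exact T.pow_Yw_eq_zero
    · exact h
  obtain rfl : n = q - 2 := by omega
  refine ⟨⟨hS.pow_mem' _ (hS.Y_mem hS.w_mem) (by omega), ?_, hYne, by omega, fun h =>
    T.opposite_start hbig h hrun⟩, fun i h1 h2 => hnor i h1 (by omega)⟩
  rw [apply_pow, show q - 2 + 1 = q - 1 by omega]
  exact T.pow_Yw_eq_zero

/-- The images of `[y, x, …, x]` of degree `q - 1` under the powers of the adjoint map of `w`. -/
def chain (q : ℕ) (y : L) (X : Module.End F L) (m : ℕ) : L :=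
  ((LieAlgebra.ad F L ((X ^ (q - 1)) y)) ^ m) ((X ^ (q - 2)) y)

theorem chain_one (T : Tail ℒ k q e x y X Y 1 t τ v ρ) :
    chain q y X 1 = (X ^ (q - 2)) (Y ((X ^ (q - 1)) y)) := by
  have hq8 := T.q_ge
  rw [chain, pow_one, LieAlgebra.ad_apply, lie_comm_char_two F,
    T.S.lie_w T.hq (i := 1) (A := (X ^ (q - 1)) y) (by omega)
      (by rw [pow_apply_pow]; congr 2; omega) T.S.X_w
      (fun l hl => by rw [pow_apply_pow]; exact T.S.Y_b (by omega)),
    show q - 1 - 1 = q - 2 by omega]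

theorem chain_succ (T : Tail ℒ k q e x y X Y 1 t τ v ρ) {m : ℕ} (h : X (chain q y X m) = 0) :
    chain q y X (m + 1) = (X ^ (q - 1)) (Y (chain q y X m)) := by
  have hq8 := T.q_ge
  rw [show chain q y X (m + 1) = ⁅(X ^ (q - 1)) y, chain q y X m⁆ by
      rw [chain, chain, ← apply_pow, LieAlgebra.ad_apply], lie_comm_char_two F,
    T.S.lie_w T.hq (i := 0) (by omega) (by simp) h (by intro l hl; omega), Nat.sub_zero]

theorem chain_link (T : Tail ℒ k q e x y X Y 1 t τ v ρ) (hbig : ℒ (k + q / 2 + 1) ≠ ⊥) :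
    ∀ m, 1 ≤ m → m * q ≤ t →
      Link ℒ k q X Y t v ρ ((m + 1) * q - 1) (chain q y X m) ∧
        ∀ i, q < i → i < (m + 1) * q - 1 → (∀ j, 1 ≤ j → j < m → i ≠ (j + 1) * q - 1) →
          Normal ℒ Y i := by
  have hq8 := T.q_ge
  intro m hm
  induction m, hm using Nat.le_induction with
  | base =>
    intro _
    rw [T.chain_one]
    obtain ⟨h1, h2⟩ := T.link_start hbig
    exact ⟨h1, fun i h3 h4 _ => h2 i h3 h4⟩
  | succ m hm ih =>
    intro h
    have hmq : (m + 1) * q = m * q + q := by ring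
    obtain ⟨h1, h2⟩ := ih (by omega)
    have h1q : 1 * q ≤ m * q := Nat.mul_le_mul_right _ hm
    obtain ⟨h3, h4⟩ := T.link_next hbig (by omega) (by omega) h1
    have hmq' : (m + 1 + 1) * q = m * q + q + q := by ring
    rw [← T.chain_succ h1.X_eq, show (m + 1) * q - 1 + q = (m + 1 + 1) * q - 1 by omega] at h3
    refine ⟨h3, fun i h5 h6 h7 => ?_⟩
    rcases Nat.lt_trichotomy i ((m + 1) * q - 1) with h8 | h8 | h8
    · exact h2 i h5 h8 fun j h9 h10 => h7 j h9 (by omega)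
    · exact absurd h8 (h7 m hm (by omega))
    · exact h4 i h8 (by omega)

/-- The degree of the second diamond. -/
theorem exists_chain (T : Tail ℒ k q e x y X Y 1 t τ v ρ) (hbig : ℒ (k + q / 2 + 1) ≠ ⊥) :
    ∃ N, 3 ≤ N ∧ k + 1 = N * q ∧
      (∀ m, 2 ≤ m → m < N → Link ℒ k q X Y t v ρ (m * q - 1) (chain q y X (m - 1))) ∧
      ∀ i, q < i → i + 1 < k → (∀ m, 2 ≤ m → m < N → i ≠ m * q - 1) → Normal ℒ Y i := by
  have hq8 := T.q_ge
  have hke := T.k_eq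
  have hlt := T.lt_t
  obtain ⟨M, hM⟩ : ∃ M, M = t / q := ⟨_, rfl⟩
  have hMq : M * q ≤ t := hM ▸ Nat.div_mul_le_self t q
  have hM2 : t < (M + 1) * q := by
    rw [hM, mul_comm]; exact Nat.lt_mul_div_succ t (by omega)
  have hM1 : 1 ≤ M := by
    rw [hM]; exact Nat.div_pos hlt.le (by omega)
  obtain ⟨h1, h2⟩ := T.chain_link hbig M hM1 hMq
  -- A link never exceeds degree t, while t < (M + 1)q by the choice of M. So the chain ends exactly
  -- at t.
  have hte : t = (M + 1) * q - 1 := le_antisymm (by omega) h1.le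
  have e1 : (M + 2) * q = (M + 1) * q + q := by ring
  refine ⟨M + 2, by omega, by omega, fun m hm hmN => ?_, fun i h3 h4 h5 => ?_⟩
  · obtain ⟨j, rfl⟩ : ∃ j, m = j + 1 := ⟨m - 1, by omega⟩
    have : j * q ≤ M * q := Nat.mul_le_mul_right _ (by omega)
    exact (T.chain_link hbig j (by omega) (by omega)).1
  · rcases Nat.lt_trichotomy i t with h6 | h6 | h6
    · exact h2 i h3 (by omega) fun j h7 h8 => h5 (j + 1) (by omega) (by omega)
    · exact absurd (h6.trans hte) (h5 (M + 1) (by omega) (by omega))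
    · exact T.hbt i h6 h4

end Tail

end ChainStart
end ThinLie

namespace ThinLie

/-! ### Why N is a power of two -/

section PowerOfTwo

variable {F L : Type*} [Field F] [CharP F 2] [LieRing L] [LieAlgebra F L]
variable {ℒ : ℕ → Submodule F L} {k q : ℕ} {x y : L} {X Y : Module.End F L}
variable {e t : ℕ} {τ v : L} {ρ : F}

theorem mul_ne_mul_add {q N m r : ℕ} (h0 : 0 < r) (hr : r < q) : N * q + r ≠ m * q := by
  intro h
  have h1 : q ∣ r := (Nat.dvd_add_right (dvd_mul_left q N)).1 ⟨m, by rw [h, mul_comm]⟩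
  exact absurd (Nat.le_of_dvd h0 h1) (by omega)

/-- Given elements `A` and `B` centralized by `x` whose bracket spans its component, the
components following it are centralized by `y`. -/
theorem Frame.run_of_lie (S : Frame ℒ k q x y X Y) {r a b : ℕ} {A B : L}
    (hr : 1 ≤ r) (hab : b + a = r) (hA : A ∈ ℒ a) (hB : B ∈ ℒ b) (hXA : X A = 0) (hXB : X B = 0)
    (hAY : ∀ l, l + 2 ≤ q → Y ((X ^ l) (Y A)) = 0) (hBY : ∀ l, l + 2 ≤ q → Y ((X ^ l) (Y B)) = 0)
    (h : SpannedBy ℒ r ⁅B, A⁆) :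
    ∀ i, i + 2 ≤ q → Y ((X ^ i) (Y ⁅B, A⁆)) = 0 := by
  have hX : X ⁅B, A⁆ = 0 := by rw [S.derX, hXA, hXB, zero_lie, lie_zero, add_zero]
  have hs := h.Y_of_X_eq_zero S hr hX
  -- The induction carries along the vanishing of all brackets [X^c YB, X^d YA] with c + d = i. The
  -- vanishing for i - 1 makes those for i coincide.
  suffices H : ∀ i, i + 2 ≤ q → Y ((X ^ i) (Y ⁅B, A⁆)) = 0 ∧
      ∀ c d, c + d = i → ⁅(X ^ c) (Y B), (X ^ d) (Y A)⁆ = 0 from fun i hi => (H i hi).1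
  have hlie : ∀ i, i + 2 ≤ q → (∀ l, l ≤ i → Y ((X ^ l) (Y ⁅B, A⁆)) = 0) →
      ⁅(X ^ i) (Y B), Y A⁆ = 0 := by
    intro i hi hl
    have h1 := (hs.pow S (by omega) i fun l h => hl l h.le).normal (hl i le_rfl)
    have h2 := S.derY ((X ^ i) (Y B)) A
    rw [h1 _ (S.lie_mem' (S.pow_mem (S.Y_mem hB) i) hA (by omega)), hBY i hi, zero_lie,
      zero_add] at h2
    exact h2.symm
  intro i
  induction i using Nat.strong_induction_on with
  | _ i ih =>
    intro hi
    have hstep : ∀ c d, c + d + 1 = i → ⁅(X ^ (c + 1)) (Y B), (X ^ d) (Y A)⁆ =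
        ⁅(X ^ c) (Y B), (X ^ (d + 1)) (Y A)⁆ := by
      intro c d hcd
      have h1 := S.derX ((X ^ c) (Y B)) ((X ^ d) (Y A))
      rw [(ih (c + d) (by omega) (by omega)).2 c d rfl, map_zero, apply_pow, apply_pow] at h1
      exact eq_of_add_eq_zero F h1.symm
    have hall : ∀ d c, c + d = i → ⁅(X ^ c) (Y B), (X ^ d) (Y A)⁆ = ⁅(X ^ i) (Y B), Y A⁆ := by
      intro d
      induction d with
      | zero => intro c hc; obtain rfl : c = i := by omega
                simp
      | succ d ihd =>
        intro c hc
        rw [← hstep c d (by omega), ihd (c + 1) (by omega)]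
    -- X^i Y[B, A] is the sum of [X^i YB, A] and [B, X^i YA], and Y sends the two summands to the
    -- same bracket, which cancels.
    have hY : Y ((X ^ i) (Y ⁅B, A⁆)) = 0 := by
      have h1 : (X ^ i) (Y ⁅B, A⁆) = ⁅(X ^ i) (Y B), A⁆ + ⁅B, (X ^ i) (Y A)⁆ := by
        rw [S.derY, map_add, S.derX.lie_pow_of_apply_eq_zero hXB]
        congr 1
        rw [lie_comm_char_two F, ← S.derX.lie_pow_of_apply_eq_zero hXA, lie_comm_char_two F]
      have h2 := hall i 0 (by omega)
      rw [pow_zero, Module.End.one_apply] at h2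
      rw [h1, map_add, S.derY, S.derY, hBY i hi, hAY i hi, zero_lie, lie_zero, zero_add, add_zero,
        h2, add_self_zero F]
    have h0 := hlie i hi fun l hl => by
      rcases Nat.eq_or_lt_of_le hl with rfl | hl
      · exact hY
      · exact (ih l hl (by omega)).1
    exact ⟨hY, fun c d hcd => by rw [hall d c hcd, h0]⟩

namespace Tail

/-- τ is determined only up to a scalar. Rescaling makes it equal to the last link of the chain
before the second diamond. -/
theorem smul (T : Tail ℒ k q e x y X Y 1 t τ v ρ) {a : F} (ha : a ≠ 0) :
    Tail ℒ k q e x y X Y 1 t (a • τ) (a • v) ρ where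
  S := T.S
  he := T.he
  hq := T.hq
  hd := T.hd
  q_le := T.q_le
  t_eq := T.t_eq
  hbt := T.hbt
  τ_mem := (ℒ t).smul_mem _ T.τ_mem
  X_τ := by rw [map_smul, T.X_τ, smul_zero]
  v_eq := by rw [map_smul, map_smul, T.v_eq]
  v_ne := smul_ne_zero ha T.v_ne
  YXv := by rw [map_smul, map_smul, T.YXv, map_smul, map_smul, smul_comm]
  ρ_ne := T.ρ_ne
  spanned := by
    refine ⟨by rw [map_smul, map_smul]; exact (ℒ _).smul_mem _ T.spanned.1, fun w hw => ?_⟩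
    obtain ⟨b, rfl⟩ := T.spanned.2 w hw
    exact ⟨b * a⁻¹, by rw [map_smul, map_smul, smul_smul, mul_assoc, inv_mul_cancel₀ ha, mul_one]⟩
  tail := fun l hl => by rw [map_smul, map_smul, map_smul, T.tail l hl, smul_zero]

/-- One step beyond the range of `tail`: computing Y[τ, X^(q-3) Yw] directly and by the derivation
rule gives the element itself and 1 + ρ times it, and ρ is nonzero. -/
theorem Y_pow_Yv (T : Tail ℒ k q e x y X Y 1 t τ v ρ) (hbig : ℒ (k + q / 2 + 1) ≠ ⊥) :
    Y ((X ^ (q - 2)) (Y v)) = 0 := by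
  have hq8 := T.q_ge
  have hS := T.S
  have hke := T.k_eq
  obtain ⟨-, hn⟩ := T.link_start hbig
  have hEY : Y ((X ^ (q - 3)) (Y ((X ^ (q - 1)) y))) = 0 :=
    hn (q + 1 + (q - 3)) (by omega) (by omega) _ (hS.pow_mem (hS.Y_mem hS.w_mem) _)
  have hlie : ∀ l, l + 3 ≤ q → ⁅(X ^ l) (Y τ), Y ((X ^ (q - 1)) y)⁆ =
      (1 + ρ) • Y ((X ^ (l + 1)) (Y v)) := by
    intro l hl
    have h1 := hS.derY ((X ^ l) (Y τ)) ((X ^ (q - 1)) y)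
    rw [T.lie_w_v (m := q - 2 - l) (by omega) (by left; omega)
        (by rw [pow_apply_pow, ← T.pow_Yτ]; congr 2; omega)
        (fun j hj => by rw [pow_apply_pow]; exact T.Y_pow_Yτ (by omega)),
      T.Y_pow_Yτ (by omega), zero_lie, zero_add, map_smul,
      show q - 1 - (q - 2 - l) = l + 1 by omega] at h1
    exact h1.symm
  have h1 := hS.derY τ ((X ^ (q - 3)) (Y ((X ^ (q - 1)) y)))
  rw [hEY, lie_zero, add_zero, hS.derX.lie_pow_of_apply_eq_zero T.X_τ, T.opposite_w.lie, one_smul,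
    pow_apply_apply, hS.derX.lie_pow_one (m := q - 3), hlie _ (by omega), Nat.choose_self,
    Nat.sub_self, show q - 3 + 1 = q - 2 by omega] at h1
  · have h2 : ρ • Y ((X ^ (q - 2)) (Y v)) = 0 := by
      simpa [add_smul] using h1
    exact (smul_eq_zero.1 h2).resolve_left T.ρ_ne
  · intro l hl _
    rw [hlie l (by omega), T.tail _ (by omega), smul_zero]
  · intro l hl hl2; omega

theorem spanned_run (T : Tail ℒ k q e x y X Y 1 t τ v ρ) (hbig : ℒ (k + q / 2 + 1) ≠ ⊥) {a : ℕ}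
    (ha1 : 1 ≤ a) (ha : a + 1 ≤ q) : SpannedBy ℒ (k + a) ((X ^ a) (Y v)) := by
  have h := T.spanned.pow T.S (by omega) (a - 1) (fun l hl => by
    rw [pow_apply_apply]
    rcases Nat.lt_or_ge (l + 1 + 2) q with h | h
    · exact T.tail _ (by omega)
    · rw [show l + 1 = q - 2 by omega]; exact T.Y_pow_Yv hbig)
  rwa [pow_apply_apply, show a - 1 + 1 = a by omega, show k + 1 + (a - 1) = k + a by omega] at h

/-- If `k + 1 = N * q`, then `N` is a power of two. -/
theorem exists_two_pow (T : Tail ℒ k q e x y X Y 1 t τ v ρ) (hbig : ℒ (k + q / 2 + 1) ≠ ⊥)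
    {N : ℕ} (hN : 3 ≤ N) (hk : k + 1 = N * q)
    (hlink : ∀ m, 2 ≤ m → m < N → chain q y X (m - 1) ∈ ℒ (m * q - 1) ∧ X (chain q y X (m - 1)) = 0)
    (hnor : ∀ i, q < i → i + 1 < k → (∀ m, 2 ≤ m → m < N → i ≠ m * q - 1) → Normal ℒ Y i)
    (hτ : chain q y X (N - 2) = τ)
    (hdim : ∀ M, k ≤ M → (∀ i, k < i → i ≤ M → ∃ u, SpannedBy ℒ i u) → 3 * (M + 2) ≤ 4 * k + 1 →
      ℒ (M + 1) ≠ ⊥) : ∃ s, N = 2 ^ s := by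
  have hq8 := T.q_ge
  have hS := T.S
  have hke := T.k_eq
  set W := LieAlgebra.ad F L ((X ^ (q - 1)) y) with hW
  have hWd : IsDer W := IsDer.ad _
  have hWa : ∀ u, W u = ⁅u, (X ^ (q - 1)) y⁆ := fun u => by
    rw [hW, LieAlgebra.ad_apply, lie_comm_char_two F]
  have hWp : ∀ a m, (W ^ a) (chain q y X m) = chain q y X (a + m) := fun a m => by
    rw [chain, chain, ← hW, pow_apply_pow]
  have hWc : ∀ m, W (chain q y X m) = chain q y X (m + 1) := fun m => by
    rw [chain, chain, ← hW, apply_pow]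
  have hmul : ∀ m n : ℕ, m ≤ n → m * q ≤ n * q := fun m n h => Nat.mul_le_mul_right _ h
  have hX : ∀ m, 1 ≤ m → m + 2 ≤ N → X (chain q y X m) = 0 := fun m h1 h2 => by
    simpa using (hlink (m + 1) (by omega) (by omega)).2
  have hmem : ∀ m, 1 ≤ m → m + 2 ≤ N → chain q y X m ∈ ℒ ((m + 1) * q - 1) := fun m h1 h2 => by
    simpa using (hlink (m + 1) (by omega) (by omega)).1
  have hrun : ∀ m, 1 ≤ m → m + 3 ≤ N → ∀ l, l + 2 ≤ q →
      Y ((X ^ l) (Y (chain q y X m))) = 0 := by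
    intro m h1 h2 l hl
    have h3 := hmul (m + 3) N h2
    have h4 : (m + 3) * q = (m + 1) * q + q + q := by ring
    have h5 := hmul 2 (m + 1) (by omega)
    refine hnor ((m + 1) * q + l) (by omega) (by omega) (fun j _ _ h => ?_) _
      (hS.pow_mem' l (hS.Y_mem' (hmem m h1 (by omega)) (j := (m + 1) * q) (by omega)) rfl)
    exact mul_ne_mul_add (q := q) (N := m + 1) (m := j) (r := l + 1) (by omega) (by omega)
      (by omega)
  -- X kills the bracket, whose degree is at most k - 1 and congruent to -2 modulo q. Below k - 1
  -- this degree is centralized by y, and in degree k - 1 no nonzero element is killed by X.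
  have hcomm : ∀ a b, 1 ≤ a → 1 ≤ b → a + b + 2 ≤ N → ⁅chain q y X a, chain q y X b⁆ = 0 := by
    intro a b ha hb hab
    have h1 := hmem a ha (by omega)
    have h2 := hmem b hb (by omega)
    have h3 := hmul _ _ hab
    have h4 : (a + b + 2) * q = (a + 1) * q + (b + 1) * q := by ring
    have h5 := hmul 2 (a + 1) (by omega)
    have h6 := hmul 2 (b + 1) (by omega)
    have h7 : ⁅chain q y X a, chain q y X b⁆ ∈ ℒ ((a + b + 2) * q - 2) :=
      hS.lie_mem' h1 h2 (by omega)
    have h8 : X ⁅chain q y X a, chain q y X b⁆ = 0 := by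
      rw [hS.derX, hX a ha (by omega), hX b hb (by omega), zero_lie, lie_zero, add_zero]
    by_contra h0
    rcases Nat.lt_or_ge ((a + b + 2) * q - 2 + 1) k with h9 | h9
    · refine hS.ne_bot (by omega) (by omega) (hS.bot_of_zero (by omega) h7 h0 h8 ?_)
      refine hnor _ (by omega) h9 (fun j _ _ h => ?_) _ h7
      have h10 : (a + b + 2) * q = (a + b + 1) * q + q := by ring
      exact mul_ne_mul_add (q := q) (N := a + b + 1) (m := j) (r := q - 1) (by omega) (by omega)
        (by omega)
    · rw [show (a + b + 2) * q - 2 = k - 1 by omega] at h7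
      exact hS.X_last_ne h7 h0 h8
  -- The elements ζ j continue the chain beyond the second diamond: ζ 0 = X^(q-1) Yv, and ζ (j + 1)
  -- = W(ζ j).
  obtain ⟨ζ, hζ⟩ : ∃ ζ : ℕ → L, ∀ j, ζ j = (W ^ j) ((X ^ (q - 1)) (Y v)) := ⟨_, fun _ => rfl⟩
  have hζ0 : ζ 0 = (X ^ (q - 1)) (Y v) := by rw [hζ]; rfl
  have hζs : ∀ j, ζ (j + 1) = W (ζ j) := fun j => by rw [hζ, hζ, apply_pow]
  have hXXv : X (X v) = 0 := by
    rw [← T.pow_succ_Yτ, apply_pow]; exact hS.X_pow_q T.hq (by omega) _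
  have hlast : chain q y X (N - 1) = X v := by
    rw [show N - 1 = N - 2 + 1 by omega, T.chain_succ (by rw [hτ, T.X_τ]), hτ, T.pow_succ_Yτ]
  have hWv : W v = (1 + ρ) • ζ 0 := by
    rw [hWa, T.lie_w_v (m := 0) (by omega) (Or.inr hXXv) (by simp) (by intro l hl; omega), hζ0,
      Nat.sub_zero]
  have hWlast : W (chain q y X (N - 1)) = 0 := by
    rw [hlast]
    have h := hS.derX v ((X ^ (q - 1)) y)
    rw [hS.X_w, lie_zero, add_zero, ← hWa, hWv, ← hWa, hζ0, map_smul, apply_pow,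
      hS.X_pow_q T.hq (by omega), smul_zero] at h
    exact h.symm
  have hρ : ∀ j, ⁅chain q y X (N - 1), chain q y X j⁆ = ρ • ζ j := by
    intro j
    induction j with
    | zero =>
      rw [hlast, chain, pow_zero, Module.End.one_apply, hS.derX.lie_pow_of_apply_eq_zero hXXv,
        hS.lie_y, T.YXv, map_smul, pow_apply_apply, hζ0, show q - 2 + 1 = q - 1 by omega]
    | succ j ih =>
      have h := hWd (chain q y X (N - 1)) (chain q y X j)
      rw [hWlast, zero_lie, zero_add, ih, map_smul, ← hζs, hWc] at h
      exact h.symm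
  -- Apply W to [chain (N - 2), chain 0] = v. The result (1 + ρ)ζ 0 already contains [chain (N - 1),
  -- chain 0] = ρζ 0.
  have hone : ⁅chain q y X (N - 2), chain q y X 1⁆ = ζ 0 := by
    have h := hWd (chain q y X (N - 2)) (chain q y X 0)
    have h1 : ⁅chain q y X (N - 2), chain q y X 0⁆ = v := by
      rw [hτ, chain, pow_zero, Module.End.one_apply, hS.derX.lie_pow_of_apply_eq_zero T.X_τ,
        hS.lie_y, T.pow_Yτ]
    rw [h1, hWv, hWc, hWc, show N - 2 + 1 = N - 1 by omega, hρ, add_smul, one_smul,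
      add_comm] at h
    exact (add_left_cancel h).symm
  have hXζ : ∀ j, X (ζ j) = 0 := by
    intro j
    induction j with
    | zero => rw [hζ0, apply_pow]; exact hS.X_pow_q T.hq (by omega) _
    | succ j ih => rw [hζs, hWa, hS.derX, ih, hS.X_w, zero_lie, lie_zero, add_zero]
  have hζY : ∀ j, ζ (j + 1) = (X ^ (q - 1)) (Y (ζ j)) := fun j => by
    rw [hζs, hWa, hS.lie_w T.hq (i := 0) (by omega) (by simp) (hXζ j) (by intro l hl; omega),
      Nat.sub_zero]
  obtain ⟨f, o, ho, hNo⟩ := Nat.exists_eq_two_pow_mul_odd (n := N) (by omega)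
  obtain ⟨r, rfl⟩ := ho
  rcases Nat.eq_zero_or_pos r with rfl | hr
  · exact ⟨f, by simpa using hNo⟩
  exfalso
  obtain ⟨Q, hQ⟩ : ∃ Q, Q = 2 ^ f := ⟨_, rfl⟩
  rw [← hQ] at hNo
  have hQ0 : 0 < Q := hQ ▸ by positivity
  have hQr : Q * 3 ≤ N := by rw [hNo]; exact Nat.mul_le_mul_left _ (by omega)
  -- Up to degree k + Qq - 1 every component is spanned by one element, so the second diamond is the
  -- last component of dimension two in this range.
  have hspan : ∀ j, j < Q → SpannedBy ℒ (k + j * q + (q - 1)) (ζ j) ∧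
      ∀ i, k < i → i ≤ k + j * q + (q - 1) → ∃ u, SpannedBy ℒ i u := by
    intro j
    induction j with
    | zero =>
      intro _
      rw [zero_mul, add_zero, hζ0]
      refine ⟨T.spanned_run hbig (by omega) (by omega), fun i h1 h2 => ?_⟩
      obtain ⟨a, rfl⟩ := Nat.exists_eq_add_of_lt h1
      exact ⟨_, T.spanned_run hbig (a := a + 1) (by omega) (by omega)⟩
    | succ j ih =>
      intro hj
      obtain ⟨h1, h2⟩ := ih (by omega)
      -- To apply `run_of_lie`, ζ j must be a nonzero multiple of a bracket of two links before the
      -- second diamond. For j = 0 all brackets of links with index sum N - 1 and positive indices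
      -- agree with ζ 0. For j > 0 the derivation W^Q is applied to [chain (N - Q - 1), chain j] =
      -- 0.
      have hlie : ∃ θ : F, θ ≠ 0 ∧
          ⁅chain q y X (N - Q - 1), chain q y X (Q + j)⁆ = θ • ζ j := by
        rcases Nat.eq_zero_or_pos j with rfl | hj0
        · refine ⟨1, one_ne_zero, ?_⟩
          have h3 := hWd.lie_pow_self_eq (c := chain q y X 1) (n := N - 3) (fun i hi => by
            rw [hWp]; exact hcomm _ _ (by omega) le_rfl (by omega)) (N - 3) le_rfl (Q - 1) (by omega)
          rw [hWp, hWp, hWp, show N - 3 - (Q - 1) + 1 = N - Q - 1 by omega,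
            show Q - 1 + 1 = Q + 0 by omega, show N - 3 + 1 = N - 2 by omega, hone] at h3
          rw [h3, one_smul]
        · refine ⟨ρ, T.ρ_ne, ?_⟩
          have h3 := hWd.pow_two_pow f (chain q y X (N - Q - 1)) (chain q y X j)
          rw [hcomm _ _ (by omega) hj0 (by omega), map_zero, ← hQ, hWp, hWp,
            show Q + (N - Q - 1) = N - 1 by omega, hρ] at h3
          exact (eq_of_add_eq_zero F h3.symm).symm
      obtain ⟨θ, hθ, h3⟩ := hlie
      have h4 : SpannedBy ℒ (k + j * q + (q - 1))
          ⁅chain q y X (N - Q - 1), chain q y X (Q + j)⁆ := by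
        rw [h3]
        refine ⟨(ℒ _).smul_mem _ h1.1, fun w hw => ?_⟩
        obtain ⟨b, rfl⟩ := h1.2 w hw
        exact ⟨b * θ⁻¹, by rw [smul_smul, mul_assoc, inv_mul_cancel₀ hθ, mul_one]⟩
      have h5 := hmul 1 (Q + j + 1) (by omega)
      have h6 := hmul 1 (N - Q - 1 + 1) (by omega)
      have h7 : (Q + j + 1) * q + (N - Q - 1 + 1) * q = N * q + (j + 1) * q := by
        rw [← add_mul, ← add_mul]; congr 1; omega
      have h8 : (j + 1) * q = j * q + q := by ring
      have h9 := hS.run_of_lie (by omega) (by omega)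
        (hmem (Q + j) (by omega) (by omega)) (hmem (N - Q - 1) (by omega) (by omega))
        (hX (Q + j) (by omega) (by omega)) (hX (N - Q - 1) (by omega) (by omega))
        (hrun (Q + j) (by omega) (by omega)) (hrun (N - Q - 1) (by omega) (by omega)) h4
      rw [h3] at h9
      have h10 : ∀ i, i + 2 ≤ q → Y ((X ^ i) (Y (ζ j))) = 0 := fun i hi => by
        have := h9 i hi
        rw [map_smul, map_smul, map_smul] at this
        exact (smul_eq_zero.1 this).resolve_left hθ
      have h11 := h1.Y_of_X_eq_zero hS (by omega) (hXζ j)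
      have h12 : ∀ i, i + 1 ≤ q → SpannedBy ℒ (k + j * q + (q - 1) + 1 + i)
          ((X ^ i) (Y (ζ j))) := fun i hi =>
        h11.pow hS (by omega) i fun l hl => h10 l (by omega)
      refine ⟨?_, fun i h13 h14 => ?_⟩
      · have := h12 (q - 1) (by omega)
        rwa [← hζY, show k + j * q + (q - 1) + 1 + (q - 1) = k + (j + 1) * q + (q - 1) by
          omega] at this
      · rcases Nat.lt_or_ge (k + j * q + (q - 1)) i with h | h
        · obtain ⟨a, rfl⟩ := Nat.exists_eq_add_of_lt h
          refine ⟨(X ^ a) (Y (ζ j)), ?_⟩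
          rw [add_right_comm _ a 1]
          exact h12 a (by omega)
        · exact h2 i h13 h
  obtain ⟨h1, h2⟩ := hspan (Q - 1) (by omega)
  have h3 : (Q - 1) * q + q = Q * q := by
    rw [← Nat.succ_mul]; congr 1; omega
  have h4 : Q * q * 3 ≤ N * q := by
    rw [mul_right_comm]; exact hmul _ _ hQr
  have hne : ζ (Q - 1) ≠ 0 := by
    apply h1.ne_zero
    -- The component has degree k + Qq - 1, and 3Qq ≤ Nq = k + 1 is exactly what the dimension bound
    -- allows.
    have := hdim (k + (Q - 1) * q + (q - 1) - 1) (by omega) (fun i h5 h6 => h2 i h5 (by omega))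
      (by omega)
    rwa [Nat.sub_add_cancel (by omega)] at this
  apply hne
  -- For Q = 1 the natural base element chain (Q - 1) has index zero, where `hcomm` does not apply.
  -- The argument then starts from chain 1.
  rcases Nat.eq_or_lt_of_le (show 1 ≤ Q from hQ0) with h5 | h5
  · have h6 := hWd.lie_pow_self_eq_zero (c := chain q y X 1) (n := r - 1) (fun i hi => by
      rw [hWp]; exact hcomm _ _ (by omega) le_rfl (by rw [← h5] at hNo; omega))
    rw [← h5] at hNo ⊢
    rw [hWp, show 2 * (r - 1) + 1 = N - 2 by omega, hone] at h6
    exact h6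
  · have hpow : ∀ i, ((W ^ Q) ^ i) (chain q y X (Q - 1)) = chain q y X (Q * i + (Q - 1)) :=
      fun i => by rw [← pow_mul, hWp]
    have h6 := (hWd.pow_two_pow f).lie_pow_self_eq_zero (c := chain q y X (Q - 1)) (n := r) (by
      intro i hi
      rw [← hQ, hpow]
      refine hcomm _ _ (by omega) (by omega) ?_
      have : Q * (i + 2) ≤ Q * (2 * r + 1) := Nat.mul_le_mul_left _ (by omega)
      rw [← hNo, mul_add] at this
      omega)
    rw [mul_add, mul_one] at hNo
    rw [← hQ, hpow, show Q * (2 * r) + (Q - 1) = N - 1 by omega, hρ] at h6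
    exact (smul_eq_zero.1 h6).resolve_left T.ρ_ne

end Tail

end PowerOfTwo
end ThinLie

namespace ThinLie

/-! ### Lie powers, quotients and metabelianity -/

section Quotients

variable {F L : Type*} [Field F] [LieRing L] [LieAlgebra F L]

/-- The sum of the components of degree at least `n`. -/
def upper (ℒ : ℕ → Submodule F L) (n : ℕ) : Submodule F L := ⨆ i, ⨆ (_ : n ≤ i), ℒ i

variable {ℒ : ℕ → Submodule F L}

theorem le_upper {n i : ℕ} (h : n ≤ i) : ℒ i ≤ upper ℒ n := le_iSup₂_of_le i h le_rfl

theorem upper_le {n : ℕ} {P : Submodule F L} (h : ∀ i, n ≤ i → ℒ i ≤ P) : upper ℒ n ≤ P :=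
  iSup₂_le h

/-- A bracket of two sums of components lies in a submodule if the brackets of components do. -/
theorem lie_mem_of_upper {m n : ℕ} {P : Submodule F L}
    (h : ∀ i j, m ≤ i → n ≤ j → ∀ u ∈ ℒ i, ∀ w ∈ ℒ j, ⁅u, w⁆ ∈ P) {u w : L}
    (hu : u ∈ upper ℒ m) (hw : w ∈ upper ℒ n) : ⁅u, w⁆ ∈ P := by
  have h1 : ∀ i, m ≤ i → ∀ a ∈ ℒ i, ⁅a, w⁆ ∈ P := by
    intro i hi a ha
    have : upper ℒ n ≤ P.comap (LieAlgebra.ad F L a : L →ₗ[F] L) := upper_le fun j hj b hb => by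
      simpa using h i j hi hj a ha b hb
    simpa using this hw
  have h2 : upper ℒ m ≤ P.comap (LieAlgebra.ad F L w : L →ₗ[F] L) := upper_le fun i hi a ha => by
    have := h1 i hi a ha
    rw [← lie_skew] at this
    simpa using P.neg_mem this
  have h3 : ⁅w, u⁆ ∈ P := by simpa using h2 hu
  rw [← lie_skew]
  exact P.neg_mem h3

theorem IsPositivelyGraded.upper_one (G : IsPositivelyGraded ℒ) : upper ℒ 1 = ⊤ := by
  rw [eq_top_iff, ← G.isInternal.submodule_iSup_eq_top]
  refine iSup_le fun i => ?_
  rcases Nat.eq_zero_or_pos i with rfl | h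
  · rw [G.zero_eq_bot]; exact bot_le
  · exact le_upper h

theorem IsPositivelyGraded.eq_zero_of_mem_upper (G : IsPositivelyGraded ℒ) {i n : ℕ} (h : i < n)
    {u : L} (hu : u ∈ ℒ i) (hn : u ∈ upper ℒ n) : u = 0 := by
  have h1 := G.isInternal.submodule_iSupIndep i
  have h2 : upper ℒ n ≤ ⨆ j, ⨆ (_ : j ≠ i), ℒ j :=
    upper_le fun j hj => le_iSup₂_of_le j (by omega) le_rfl
  exact (Submodule.disjoint_def.1 h1) u hu (h2 hn)

/-- The Lie powers of a graded Lie algebra generated in degree one. -/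
theorem IsPositivelyGraded.liePower_eq (G : IsPositivelyGraded ℒ)
    (hgen : ∀ i, 1 ≤ i → ∀ t ∈ ℒ (i + 1), ∃ a b : L, ∃ u ∈ ℒ i, ∃ w ∈ ℒ i, t = ⁅a, u⁆ + ⁅b, w⁆)
    (n : ℕ) : LieSubmodule.toSubmodule (liePower F L (n + 1)) = upper ℒ (n + 1) := by
  rw [liePower, Nat.add_sub_cancel]
  induction n with
  | zero => rw [LieModule.lowerCentralSeries_zero, LieSubmodule.top_toSubmodule, G.upper_one]
  | succ n ih =>
    rw [LieModule.lowerCentralSeries_succ, LieSubmodule.lieIdeal_oper_eq_linear_span']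
    apply le_antisymm
    · rw [Submodule.span_le]
      rintro _ ⟨a, -, u, hu, rfl⟩
      rw [← LieSubmodule.mem_toSubmodule, ih] at hu
      refine lie_mem_of_upper (m := 1) (fun i j hi hj u hu w hw => ?_)
        (by rw [G.upper_one]; trivial) hu
      exact le_upper (by omega) (G.bracket_mem i j u hu w hw)
    · refine upper_le fun i hi t ht => ?_
      obtain ⟨j, rfl⟩ : ∃ j, i = j + 1 := ⟨i - 1, by omega⟩
      obtain ⟨a, b, u, hu, w, hw, rfl⟩ := hgen j (by omega) t ht
      have hmem : ∀ u ∈ ℒ j, u ∈ LieModule.lowerCentralSeries F L L n := fun u hu => by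
        rw [← LieSubmodule.mem_toSubmodule, ih]
        exact le_upper (by omega) hu
      exact Submodule.add_mem _
        (Submodule.subset_span ⟨a, LieSubmodule.mem_top a, u, hmem u hu, rfl⟩)
        (Submodule.subset_span ⟨b, LieSubmodule.mem_top b, w, hmem w hw, rfl⟩)

theorem toSubmodule_derivedSeries_one (K : Type*) [LieRing K] [LieAlgebra F K] :
    LieSubmodule.toSubmodule (LieAlgebra.derivedSeries F K 1) =
      Submodule.span F {⁅x, y⁆ | (x : K) (y : K)} :=
  LieAlgebra.coe_derivedSeries_one_eq F K

theorem isMetabelian_quotient_iff (I : LieIdeal F L) :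
    IsMetabelian F (L ⧸ I) ↔
      ∀ a ∈ LieAlgebra.derivedSeries F L 1, ∀ b ∈ LieAlgebra.derivedSeries F L 1, ⁅a, b⁆ ∈ I := by
  have hmap : ∀ z : L ⧸ I, z ∈ LieAlgebra.derivedSeries F (L ⧸ I) 1 ↔
      ∃ a ∈ LieAlgebra.derivedSeries F L 1, LieSubmodule.Quotient.mk' I a = z := by
    intro z
    have h1 : LieSubmodule.toSubmodule (LieAlgebra.derivedSeries F (L ⧸ I) 1) =
        (LieSubmodule.toSubmodule (LieAlgebra.derivedSeries F L 1)).map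
          (LieSubmodule.Quotient.mk' I : L →ₗ[F] L ⧸ I) := by
      rw [toSubmodule_derivedSeries_one, toSubmodule_derivedSeries_one, Submodule.map_span]
      congr 1
      ext z
      constructor
      · rintro ⟨a, b, rfl⟩
        obtain ⟨a, rfl⟩ := LieSubmodule.Quotient.surjective_mk' I a
        obtain ⟨b, rfl⟩ := LieSubmodule.Quotient.surjective_mk' I b
        exact ⟨⁅a, b⁆, ⟨a, b, rfl⟩, rfl⟩
      · rintro ⟨_, ⟨a, b, rfl⟩, rfl⟩
        exact ⟨LieSubmodule.Quotient.mk' I a, LieSubmodule.Quotient.mk' I b, rfl⟩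
    rw [← LieSubmodule.mem_toSubmodule, h1]
    exact Submodule.mem_map
  change LieAlgebra.derivedSeriesOfIdeal F (L ⧸ I) (1 + 1) ⊤ = ⊥ ↔ _
  rw [LieAlgebra.derivedSeriesOfIdeal_succ, LieSubmodule.lie_eq_bot_iff]
  constructor
  · intro h a ha b hb
    rw [← LieSubmodule.Quotient.mk_eq_zero]
    exact h _ ((hmap _).2 ⟨a, ha, rfl⟩) _ ((hmap _).2 ⟨b, hb, rfl⟩)
  · intro h z hz z' hz'
    obtain ⟨a, ha, rfl⟩ := (hmap z).1 hz
    obtain ⟨b, hb, rfl⟩ := (hmap z').1 hz'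
    exact (LieSubmodule.Quotient.mk_eq_zero (N := I)).2 (h a ha b hb)

theorem derivedSeries_one_eq_liePower :
    LieAlgebra.derivedSeries F L 1 = liePower F L 2 := rfl

/-- The quotient of a graded Lie algebra by the sum of its components of large degree. -/
theorem IsPositivelyGraded.quotient (G : IsPositivelyGraded ℒ) {I : LieIdeal F L} {n : ℕ}
    (hI : LieSubmodule.toSubmodule I = upper ℒ n) : IsPositivelyGraded (quotientGrading I ℒ) := by
  have hmk : ∀ u, LieSubmodule.Quotient.mk' I u = 0 ↔ u ∈ upper ℒ n := fun u => by
    rw [LieSubmodule.Quotient.mk_eq_zero, ← hI]; rfl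
  refine ⟨by rw [quotientGrading, G.zero_eq_bot, Submodule.map_bot], ?_, ?_⟩
  · apply DirectSum.isInternal_submodule_of_iSupIndep_of_iSup_eq_top
    · intro i
      rw [Submodule.disjoint_def]
      rintro z ⟨u, hu, rfl⟩ hz
      simp only [quotientGrading, ← Submodule.map_iSup] at hz
      obtain ⟨w, hw, hwu⟩ := hz
      have h1 : u - w ∈ upper ℒ n := by
        rw [← hmk, map_sub, sub_eq_zero]; exact hwu.symm
      rcases Nat.lt_or_ge i n with h | h
      · have h2 : upper ℒ n ≤ ⨆ j, ⨆ (_ : j ≠ i), ℒ j :=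
          upper_le fun j hj => le_iSup₂_of_le j (by omega) le_rfl
        have h3 : u ∈ ⨆ j, ⨆ (_ : j ≠ i), ℒ j := by
          have := Submodule.add_mem _ (h2 h1) hw
          rwa [sub_add_cancel] at this
        rw [Submodule.disjoint_def.1 (G.isInternal.submodule_iSupIndep i) u hu h3, map_zero]
      · exact (hmk u).2 (le_upper h hu)
    · change ⨆ i, (ℒ i).map (LieSubmodule.Quotient.mk' I : L →ₗ[F] L ⧸ I) = ⊤
      rw [← Submodule.map_iSup, G.isInternal.submodule_iSup_eq_top, Submodule.map_top, LinearMap.range_eq_top]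
      exact LieSubmodule.Quotient.surjective_mk' I
  · rintro i j _ ⟨u, hu, rfl⟩ _ ⟨w, hw, rfl⟩
    exact ⟨⁅u, w⁆, G.bracket_mem i j u hu w hw, rfl⟩

end Quotients
end ThinLie

namespace ThinLie

/-! ### From thin Lie algebras to frames, and the dimension count -/

section Thin

variable {F L : Type*} [Field F] [LieRing L] [LieAlgebra F L] {ℒ : ℕ → Submodule F L}
variable {k q : ℕ} {x y : L}

theorem IsFirstTwoCentralizers.y_mem (C : IsFirstTwoCentralizers ℒ q x y) :
    y ∈ ℒ 1 ∧ ∀ b ∈ ℒ 2, ⁅y, b⁆ = 0 := by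
  have : y ∈ twoStepCentralizer ℒ 2 := by
    rw [C.centralizer_two]; exact Submodule.mem_span_singleton_self y
  exact this

theorem IsFirstTwoCentralizers.x_mem (C : IsFirstTwoCentralizers ℒ q x y) :
    x ∈ ℒ 1 ∧ ∀ b ∈ ℒ q, ⁅x, b⁆ = 0 := by
  have : x ∈ twoStepCentralizer ℒ q := by
    rw [C.centralizer_qb]; exact Submodule.mem_span_singleton_self x
  exact this

theorem IsFirstTwoCentralizers.lie_y (C : IsFirstTwoCentralizers ℒ q x y) {i : ℕ} (h2 : 2 ≤ i)
    (hi : i < q) {b : L} (hb : b ∈ ℒ i) : ⁅y, b⁆ = 0 := by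
  have : y ∈ twoStepCentralizer ℒ i := by
    rw [C.centralizer_eq i h2 hi]; exact Submodule.mem_span_singleton_self y
  exact this.2 b hb

theorem IsFirstTwoCentralizers.two_lt (C : IsFirstTwoCentralizers ℒ q x y) : 2 < q := by
  refine lt_of_le_of_ne C.two_le fun h => C.span_ne ?_
  rw [← C.centralizer_qb, ← C.centralizer_two, h]

theorem IsThin.span_pair (T : IsThin ℒ) (C : IsFirstTwoCentralizers ℒ q x y) :
    Submodule.span F {x, y} = ℒ 1 := by
  have hli : LinearIndependent F ![x, y] := by
    rw [LinearIndependent.pair_iff' C.x_ne_zero]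
    rintro a rfl
    have ha : a ≠ 0 := fun h => C.y_ne_zero (by rw [h, zero_smul])
    exact C.span_ne (Submodule.span_singleton_smul_eq (IsUnit.mk0 a ha) x).symm
  have hf := finrank_span_eq_card hli
  rw [Matrix.range_cons_cons_empty, Fintype.card_fin] at hf
  have : FiniteDimensional F (ℒ 1) :=
    FiniteDimensional.of_finrank_pos (by rw [T.finrank_one]; norm_num)
  refine Submodule.eq_of_le_of_finrank_eq ?_ (by rw [hf, T.finrank_one])
  rw [Submodule.span_le]
  rintro z (rfl | rfl)
  · exact C.x_mem.1
  · exact C.y_mem.1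

theorem IsThin.cover (T : IsThin ℒ) (C : IsFirstTwoCentralizers ℒ q x y) {i : ℕ} {u : L}
    (hi : 1 ≤ i) (hu : u ∈ ℒ i) (h0 : u ≠ 0) {t : L} (ht : t ∈ ℒ (i + 1)) :
    ∃ a b : F, t = a • ⁅u, x⁆ + b • ⁅u, y⁆ := by
  rw [← T.covering i hi u hu h0] at ht
  obtain ⟨z, hz, rfl⟩ := ht
  have hz' : z ∈ Submodule.span F {x, y} := by rw [T.span_pair C]; exact hz
  obtain ⟨a, b, rfl⟩ := Submodule.mem_span_pair.1 hz'
  exact ⟨a, b, by simp⟩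

theorem IsThin.ne_bot (T : IsThin ℒ) (D : IsSecondDiamond ℒ k) {i : ℕ} (hi : 1 ≤ i)
    (hk : i ≤ k) : ℒ i ≠ ⊥ := by
  intro h
  have : ∀ j, ℒ (i + j) = ⊥ := fun j => by
    induction j with
    | zero => exact h
    | succ j ih => exact T.eq_bot_succ (i + j) (by omega) ih
  obtain ⟨j, rfl⟩ := Nat.exists_eq_add_of_le hk
  have h2 := D.2.1
  rw [this j, finrank_bot] at h2
  omega

theorem IsThin.finrank_eq_one (T : IsThin ℒ) (D : IsSecondDiamond ℒ k)
    (C : IsFirstTwoCentralizers ℒ q x y) {i : ℕ} (hi : 2 ≤ i) (hk : i < k) :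
    Module.finrank F (ℒ i) = 1 := by
  classical
  obtain ⟨j, rfl⟩ : ∃ j, i = j + 1 := ⟨i - 1, by omega⟩
  obtain ⟨u, hu, h0⟩ := (Submodule.ne_bot_iff _).1 (T.ne_bot D (i := j) (by omega) (by omega))
  have hle : ℒ (j + 1) ≤ Submodule.span F (({⁅u, x⁆, ⁅u, y⁆} : Finset L) : Set L) := by
    intro t ht
    obtain ⟨a, b, rfl⟩ := T.cover C (by omega) hu h0 ht
    simp only [Finset.coe_insert, Finset.coe_singleton]
    exact Submodule.mem_span_pair.2 ⟨a, b, rfl⟩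
  have h1 := Submodule.finrank_mono hle
  have h2 := finrank_span_finset_le_card (R := F) ({⁅u, x⁆, ⁅u, y⁆} : Finset L)
  have h3 : ({⁅u, x⁆, ⁅u, y⁆} : Finset L).card ≤ 2 := Finset.card_le_two
  have h4 := D.2.2 (j + 1) (by omega) hk
  have : FiniteDimensional F (ℒ (j + 1)) := Submodule.finiteDimensional_of_le hle
  have h5 : 0 < Module.finrank F (ℒ (j + 1)) := by
    rw [Module.finrank_pos_iff, Submodule.nontrivial_iff_ne_bot]
    exact T.ne_bot D (by omega) (by omega)
  rw [Set.finrank] at h2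
  omega

variable [CharP F 2]

theorem IsThin.frame (T : IsThin ℒ) (D : IsSecondDiamond ℒ k)
    (C : IsFirstTwoCentralizers ℒ q x y) :
    Frame ℒ k q x y (LieAlgebra.ad F L x) (LieAlgebra.ad F L y) := by
  have hX : ∀ u, LieAlgebra.ad F L x u = ⁅u, x⁆ := fun u => by
    rw [LieAlgebra.ad_apply, lie_comm_char_two F]
  have hY : ∀ u, LieAlgebra.ad F L y u = ⁅u, y⁆ := fun u => by
    rw [LieAlgebra.ad_apply, lie_comm_char_two F]
  have hcover : ∀ {i : ℕ} {u : L}, 1 ≤ i → u ∈ ℒ i → u ≠ 0 → ∀ t ∈ ℒ (i + 1),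
      ∃ a b : F, t = a • LieAlgebra.ad F L x u + b • LieAlgebra.ad F L y u := by
    intro i u hi hu h0 t ht
    rw [hX, hY]
    exact T.cover C hi hu h0 ht
  have hk1 := D.1
  have hxy : ⁅x, y⁆ ≠ 0 := by
    intro h
    apply T.ne_bot D (i := 2) (by norm_num) hk1
    rw [eq_bot_iff]
    intro t ht
    obtain ⟨a, b, rfl⟩ := T.cover C le_rfl C.x_mem.1 C.x_ne_zero ht
    simp [h]
  have hk3 : 3 ≤ k := by
    by_contra h
    obtain rfl : k = 2 := by omega
    have h1 : ℒ 2 ≤ Submodule.span F {⁅x, y⁆} := by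
      intro t ht
      obtain ⟨a, b, rfl⟩ := T.cover C le_rfl C.x_mem.1 C.x_ne_zero ht
      rw [lie_self, smul_zero, zero_add]
      exact Submodule.smul_mem _ _ (Submodule.mem_span_singleton_self _)
    have h2 := Submodule.finrank_mono h1
    rw [D.2.1, finrank_span_singleton hxy] at h2
    omega
  have hindep : ∀ {v : L}, v ∈ ℒ (k - 1) → v ≠ 0 → ∀ a b : F,
      a • LieAlgebra.ad F L x v + b • LieAlgebra.ad F L y v = 0 → a = 0 ∧ b = 0 := by
    intro v hv h0 a b hab
    have hmem : ∀ z ∈ ℒ 1, ⁅v, z⁆ ∈ ℒ k := fun z hz => by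
      have := T.graded.bracket_mem (k - 1) 1 v hv z hz
      rwa [Nat.sub_add_cancel (by omega)] at this
    have hspan : Submodule.span F (Set.range ![⁅v, x⁆, ⁅v, y⁆]) = ℒ k := by
      rw [Matrix.range_cons_cons_empty]
      apply le_antisymm
      · rw [Submodule.span_le]
        rintro z (rfl | rfl)
        · exact hmem x C.x_mem.1
        · exact hmem y C.y_mem.1
      · intro t ht
        rw [show k = k - 1 + 1 by omega] at ht
        obtain ⟨a, b, rfl⟩ := T.cover C (by omega) hv h0 ht
        exact Submodule.mem_span_pair.2 ⟨a, b, rfl⟩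
    have hli : LinearIndependent F ![⁅v, x⁆, ⁅v, y⁆] := by
      rw [linearIndependent_iff_card_eq_finrank_span, Set.finrank, hspan, D.2.1, Fintype.card_fin]
    rw [hX, hY] at hab
    exact LinearIndependent.pair_iff.1 hli a b hab
  have hq2 := C.two_lt
  -- No nonzero element of degree one centralizes degree k - 1. So q = k - 1 is impossible because
  -- of x, and q ≥ k because of y.
  have hqk : q + 2 ≤ k := by
    by_contra h
    obtain ⟨v, hv, h0⟩ := (Submodule.ne_bot_iff _).1
      (T.ne_bot D (i := k - 1) (by omega) (by omega))
    rcases Nat.lt_or_ge q k with h1 | h1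
    · have h2 := hindep hv h0 1 0 (by
        rw [one_smul, zero_smul, add_zero]
        exact C.x_mem.2 v (by rwa [show k - 1 = q by omega] at hv))
      exact one_ne_zero h2.1
    · have h2 := hindep hv h0 0 1 (by
        rw [one_smul, zero_smul, zero_add]
        exact C.lie_y (by omega) (by omega) hv)
      exact one_ne_zero h2.2
  exact {
    derX := IsDer.ad x
    derY := IsDer.ad y
    lie_y := fun u => (hY u).symm
    X_x := by simp
    Y_y := by simp
    Y_x := by rw [hY]; rfl
    y_mem := C.y_mem.1
    X_y_ne := hxy
    X_mem := fun {i u} hu => by rw [hX]; exact T.graded.bracket_mem i 1 u hu x C.x_mem.1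
    Y_mem := fun {i u} hu => by rw [hY]; exact T.graded.bracket_mem i 1 u hu y C.y_mem.1
    lie_mem := fun {i j u w} hu hw => T.graded.bracket_mem i j u hu w hw
    cover := hcover
    bot_succ := fun {i} hi h => T.eq_bot_succ i hi h
    ne_bot := fun {i} h1 h2 => T.ne_bot D h1 h2
    line := fun {i} h1 h2 {u w} hu h0 hw => by
      obtain ⟨a, ha⟩ := (finrank_eq_one_iff_of_nonzero' (⟨u, hu⟩ : ℒ i)
        (fun h => h0 (congrArg Subtype.val h))).1 (T.finrank_eq_one D C h1 h2) ⟨w, hw⟩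
      exact ⟨a, (congrArg Subtype.val ha).symm⟩
    indep := hindep
    two_le := hq2.le
    q_le := hqk
    low := fun i h1 h2 u hu => C.lie_y h1 h2 hu
    X_q := fun u hu => C.x_mem.2 u hu
    der_zero := by
      intro δ hδ hx hy
      have h1 : ∀ i, ∀ u ∈ ℒ (i + 1), δ u = 0 := by
        intro i
        induction i with
        | zero =>
          intro u hu
          rw [zero_add, ← T.span_pair C] at hu
          obtain ⟨a, b, rfl⟩ := Submodule.mem_span_pair.1 hu
          rw [map_add, map_smul, map_smul, hx, hy, smul_zero, smul_zero, add_zero]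
        | succ i ih =>
          intro t ht
          by_cases hb : ℒ (i + 1) = ⊥
          · rw [T.eq_bot_succ _ (by omega) hb] at ht
            rw [(Submodule.mem_bot F).1 ht, map_zero]
          · obtain ⟨u, hu, h0⟩ := (Submodule.ne_bot_iff _).1 hb
            obtain ⟨a, b, rfl⟩ := T.cover C (by omega) hu h0 ht
            rw [map_add, map_smul, map_smul, hδ, hδ, ih u hu, hx, hy]
            simp
      have h2 : (⊤ : Submodule F L) ≤ LinearMap.ker δ := by
        rw [← T.graded.upper_one]
        refine upper_le fun i hi u hu => ?_
        obtain ⟨j, rfl⟩ : ∃ j, i = j + 1 := ⟨i - 1, by omega⟩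
        exact h1 j u hu
      ext u
      exact h2 (Submodule.mem_top (x := u)) }

theorem IsThin.liePower_eq (T : IsThin ℒ) (C : IsFirstTwoCentralizers ℒ q x y) (n : ℕ) :
    LieSubmodule.toSubmodule (liePower F L (n + 1)) = upper ℒ (n + 1) := by
  refine T.graded.liePower_eq (fun i hi t ht => ?_) n
  by_cases hb : ℒ i = ⊥
  · rw [T.eq_bot_succ _ hi hb] at ht
    exact ⟨0, 0, 0, zero_mem _, 0, zero_mem _, by rw [(Submodule.mem_bot F).1 ht]; simp⟩
  · obtain ⟨u, hu, h0⟩ := (Submodule.ne_bot_iff _).1 hb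
    obtain ⟨a, b, rfl⟩ := T.cover C hi hu h0 ht
    refine ⟨x, y, a • u, (ℒ i).smul_mem _ hu, b • u, (ℒ i).smul_mem _ hu, ?_⟩
    rw [lie_comm_char_two F x, lie_comm_char_two F y, smul_lie, smul_lie]

/-- The quotient of a thin Lie algebra by a Lie power before the second diamond. -/
theorem IsThin.isMaximalClass_quotient (T : IsThin ℒ) (D : IsSecondDiamond ℒ k)
    (C : IsFirstTwoCentralizers ℒ q x y) {n : ℕ} (h1 : 1 ≤ n) (hn : n < k) :
    IsMaximalClass (quotientGrading (liePower F L (n + 1)) ℒ) := by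
  have hI := T.liePower_eq C n
  have G := T.graded.quotient hI
  have hmk : ∀ u, LieSubmodule.Quotient.mk' (liePower F L (n + 1)) u = 0 ↔
      u ∈ upper ℒ (n + 1) := fun u => by
    rw [LieSubmodule.Quotient.mk_eq_zero, ← hI]; rfl
  refine ⟨G, ?_, fun i hi => ?_, fun i hi => le_antisymm ?_ ?_⟩
  · rw [quotientGrading, ← LinearMap.range_domRestrict, LinearMap.finrank_range_of_inj,
      T.finrank_one]
    rw [← LinearMap.ker_eq_bot, LinearMap.ker_eq_bot']
    rintro ⟨u, hu⟩ h
    exact Subtype.ext (T.graded.eq_zero_of_mem_upper (by omega) hu ((hmk u).1 h))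
  · rcases Nat.lt_or_ge i k with h | h
    · refine (rank_map_le _ _).trans ?_
      have h2 := T.finrank_eq_one D C hi h
      have : FiniteDimensional F (ℒ i) := FiniteDimensional.of_finrank_pos (by omega)
      rw [← Module.finrank_eq_rank, h2]
      simp
    · have : quotientGrading (liePower F L (n + 1)) ℒ i = ⊥ := by
        rw [eq_bot_iff]
        rintro _ ⟨u, hu, rfl⟩
        exact (hmk u).2 (le_upper (by omega) hu)
      rw [this, rank_bot]
      exact zero_le
  · rw [Submodule.span_le]
    rintro _ ⟨u, hu, w, hw, rfl⟩
    exact G.bracket_mem i 1 u hu w hw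
  · rintro _ ⟨t, ht, rfl⟩
    by_cases hb : ℒ i = ⊥
    · rw [T.eq_bot_succ _ hi hb] at ht
      rw [(Submodule.mem_bot F).1 ht, map_zero]
      exact zero_mem _
    · obtain ⟨u, hu, h0⟩ := (Submodule.ne_bot_iff _).1 hb
      obtain ⟨a, b, rfl⟩ := T.cover C hi hu h0 ht
      rw [← lie_smul, ← lie_smul, ← lie_add]
      exact Submodule.subset_span ⟨_, ⟨u, hu, rfl⟩, _, ⟨a • x + b • y,
        (ℒ 1).add_mem ((ℒ 1).smul_mem _ C.x_mem.1) ((ℒ 1).smul_mem _ C.y_mem.1), rfl⟩, rfl⟩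

/-- A bound on the dimension in terms of the last component that is not zero. -/
theorem IsThin.ne_bot_of_rank (T : IsThin ℒ) (D : IsSecondDiamond ℒ k)
    (C : IsFirstTwoCentralizers ℒ q x y)
    (hdim : ((4 * k + 1 : ℕ) : Cardinal) < 3 * Module.rank F L) {M : ℕ} (hM : k ≤ M)
    (hs : ∀ i, k < i → i ≤ M → ∃ u, SpannedBy ℒ i u) (h3 : 3 * (M + 2) ≤ 4 * k + 1) :
    ℒ (M + 1) ≠ ⊥ := by
  classical
  intro hbot
  have hS := T.frame D C
  have hqk := hS.q_le
  obtain ⟨v, hv, h0⟩ := hS.exists_ne (i := k - 1) (by omega) (by omega)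
  have hg : ∀ i, ∃ g : L, 1 ≤ i → i ≤ M → ℒ i ≤ Submodule.span F {g, x, ⁅v, x⁆} := by
    intro i
    by_cases h1 : i = 1
    · refine ⟨y, fun _ _ => ?_⟩
      rw [h1, ← T.span_pair C]
      refine Submodule.span_mono ?_
      rintro z (rfl | rfl) <;> simp
    by_cases h2 : i = k
    · refine ⟨⁅v, y⁆, fun _ _ t ht => ?_⟩
      rw [h2, show k = k - 1 + 1 by omega] at ht
      obtain ⟨a, b, rfl⟩ := T.cover C (by omega) hv h0 ht
      exact Submodule.add_mem _
        (Submodule.smul_mem _ _ (Submodule.subset_span (by simp)))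
        (Submodule.smul_mem _ _ (Submodule.subset_span (by simp)))
    by_cases h4 : 1 ≤ i ∧ i ≤ M
    · have : ∃ u, SpannedBy ℒ i u := by
        rcases Nat.lt_or_ge i k with h | h
        · obtain ⟨u, hu, hu0⟩ := hS.exists_ne h4.1 h.le
          exact ⟨u, hu, fun w hw => hS.line (by omega) h hu hu0 hw⟩
        · exact hs i (by omega) h4.2
      obtain ⟨u, -, hu⟩ := this
      refine ⟨u, fun _ _ t ht => ?_⟩
      obtain ⟨a, rfl⟩ := hu t ht
      exact Submodule.smul_mem _ _ (Submodule.subset_span (by simp))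
    · exact ⟨0, fun h h' => absurd ⟨h, h'⟩ h4⟩
  choose g hg using hg
  have hz : ∀ j, ℒ (M + 1 + j) = ⊥ := fun j => by
    induction j with
    | zero => exact hbot
    | succ j ih => exact T.eq_bot_succ (M + 1 + j) (by omega) ih
  -- One generator for each degree up to M, and one more for each of the two diamonds: x in degree 1
  -- and [v, x] in degree k. This gives at most M + 2 generators.
  set s : Finset L := insert x (insert ⁅v, x⁆ ((Finset.Icc 1 M).image g)) with hsdef
  have hcard : s.card ≤ M + 2 := by
    refine (Finset.card_insert_le _ _).trans ?_
    refine Nat.succ_le_succ ((Finset.card_insert_le _ _).trans ?_)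
    refine Nat.succ_le_succ (Finset.card_image_le.trans ?_)
    simp
  have htop : Submodule.span F (s : Set L) = ⊤ := by
    rw [eq_top_iff, ← T.graded.upper_one]
    refine upper_le fun i hi => ?_
    rcases Nat.lt_or_ge M i with h | h
    · obtain ⟨j, rfl⟩ := Nat.exists_eq_add_of_lt h
      rw [add_right_comm, hz]
      exact bot_le
    · refine (hg i hi h).trans (Submodule.span_mono ?_)
      have : g i ∈ (Finset.Icc 1 M).image g :=
        Finset.mem_image_of_mem g (Finset.mem_Icc.2 ⟨hi, h⟩)
      rintro z (rfl | rfl | rfl)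
      · simp only [hsdef, Finset.mem_coe, Finset.mem_insert]
        exact Or.inr (Or.inr this)
      · simp [hsdef]
      · simp [hsdef]
  have hrank : Module.rank F L ≤ ((M + 2 : ℕ) : Cardinal) := by
    rw [← rank_top, ← htop]
    refine (rank_span_finset_le s).trans ?_
    exact_mod_cast hcard
  have h5 : ((4 * k + 1 : ℕ) : Cardinal) < ((3 * (M + 2) : ℕ) : Cardinal) := by
    refine hdim.trans_le ?_
    rw [Nat.cast_mul]
    exact mul_le_mul' (by norm_num) hrank
  have h6 : 4 * k + 1 < 3 * (M + 2) := by exact_mod_cast h5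
  omega

end Thin
end ThinLie

namespace ThinLie

/-! ### Nottingham type and the list of noncentralized degrees -/

section Classification

variable {F L : Type*} [Field F] [CharP F 2] [LieRing L] [LieAlgebra F L]
variable {ℒ : ℕ → Submodule F L} {k q : ℕ} {x y : L}

theorem Frame.lie_eq_zero_of_le {X Y : Module.End F L} (S : Frame ℒ k q x y X Y) {i j : ℕ} {u w : L}
    (hi : 2 ≤ i) (hj : 2 ≤ j) (hij : i + j ≤ q) (hu : u ∈ ℒ i) (hw : w ∈ ℒ j) : ⁅u, w⁆ = 0 := by
  have hqk := S.q_le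
  obtain ⟨m, rfl⟩ : ∃ m, i = m + 1 := ⟨i - 1, by omega⟩
  obtain ⟨n, rfl⟩ : ∃ n, j = n + 1 := ⟨j - 1, by omega⟩
  obtain ⟨a, rfl⟩ := S.line (by omega) (by omega) (S.b_mem rfl) (S.b_ne (by omega)) hu
  obtain ⟨b, rfl⟩ := S.line (by omega) (by omega) (S.b_mem rfl) (S.b_ne (by omega)) hw
  rw [smul_lie, lie_smul, S.derX.lie_pow_zero, smul_zero, smul_zero]
  intro l hl
  rw [S.lie_y, pow_apply_pow]
  exact S.Y_b (by omega)

theorem IsThin.isMetabelian (T : IsThin ℒ) (D : IsSecondDiamond ℒ k)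
    (C : IsFirstTwoCentralizers ℒ q x y) : IsMetabelian F (L ⧸ liePower F L (q + 1)) := by
  have S := T.frame D C
  rw [isMetabelian_quotient_iff, derivedSeries_one_eq_liePower]
  intro a ha b hb
  rw [← LieSubmodule.mem_toSubmodule, T.liePower_eq C] at ha hb ⊢
  refine lie_mem_of_upper (fun i j hi hj u hu w hw => ?_) ha hb
  rcases Nat.lt_or_ge q (i + j) with h | h
  · exact le_upper h (S.lie_mem hu hw)
  · rw [S.lie_eq_zero_of_le hi hj h hu hw]
    exact zero_mem _

/-- [X^(q-2) y, Xy] = Yw is a nonzero element of degree q + 1. -/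
theorem IsThin.not_isMetabelian (T : IsThin ℒ) (D : IsSecondDiamond ℒ k)
    (C : IsFirstTwoCentralizers ℒ q x y) : ¬ IsMetabelian F (L ⧸ liePower F L (q + 2)) := by
  have S := T.frame D C
  have hq := C.two_lt
  rw [isMetabelian_quotient_iff, derivedSeries_one_eq_liePower]
  intro h
  have hmem : ∀ i, 2 ≤ i → ∀ u ∈ ℒ i, u ∈ liePower F L 2 := fun i hi u hu => by
    rw [← LieSubmodule.mem_toSubmodule, T.liePower_eq C]
    exact le_upper hi hu
  have h1 := h _ (hmem (q - 1) (by omega) _ (S.b_mem (n := q - 2) (by omega))) _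
    (hmem 2 le_rfl _ (S.b_mem (n := 1) rfl))
  have h2 : ⁅(LieAlgebra.ad F L x ^ (q - 2)) y, (LieAlgebra.ad F L x ^ 1) y⁆ =
      LieAlgebra.ad F L y ((LieAlgebra.ad F L x ^ (q - 1)) y) := by
    rw [S.derX.lie_pow_one (m := 1), S.lie_y, pow_apply_pow, show 1 + (q - 2) = q - 1 by omega]
    · simp
    · intro l hl _
      rw [S.lie_y, pow_apply_pow]
      exact S.Y_b (by omega)
    · intro l hl hl2; omega
  rw [h2, ← LieSubmodule.mem_toSubmodule, T.liePower_eq C] at h1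
  exact S.Y_w_ne (T.graded.eq_zero_of_mem_upper (Nat.lt_succ_self (q + 1)) (S.Y_mem S.w_mem) h1)

theorem IsThin.isNottingham (T : IsThin ℒ) (D : IsSecondDiamond ℒ k)
    (C : IsFirstTwoCentralizers ℒ q x y) : IsNottinghamWithFakeSecondDiamond ℒ q := by
  have S := T.frame D C
  have hqk := S.q_le
  exact ⟨inferInstance, T, T.isMetabelian D C,
    T.isMaximalClass_quotient D C (n := q + 1) (by omega) (by omega), T.not_isMetabelian D C⟩

/-- The components before the second diamond which are not centralized by `y`. -/
theorem IsThin.exists_classification (T : IsThin ℒ) (D : IsSecondDiamond ℒ k)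
    (C : IsFirstTwoCentralizers ℒ q x y)
    (hdim : ((4 * k + 1 : ℕ) : Cardinal) < 3 * Module.rank F L) {e : ℕ} (he : 3 ≤ e)
    (hq : q = 2 ^ e) :
    ∃ s, k + 1 = 2 ^ (s + 1) * q ∧
      (∀ m, 2 ≤ m → m < 2 ^ (s + 1) → ∃ A ∈ ℒ (m * q - 1), ⁅x, A⁆ = 0 ∧ ⁅y, A⁆ ≠ 0) ∧
      ∀ i, q < i → i + 1 < k → (∀ m, 2 ≤ m → m < 2 ^ (s + 1) → i ≠ m * q - 1) →
        Normal ℒ (LieAlgebra.ad F L y) i := by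
  have S := T.frame D C
  have hqk := S.q_le
  have hq8 : 8 ≤ q := by
    rw [hq]; calc 8 = 2 ^ 3 := by norm_num
      _ ≤ 2 ^ e := Nat.pow_le_pow_right (by norm_num) he
  have hbound : ∀ M, k ≤ M → (∀ i, k < i → i ≤ M → ∃ u, SpannedBy ℒ i u) →
      3 * (M + 2) ≤ 4 * k + 1 → ℒ (M + 1) ≠ ⊥ := fun M h1 h2 h3 =>
    T.ne_bot_of_rank D C hdim h1 h2 h3
  obtain ⟨d, t, τ, v, ρ, R⟩ := S.exists_tail he hq
    (hbound k le_rfl (fun i h1 h2 => by omega) (by omega))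
  -- Degree q itself is not centralized by y, so t ≥ q + q/2. Then k is large enough for the
  -- dimension bound to reach degree k + q/2 + 1.
  have hbig : q < t → ℒ (k + q / 2 + 1) ≠ ⊥ := by
    intro hqt
    have hte := R.t_eq
    have h1 : q + q / 2 ≤ t := by
      by_contra h
      exact S.not_normal_q (S.half_le_gap he hq t R.q_le (by have := R.t_lt; omega)
        R.not_normal_t q hqt (by omega))
    refine hbound _ (by omega) (fun i h2 h3 => ?_) (by rcases R.hd with h | h <;> omega)
    obtain ⟨a, rfl⟩ := Nat.exists_eq_add_of_lt h2
    exact ⟨_, R.spanned_pow (a := a + 1) (by omega) (by omega)⟩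
  rcases R.hd with rfl | rfl
  · have hb := hbig R.lt_t
    obtain ⟨N, hN, hk, hlink, hnor⟩ := R.exists_chain hb
    have hke := R.k_eq
    have hmul : (N - 1) * q + q = N * q := by
      rw [← Nat.succ_mul]; congr 1; omega
    have hlast := hlink (N - 1) (by omega) (by omega)
    obtain ⟨a, ha⟩ := R.smul_τ (u := Tail.chain q y (LieAlgebra.ad F L x) (N - 2))
      (by convert hlast.mem using 2 <;> omega)
    have ha0 : a ≠ 0 := by
      rintro rfl
      apply hlast.Y_ne
      rw [show N - 1 - 1 = N - 2 by omega, ha, zero_smul, map_zero]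
    obtain ⟨s, rfl⟩ := (R.smul ha0).exists_two_pow hb hN hk
      (fun m h1 h2 => ⟨(hlink m h1 h2).mem, (hlink m h1 h2).X_eq⟩) hnor ha hbound
    obtain ⟨s, rfl⟩ : ∃ r, s = r + 1 := by
      refine ⟨s - 1, ?_⟩
      have : s ≠ 0 := by
        rintro rfl
        norm_num at hN
      omega
    exact ⟨s, hk, fun m h1 h2 => ⟨_, (hlink m h1 h2).mem, (hlink m h1 h2).X_eq,
      (hlink m h1 h2).Y_ne⟩, hnor⟩
  · have hte := R.t_eq
    have htq : t = q := by
      by_contra h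
      have hqt := lt_of_le_of_ne R.q_le (Ne.symm h)
      exact h (R.eq_of_two (hbig hqt))
    -- Here k = 2q - 1, so r = 1 and there is no m with 1 < m < 2r.
    refine ⟨0, by norm_num; omega, fun m h1 h2 => ?_, fun i h1 h2 _ => R.hbt i (by omega) h2⟩
    norm_num at h2
    omega

end Classification

end ThinLie

/-! ### The main theorem -/

theorem theorem3p1 {F : Type*} {L : Type*} [Field F] [CharP F 2] [LieRing L] [LieAlgebra F L]
    (ℒ : ℕ → Submodule F L) (hthin : ThinLie.IsThin ℒ)
    (k : ℕ) (hk : ThinLie.IsSecondDiamond ℒ k)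
    (hdim : ((4 * k + 1 : ℕ) : Cardinal) < 3 * Module.rank F L)
    (hnonmet : ¬ ThinLie.IsMetabelian F (L ⧸ ThinLie.liePower F L k))
    (hmet : ThinLie.IsMetabelian F (L ⧸ ThinLie.liePower F L 6))
    (qb : ℕ) (x y : L) (hxy : ThinLie.IsFirstTwoCentralizers ℒ qb x y) :
    (∃ e : ℕ, qb = 2 ^ e) ∧
    ThinLie.IsNottinghamWithFakeSecondDiamond ℒ qb ∧
    (∀ i : ℕ, 1 < i → i + 1 < k →
      (∀ u ∈ ℒ i, ⁅u, x⁆ = 0) ∨ (∀ u ∈ ℒ i, ⁅u, y⁆ = 0)) ∧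
    ∃ r : ℕ, (∃ s : ℕ, r = 2 ^ s) ∧ k + 1 = 2 * r * qb ∧
      ∀ h : ℕ, 1 < h → h < k →
        (ThinLie.IsFakeDiamondOfTypeOne ℒ x y h ↔
          h = qb ∨ ∃ m : ℕ, 1 < m ∧ m < 2 * r ∧ h + 1 = m * qb) := by
  have S := hthin.frame hk hxy
  have hX : ∀ u, ⁅u, x⁆ = LieAlgebra.ad F L x u := fun u => by
    rw [LieAlgebra.ad_apply, ThinLie.lie_comm_char_two F]
  have hY : ∀ u, ⁅u, y⁆ = LieAlgebra.ad F L y u := fun u => by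
    rw [LieAlgebra.ad_apply, ThinLie.lie_comm_char_two F]
  have hq2 := hxy.two_lt
  have hqk := S.q_le
  obtain ⟨e, he⟩ := S.exists_eq_two_pow
  -- Since q > 2, only q = 4 has to be excluded, and then L/L^(q+2) = L/L^6 would not be metabelian.
  have he3 : 3 ≤ e := by
    by_contra h
    have he2 : e = 2 := by
      interval_cases e
      · omega
      · omega
      · rfl
    subst he2
    have h1 := hthin.not_isMetabelian hk hxy
    rw [he] at h1
    exact h1 hmet
  obtain ⟨s, hks, hspecial, hnormal⟩ := hthin.exists_classification hk hxy hdim he3 he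
  have hq8 : 8 ≤ qb := by
    rw [he]; calc 8 = 2 ^ 3 := by norm_num
      _ ≤ 2 ^ e := Nat.pow_le_pow_right (by norm_num) he3
  have hmul : ∀ m n : ℕ, m ≤ n → m * qb ≤ n * qb := fun m n h => Nat.mul_le_mul_right _ h
  have hpos : 0 < 2 ^ s := by positivity
  have h2s : 2 ^ (s + 1) = 2 * 2 ^ s := by rw [pow_succ]; ring
  have hcases : ∀ i, 1 < i → i + 1 < k → ThinLie.Normal ℒ (LieAlgebra.ad F L y) i ∨
      (i = qb ∨ ∃ m, 1 < m ∧ m < 2 * 2 ^ s ∧ i + 1 = m * qb) := by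
    intro i h1 h2
    rcases Nat.lt_trichotomy i qb with h | h | h
    · exact Or.inl (S.low i h1 h)
    · exact Or.inr (Or.inl h)
    · by_cases hm : ∃ m, 1 < m ∧ m < 2 * 2 ^ s ∧ i + 1 = m * qb
      · exact Or.inr (Or.inr hm)
      · left
        refine hnormal i h h2 fun m h3 h4 h5 => hm ⟨m, h3, h2s ▸ h4, ?_⟩
        have := hmul 2 m h3
        omega
  have helem : ∀ i, (i = qb ∨ ∃ m, 1 < m ∧ m < 2 * 2 ^ s ∧ i + 1 = m * qb) →
      qb ≤ i ∧ i + 1 < k ∧ ∃ A ∈ ℒ i, LieAlgebra.ad F L x A = 0 ∧ LieAlgebra.ad F L y A ≠ 0 := by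
    rintro i (rfl | ⟨m, h1, h2, h3⟩)
    · exact ⟨le_rfl, by omega, _, S.w_mem, S.X_w, S.Y_w_ne⟩
    · have h4 := hmul 2 m h1
      have h5 := hmul (m + 1) (2 ^ (s + 1)) (by omega)
      have h6 : (m + 1) * qb = m * qb + qb := by ring
      obtain ⟨A, hA, hXA, hYA⟩ := hspecial m h1 (h2s ▸ h2)
      exact ⟨by omega, by omega, A, by convert hA using 2; omega, hXA, hYA⟩
  have hkill : ∀ i, (i = qb ∨ ∃ m, 1 < m ∧ m < 2 * 2 ^ s ∧ i + 1 = m * qb) →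
      ∀ u ∈ ℒ i, LieAlgebra.ad F L x u = 0 := by
    intro i hi u hu
    obtain ⟨h1, h2, A, hA, hXA, hYA⟩ := helem i hi
    obtain ⟨a, rfl⟩ := S.line (by omega) (by omega) hA (fun h => hYA (by rw [h, map_zero])) hu
    rw [map_smul, hXA, smul_zero]
  refine ⟨⟨e, he⟩, hthin.isNottingham hk hxy, fun i h1 h2 => ?_, 2 ^ s, ⟨s, rfl⟩,
    by rw [hks, h2s], fun h h1 h2 => ⟨?_, fun hh => ?_⟩⟩
  · rcases hcases i h1 h2 with h | h
    · exact Or.inr fun u hu => (hY u).trans (h u hu)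
    · exact Or.inl fun u hu => (hX u).trans (hkill i h u hu)
  · rintro ⟨⟨hne, w, hw0, hw, hxx, hyy, hxy'⟩, -⟩
    have hwm : w ∈ ℒ (h - 1) := by rw [hw]; exact Submodule.mem_span_singleton_self w
    have hh2 : h ≠ 2 := by
      rintro rfl
      have := hthin.finrank_one
      rw [show 1 = 2 - 1 by norm_num, hw, finrank_span_singleton hw0] at this
      omega
    rw [sub_self, zero_smul, one_smul] at hxy'
    simp only [hX, hY] at hxx hyy hxy'
    -- Type one says X(Yw) = 0, and Y(Yw) = 0 as well. A nonzero Yw would make the component of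
    -- degree h + 1 vanish.
    have hYw : LieAlgebra.ad F L y w = 0 := by
      by_contra h0
      exact hne (S.bot_of_zero (by omega) (S.Y_mem' hwm (by omega)) h0 hxy'.symm hyy)
    have hXw := S.X_ne (by omega) hwm hw0 hYw (S.ne_bot (by omega) (by omega))
    have hXm := S.X_mem' hwm (j := h) (by omega)
    have hnn : ¬ ThinLie.Normal ℒ (LieAlgebra.ad F L y) h := fun hn =>
      hne (S.bot_of_zero (by omega) hXm hXw hxx (hn _ hXm))
    rcases Nat.lt_or_ge (h + 1) k with h3 | h3
    · exact (hcases h h1 h3).resolve_left hnn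
    -- Degree k - 1 is not centralized by y either, but it carries no fake diamond of type one: X
    -- kills no nonzero element there, whereas X(Xw) = 0.
    · rw [show h = k - 1 by omega] at hXm
      exact absurd hxx (S.X_last_ne hXm hXw)
  · obtain ⟨h3, h4, A, hA, hXA, hYA⟩ := helem h hh
    have hA0 : A ≠ 0 := fun h => hYA (by rw [h, map_zero])
    obtain ⟨w, hw, hw0⟩ := S.exists_ne (i := h - 1) (by omega) (by omega)
    have hYw : LieAlgebra.ad F L y w = 0 :=
      S.half_le_gap he3 he h h3 h2 (fun hn => hYA (hn A hA)) (h - 1) (by omega) (by omega) w hw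
    refine ⟨⟨S.ne_bot (by omega) (by omega), w, hw0, ?_, ?_, ?_, ?_⟩, ?_⟩
    · apply le_antisymm
      · intro u hu
        obtain ⟨a, rfl⟩ := S.line (by omega) (by omega) hw hw0 hu
        exact Submodule.smul_mem _ _ (Submodule.mem_span_singleton_self w)
      · rw [Submodule.span_singleton_le_iff_mem]
        exact hw
    · rw [hX, hX]
      exact hkill h hh _ (S.X_mem' hw (by omega))
    · rw [hY w, hYw, zero_lie]
    · rw [sub_self, zero_smul, one_smul, hY w, hYw, zero_lie]
    · exact hthin.finrank_eq_one hk hxy h1 h2
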